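/- Let $(M,g)$ be a smooth $n$-dimensional Riemannian manifold without boundary (Hausdorff, second countable; no completeness, curvature or connectedness assumption), let $\phi:M\to\mathbf R$ be smooth, and let $\mathcal L_\phi u=\Delta u-\langle\nabla u,\nabla\phi\rangle$ be the drift Laplacian, acting componentwise on $\mathbf R^N$-valued functions. Integrals over $M$ are with respect to the Riemannian volume. Let $W^{1,2}_\phi$ be the weighted Sobolev space obtained by completing the smooth compactly supported functions $M\to\mathbf R^N$ in the norm $\|f\|_{W^{1,2}_\phi}^2=\int_M(|f|^2+|\nabla f|^2)\,e^{-\phi}$ (on a complete manifold it contains every smooth $f$ for which this norm is finite). Let $a<b$ and let $u:M\times[a,b]\to\mathbf R^N$ be smooth, with $u(\cdot,t),\,u_t(\cdot,t)\in W^{1,2}_\phi$ for each $t\in[a,b]$ and $$\int_a^b\|u_t(\cdot,t)\|_{W^{1,2}_\phi}^2\,dt<\infty .$$ Suppose that $$|(\partial_t-\mathcal L_\phi)u|(x,t)\le C(t)\,\bigl(|u|+|\nabla u|\bigr)(x,t)\qquad\text{for all }(x,t)\in M\times[a,b],$$ where $C:[a,b]\to[0,\infty)$ is measurable and bounded. Set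 $$I(t)=\int_M|u|^2e^{-\phi},\qquad D(t)=-\int_M|\nabla u|^2e^{-\phi},\qquad U(t)=\frac{D(t)}{I(t)}$$ (with $U(t)=0$ if $I(t)=0$). Then $$I(b)\ \ge\ I(a)\,\exp\left((b-a)\,\Bigl(2+\sup_{[a,b]}C\Bigr)\left[\exp\left(\int_a^bC^2(s)\,ds\right)\,[U(a)-1]+1-\frac32\,\sup_{[a,b]}C\right]\right).$$ In particular, if $u(\cdot,b)=0$, then $u\equiv0$ on $M\times[a,b]$. -/

import Mathlib

open scoped Manifold ContDiff
open MeasureTheory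

noncomputable section

namespace DriftHeat

/-- The time derivative `u_t` on the interval `[a, b]` (one-sided at its end points). -/
def timeDeriv {M : Type*} {N : ℕ} (a b : ℝ) (u : M → ℝ → EuclideanSpace ℝ (Fin N)) (t : ℝ)
    (x : M) :
    EuclideanSpace ℝ (Fin N) :=
  derivWithin (u x) (Set.Icc a b) t

variable {n N : ℕ} {M : Type*} [TopologicalSpace M]
  [ChartedSpace (EuclideanSpace ℝ (Fin n)) M] [IsManifold (𝓡 n) ∞ M]

/-- Smooth Riemannian metrics on an `n`-dimensional smooth manifold (without boundary). -/
abbrev RMetric (n : ℕ) (M : Type*) [TopologicalSpace M]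
    [ChartedSpace (EuclideanSpace ℝ (Fin n)) M] [IsManifold (𝓡 n) ∞ M] : Type _ :=
  Bundle.ContMDiffRiemannianMetric (𝓡 n) ∞ (EuclideanSpace ℝ (Fin n))
    (fun x : M => TangentSpace (𝓡 n) x)

/-- The `i`-th standard basis vector of `ℝⁿ`. -/
def stdVec (i : Fin n) : EuclideanSpace ℝ (Fin n) := EuclideanSpace.single i 1

/-- The `i`-th vector of the standard basis of `T_x M` (the tangent space of Mathlib is modelled
on `ℝⁿ` by means of the preferred chart at `x`). -/
def tangentVec (x : M) (i : Fin n) : TangentSpace (𝓡 n) x := stdVec i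

/-- The Gram matrix of the metric at `x` in the standard basis of `T_x M`. -/
def gram (g : RMetric n M) (x : M) : Matrix (Fin n) (Fin n) ℝ :=
  Matrix.of fun i j => g.inner x (tangentVec x i) (tangentVec x j)

/-- The directional derivative `df(v)` of a real function. -/
def dirDeriv (f : M → ℝ) (x : M) (v : TangentSpace (𝓡 n) x) : ℝ := mfderiv (𝓡 n) 𝓘(ℝ, ℝ) f x v

/-- The gradient `∇f` of a real function, with components `∑ⱼ gⁱʲ ∂ⱼf`; it is the vector such that
`g(∇f, v) = df(v)` for all `v`. -/
def riemGrad (g : RMetric n M) (f : M → ℝ) (x : M) : TangentSpace (𝓡 n) x :=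
  ∑ i, ∑ j, ((gram g x)⁻¹ i j * dirDeriv f x (tangentVec x j)) • tangentVec x i

/-- `⟨∇f, ∇h⟩` for real functions. -/
def gradInner (g : RMetric n M) (f h : M → ℝ) (x : M) : ℝ :=
  g.inner x (riemGrad g f x) (riemGrad g h x)

/-- The coordinate vector field `∂ᵢ` of the chart around `p`, at the point of `M` whose coordinates
in this chart are `y`. -/
def coordVec (p : M) (y : EuclideanSpace ℝ (Fin n)) (i : Fin n) :
    TangentSpace (𝓡 n) ((extChartAt (𝓡 n) p).symm y) :=
  mfderiv 𝓘(ℝ, EuclideanSpace ℝ (Fin n)) (𝓡 n) (extChartAt (𝓡 n) p).symm y (stdVec i)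

/-- The matrix `(gᵢⱼ) = (g(∂ᵢ, ∂ⱼ))` of the metric in the chart around `p`. -/
def chartGram (g : RMetric n M) (p : M) (y : EuclideanSpace ℝ (Fin n)) :
    Matrix (Fin n) (Fin n) ℝ :=
  Matrix.of fun i j =>
    g.inner ((extChartAt (𝓡 n) p).symm y) (coordVec p y i) (coordVec p y j)

/-- The volume density `√det(gᵢⱼ)` in the chart around `p`. -/
def chartDensity (g : RMetric n M) (p : M) (y : EuclideanSpace ℝ (Fin n)) : ℝ :=
  Real.sqrt (chartGram g p y).det

/-- The coordinates, in the chart around `p`, of a tangent vector `v` at `x`. -/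
def chartCoords (p x : M) (v : TangentSpace (𝓡 n) x) : EuclideanSpace ℝ (Fin n) :=
  mfderiv (𝓡 n) 𝓘(ℝ, EuclideanSpace ℝ (Fin n)) (extChartAt (𝓡 n) p) x v

/-- The `i`-th component, in the chart around `p`, of a vector field on `M`, as a function of the
coordinates `y`. -/
def chartComponent (p : M) (X : ∀ x : M, TangentSpace (𝓡 n) x) (i : Fin n)
    (y : EuclideanSpace ℝ (Fin n)) : ℝ :=
  chartCoords p ((extChartAt (𝓡 n) p).symm y) (X ((extChartAt (𝓡 n) p).symm y)) i

/-- The Riemannian divergence `div X = (1/√det g) ∑ᵢ ∂ᵢ(√det g Xⁱ)`, computed at `x` in the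
preferred chart at `x`. -/
def divergence (g : RMetric n M) (X : ∀ x : M, TangentSpace (𝓡 n) x) (x : M) : ℝ :=
  (chartDensity g x (extChartAt (𝓡 n) x x))⁻¹ *
    ∑ i, fderiv ℝ (fun y => chartDensity g x y * chartComponent x X i y)
      (extChartAt (𝓡 n) x x) (stdVec i)

/-- The Laplace-Beltrami operator `Δf = div ∇f` on real functions. -/
def laplacian (g : RMetric n M) (f : M → ℝ) (x : M) : ℝ :=
  divergence g (riemGrad g f) x

/-- The drift Laplacian `L_φ u = Δu - ⟨∇u, ∇φ⟩` of an `ℝᴺ`-valued function, taken componentwise. -/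
def driftLaplacian (g : RMetric n M) (φ : M → ℝ) (u : M → EuclideanSpace ℝ (Fin N)) (x : M) :
    EuclideanSpace ℝ (Fin N) :=
  WithLp.toLp 2 fun k =>
    laplacian g (fun y => u y k) x - gradInner g (fun y => u y k) φ x

/-- `|∇u|² = ∑ₖ |∇uᵏ|²` for an `ℝᴺ`-valued function `u`. -/
def gradNormSq (g : RMetric n M) (u : M → EuclideanSpace ℝ (Fin N)) (x : M) : ℝ :=
  ∑ k, gradInner g (fun y => u y k) (fun y => u y k) x

variable [MeasurableSpace M]

/-- The measure `√det(gᵢⱼ) dy` of the chart around `p`, carried over to the domain of this chart. -/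
def chartVolume (g : RMetric n M) (p : M) : Measure M :=
  Measure.map (extChartAt (𝓡 n) p).symm
    ((volume.restrict (extChartAt (𝓡 n) p).target).withDensity
      fun y => ENNReal.ofReal (chartDensity g p y))

/-- The Riemannian volume measure. The measures of any two charts agree where the charts overlap,
and the least measure above all of them is the one that agrees with each of them on the domain of
its chart. -/
def riemannianVolume (g : RMetric n M) : Measure M := ⨆ p : M, chartVolume g p

/-- The square `∫ (|f|² + |∇f|²) e^{-φ}` of the norm of `W^{1,2}_φ`, for differentiable `f`. -/
def sobolevSq (g : RMetric n M) (φ : M → ℝ) (f : M → EuclideanSpace ℝ (Fin N)) : ENNReal :=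
  ∫⁻ x, ENNReal.ofReal ((‖f x‖ ^ 2 + gradNormSq g f x) * Real.exp (-φ x)) ∂(riemannianVolume g)

/-- A smooth function `f` belongs to the weighted Sobolev space `W^{1,2}_φ`, the completion of the
smooth compactly supported functions in the norm of `W^{1,2}_φ`. (On a complete manifold this is
the case as soon as `|f|` and `|∇f|` are square integrable for the weight `e^{-φ}`.) -/
def MemSobolev (g : RMetric n M) (φ : M → ℝ) (f : M → EuclideanSpace ℝ (Fin N)) : Prop :=
  ∀ ε : ENNReal, 0 < ε → ∃ h : M → EuclideanSpace ℝ (Fin N),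
    ContMDiff (𝓡 n) 𝓘(ℝ, EuclideanSpace ℝ (Fin N)) ∞ h ∧ HasCompactSupport h ∧
      sobolevSq g φ (fun x => f x - h x) < ε

/-- `I = ∫ |u|² e^{-φ}`. -/
def energyI (g : RMetric n M) (φ : M → ℝ) (u : M → EuclideanSpace ℝ (Fin N)) : ℝ :=
  ∫ x, ‖u x‖ ^ 2 * Real.exp (-φ x) ∂(riemannianVolume g)

/-- `D = -∫ |∇u|² e^{-φ}`. -/
def energyD (g : RMetric n M) (φ : M → ℝ) (u : M → EuclideanSpace ℝ (Fin N)) : ℝ :=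
  -∫ x, gradNormSq g u x * Real.exp (-φ x) ∂(riemannianVolume g)

/-- The parabolic frequency `U = D / I`. -/
def frequencyU (g : RMetric n M) (φ : M → ℝ) (u : M → EuclideanSpace ℝ (Fin N)) : ℝ :=
  energyD g φ u / energyI g φ u

end DriftHeat

end

set_option linter.unusedSectionVars false

/-! ### The gradient as a Riesz representative. -/

namespace DriftHeat

section Frame

variable {n : ℕ} {V : Type*} [AddCommGroup V] [Module ℝ V] [TopologicalSpace V]
  (B : V →L[ℝ] V →L[ℝ] ℝ) (c : Module.Basis (Fin n) ℝ V)

/-! The theorem is a Gronwall argument for the parabolic frequency. Write `L` for the drift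
Laplacian, `f = u_t - L u`, `K = sup C`, and take all integrals against `e^{-φ} dvol`. Integration
by parts gives `D = ∫⟨u, Lu⟩` and `D' = 2∫⟨u_t, Lu⟩`, while `I' = 2∫⟨u, u_t⟩`. Polarizing in `u_t +
Lu` and `u_t - Lu = f`, `I D' - D I' = ½ (I ∫|u_t + Lu|² - (∫⟨u, u_t + Lu⟩)²) - ½ I ∫|f|² + ½ (∫⟨u,
f⟩)²`. The first bracket is nonnegative by Cauchy-Schwarz and the last square may be dropped. Since
`|f|² ≤ 2C²(|u|² + |∇u|²)`, what remains is at least `-C² I (I - D)`, that is `U' ≥ C² (U - 1)`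
wherever `I > 0` (`DriftInequality.frequency`). Hence `(U - 1) exp(-∫C²)` is nondecreasing, and `U ≥
m := exp(∫C²)(U(a) - 1) + 1` on the whole interval (`frequency_lower_bound`).

On the other hand `I' = 2D + 2∫⟨u, f⟩ ≥ (2 + C) D - 3C I` (`DriftInequality.growth`). Inserting `D ≥
m I` with `m ≤ 0` gives `I' ≥ ((2 + K) m - 3K) I`, which integrates to a bound slightly stronger
than the one claimed. The division by `I` is legitimate because the bound itself keeps `I` away from
zero up to a hypothetical first zero (`energy_lower_bound`). Started at an arbitrary time `t`
instead of `a`, the bound shows that `I(b) = 0` forces `I(t) = 0`, which is backward uniqueness.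

Two analytic points carry the argument. First, `M` need not be complete, so integration by parts
relies on membership in the closure of the compactly supported functions: Green's formula for
compactly supported test functions passes to the limit because `Lu = u_t - f` is square integrable
(`integral_inner_driftLaplacian`). Second, only the slices of `u` are known to be integrable, with
no assumed bound uniform in time; a pointwise Gronwall estimate in `t` bounds `|u|²` and `|∇u|²` by
their initial values plus time integrals of `|u_t|²` and `|∇u_t|²`, which gives joint integrability
and makes `I` and `D` absolutely continuous (`integral_eq_add_integral_deriv`). As `C` is only
measurable, the differential inequalities are integrated in the class of absolutely continuous
functions.

The geometric groundwork consists of the change of variables for the volume density, which makes the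
supremum of the chart measures restrict to the expected measure on each chart, and Green's formula,
from which the chart independence of the Laplacian is deduced weakly rather than by a tensor
computation. -/

theorem bilin_sum_sum (x y : Fin n → ℝ) (d : Fin n → V) :
    B (∑ i, x i • d i) (∑ j, y j • d j) = ∑ i, ∑ j, x i * y j * B (d i) (d j) := by
  simp only [map_sum, map_smul, sum_apply, smul_apply, smul_eq_mul, Finset.mul_sum]
  rw [Finset.sum_comm]
  refine Finset.sum_congr rfl fun i _ => Finset.sum_congr rfl fun j _ => ?_
  ring

theorem posDef_gramMatrix (hs : ∀ v w, B v w = B w v) (hp : ∀ v, v ≠ 0 → 0 < B v v) :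
    (Matrix.of fun i j => B (c i) (c j)).PosDef := by
  refine Matrix.PosDef.of_dotProduct_mulVec_pos ?_ fun x hx => ?_
  · exact Matrix.IsHermitian.ext fun i j => hs _ _
  · have h0 : ∑ i, x i • c i ≠ 0 := by
      intro h
      exact hx (funext fun i => by simpa using (Fintype.linearIndependent_iff.1 c.linearIndependent) x h i)
    have := hp _ h0
    rw [bilin_sum_sum] at this
    refine this.trans_eq (Finset.sum_congr rfl fun i _ => ?_)
    simp only [Matrix.mulVec, dotProduct, Matrix.of_apply, Finset.mul_sum, star_trivial]
    exact Finset.sum_congr rfl fun j _ => by ring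

/-- The Riesz representative of a linear functional, in terms of the Gram matrix of a basis. -/
theorem gramInv_representative (hs : ∀ v w, B v w = B w v) (hp : ∀ v, v ≠ 0 → 0 < B v v)
    (α : V →ₗ[ℝ] ℝ) (w : V) :
    B (∑ i, ∑ j, ((Matrix.of fun i j => B (c i) (c j))⁻¹ i j * α (c j)) • c i) w = α w := by
  set G : Matrix (Fin n) (Fin n) ℝ := Matrix.of fun i j => B (c i) (c j) with hG
  have hdet : IsUnit G.det := (posDef_gramMatrix B c hs hp).det_pos.ne'.isUnit
  suffices h : (B (∑ i, ∑ j, (G⁻¹ i j * α (c j)) • c i)).toLinearMap = α from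
    LinearMap.congr_fun h w
  refine c.ext fun k => ?_
  have h1 : ∀ i, G i k = B (c i) (c k) := fun i => rfl
  simp only [map_sum, map_smul, ContinuousLinearMap.coe_coe,
    sum_apply, smul_apply, smul_eq_mul, ← h1]
  have h2 : ∀ i, G i k = G k i := fun i => hs _ _
  rw [Finset.sum_comm]
  have h3 : ∀ j, ∑ i, G⁻¹ i j * α (c j) * G i k = (if k = j then α (c j) else 0) := by
    intro j
    have : ∑ i, G k i * G⁻¹ i j = (1 : Matrix (Fin n) (Fin n) ℝ) k j := by
      rw [← Matrix.mul_nonsing_inv G hdet, Matrix.mul_apply]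
    rw [Matrix.one_apply] at this
    calc _ = (∑ i, G k i * G⁻¹ i j) * α (c j) := by
          rw [Finset.sum_mul]
          refine Finset.sum_congr rfl fun i _ => ?_
          rw [h2]; ring
      _ = _ := by rw [this]; split_ifs <;> simp
  simp [h3]

end Frame

variable {n N : ℕ} {M : Type*} [TopologicalSpace M]
  [ChartedSpace (EuclideanSpace ℝ (Fin n)) M] [IsManifold (𝓡 n) ∞ M]

/-- The standard basis of `T_x M`. -/
noncomputable def tangentBasis (x : M) : Module.Basis (Fin n) ℝ (TangentSpace (𝓡 n) x) :=
  (EuclideanSpace.basisFun (Fin n) ℝ).toBasis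

theorem tangentBasis_apply (x : M) (i : Fin n) : tangentBasis x i = tangentVec x i := by
  exact (congrFun (EuclideanSpace.basisFun (Fin n) ℝ).coe_toBasis i).trans
    (EuclideanSpace.basisFun_apply _ _ i)

theorem inner_riemGrad (g : RMetric n M) (f : M → ℝ) (x : M) (v : TangentSpace (𝓡 n) x) :
    g.inner x (riemGrad g f x) v = dirDeriv f x v := by
  have := gramInv_representative (g.inner x) (tangentBasis x) (g.symm x) (g.pos x)
    (mfderiv (𝓡 n) 𝓘(ℝ, ℝ) f x).toLinearMap v
  simp only [tangentBasis_apply] at this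
  exact this

/-- Positive definiteness makes the representative unique. This frees the gradient from the standard
frame of its definition, so that it can be computed in the coordinate frame of any chart. -/
theorem riemGrad_eq_of_forall_inner (g : RMetric n M) (f : M → ℝ) (x : M)
    (w : TangentSpace (𝓡 n) x) (h : ∀ v, g.inner x w v = dirDeriv f x v) :
    riemGrad g f x = w := by
  by_contra hne
  have := g.pos x (riemGrad g f x - w) (sub_ne_zero.2 hne)
  rw [map_sub (g.inner x), sub_apply, inner_riemGrad, h] at this
  simp at this

theorem gradInner_eq_dirDeriv (g : RMetric n M) (f h : M → ℝ) (x : M) :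
    gradInner g f h x = dirDeriv f x (riemGrad g h x) := inner_riemGrad g f x _

theorem gradInner_comm (g : RMetric n M) (f h : M → ℝ) (x : M) :
    gradInner g f h x = gradInner g h f x := g.symm x _ _

theorem gradInner_self_nonneg (g : RMetric n M) (f : M → ℝ) (x : M) : 0 ≤ gradInner g f f x := by
  rcases eq_or_ne (riemGrad g f x) 0 with h | h
  · simp [gradInner, h]
  · exact (g.pos x _ h).le

theorem gradInner_sq_le (g : RMetric n M) (f h : M → ℝ) (x : M) :
    gradInner g f h x ^ 2 ≤ gradInner g f f x * gradInner g h h x := by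
  have key : ∀ s t : ℝ, 0 ≤ s ^ 2 * gradInner g f f x + 2 * s * t * gradInner g f h x
      + t ^ 2 * gradInner g h h x := by
    intro s t
    have h0 : ∀ v : TangentSpace (𝓡 n) x, 0 ≤ g.inner x v v := fun v => by
      rcases eq_or_ne v 0 with hv | hv
      · simp [hv]
      · exact (g.pos x _ hv).le
    have := h0 (s • riemGrad g f x + t • riemGrad g h x)
    simp only [map_add, map_smul, add_apply,
      smul_apply, smul_eq_mul] at this
    rw [g.symm x (riemGrad g h x) (riemGrad g f x)] at this
    unfold gradInner
    linarith
  have hA := gradInner_self_nonneg g f x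
  have hC := gradInner_self_nonneg g h x
  set A := gradInner g f f x
  set b := gradInner g f h x
  set C := gradInner g h h x
  rcases hA.eq_or_lt with h0 | h0
  · have hb : b = 0 := by
      by_contra hb
      -- With `A = 0` the form is affine in `s`; this `s` gives it the value `-2(C + 1) + C < 0`.
      have h1 := key (-(C + 1) / b) 1
      rw [← h0] at h1
      have h2 : 2 * (-(C + 1) / b) * 1 * b = -2 * (C + 1) := by field_simp
      linarith
    rw [hb, ← h0]; simp
  -- These values turn the form into `A (A C - b²)`.
  · have h1 := key (-b) A
    nlinarith

section Linearity

variable {g : RMetric n M} {f h k : M → ℝ} {x : M}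

theorem dirDeriv_sub (hf : MDifferentiableAt (𝓡 n) 𝓘(ℝ, ℝ) f x)
    (hh : MDifferentiableAt (𝓡 n) 𝓘(ℝ, ℝ) h x) (v : TangentSpace (𝓡 n) x) :
    dirDeriv (fun y => f y - h y) x v = dirDeriv f x v - dirDeriv h x v := by
  have := (hf.hasMFDerivAt.sub hh.hasMFDerivAt).mfderiv
  exact DFunLike.congr_fun this v

theorem dirDeriv_mul (hf : MDifferentiableAt (𝓡 n) 𝓘(ℝ, ℝ) f x)
    (hh : MDifferentiableAt (𝓡 n) 𝓘(ℝ, ℝ) h x) (v : TangentSpace (𝓡 n) x) :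
    dirDeriv (fun y => f y * h y) x v = f x * dirDeriv h x v + h x * dirDeriv f x v := by
  have := (hf.hasMFDerivAt.mul hh.hasMFDerivAt).mfderiv
  exact DFunLike.congr_fun this v

theorem gradInner_sub_left (hf : MDifferentiableAt (𝓡 n) 𝓘(ℝ, ℝ) f x)
    (hh : MDifferentiableAt (𝓡 n) 𝓘(ℝ, ℝ) h x) :
    gradInner g (fun y => f y - h y) k x = gradInner g f k x - gradInner g h k x := by
  simp only [gradInner_eq_dirDeriv, dirDeriv_sub hf hh]

theorem gradInner_mul_left (hf : MDifferentiableAt (𝓡 n) 𝓘(ℝ, ℝ) f x)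
    (hh : MDifferentiableAt (𝓡 n) 𝓘(ℝ, ℝ) h x) :
    gradInner g (fun y => f y * h y) k x
      = f x * gradInner g h k x + h x * gradInner g f k x := by
  simp only [gradInner_eq_dirDeriv, dirDeriv_mul hf hh]

end Linearity

theorem gradNormSq_nonneg (g : RMetric n M) (u : M → EuclideanSpace ℝ (Fin N)) (x : M) :
    0 ≤ gradNormSq g u x := Finset.sum_nonneg fun _ _ => gradInner_self_nonneg g _ x

end DriftHeat

/-! ### Metric, gradient and Laplacian in a chart. -/

namespace DriftHeat

section SmoothMatrix

variable {n : ℕ} {E : Type*} [NormedAddCommGroup E] [NormedSpace ℝ E] {s : Set E}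
  {A : E → Matrix (Fin n) (Fin n) ℝ}

theorem contDiffOn_det (hA : ∀ i j, ContDiffOn ℝ ∞ (fun y => A y i j) s) :
    ContDiffOn ℝ ∞ (fun y => (A y).det) s := by
  simp only [Matrix.det_apply]
  refine ContDiffOn.sum fun σ _ => ContDiffOn.const_smul _ ?_
  exact contDiffOn_prod fun i _ => hA _ _

theorem contDiffOn_inv (hA : ∀ i j, ContDiffOn ℝ ∞ (fun y => A y i j) s)
    (h0 : ∀ y ∈ s, (A y).det ≠ 0) (i j : Fin n) :
    ContDiffOn ℝ ∞ (fun y => (A y)⁻¹ i j) s := by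
  -- Cramer's rule: the entries of the inverse are quotients of determinants, which are polynomial
  -- in the entries.
  have : ∀ y, (A y)⁻¹ i j = ((A y).det)⁻¹ * ((A y).updateRow j (Pi.single i 1)).det := by
    intro y
    rw [Matrix.inv_def, Matrix.smul_apply, Matrix.adjugate_apply, Ring.inverse_eq_inv', smul_eq_mul]
  simp only [this]
  refine ((contDiffOn_det hA).inv h0).mul (contDiffOn_det fun k l => ?_)
  by_cases hk : k = j
  · subst hk
    simp only [Matrix.updateRow_self]
    exact contDiffOn_const
  · simp only [Matrix.updateRow_ne hk]
    exact hA k l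

end SmoothMatrix

variable {n N : ℕ} {M : Type*} [TopologicalSpace M]
  [ChartedSpace (EuclideanSpace ℝ (Fin n)) M] [IsManifold (𝓡 n) ∞ M]

variable {p : M} {y : EuclideanSpace ℝ (Fin n)}

theorem isOpen_target (p : M) : IsOpen (extChartAt (𝓡 n) p).target := isOpen_extChartAt_target p

theorem isInvertible_mfderiv_symm (hy : y ∈ (extChartAt (𝓡 n) p).target) :
    (mfderiv 𝓘(ℝ, EuclideanSpace ℝ (Fin n)) (𝓡 n) (extChartAt (𝓡 n) p).symm y).IsInvertible := by
  have := isInvertible_mfderivWithin_extChartAt_symm (I := 𝓡 n) hy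
  rwa [ModelWithCorners.range_eq_univ, mfderivWithin_univ] at this

/-- The basis of the tangent space given by the coordinate vector fields of a chart. -/
noncomputable def coordBasis (hy : y ∈ (extChartAt (𝓡 n) p).target) :
    Module.Basis (Fin n) ℝ (TangentSpace (𝓡 n) ((extChartAt (𝓡 n) p).symm y)) :=
  (tangentBasis (M := EuclideanSpace ℝ (Fin n)) y).map
    (isInvertible_mfderiv_symm hy).choose.toLinearEquiv

theorem coordBasis_apply (hy : y ∈ (extChartAt (𝓡 n) p).target) (i : Fin n) :
    coordBasis hy i = coordVec p y i := by
  rw [coordBasis, Module.Basis.map_apply, tangentBasis_apply]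
  exact DFunLike.congr_fun (isInvertible_mfderiv_symm hy).choose_spec _

theorem chartGram_posDef (g : RMetric n M) (hy : y ∈ (extChartAt (𝓡 n) p).target) :
    (chartGram g p y).PosDef := by
  have := posDef_gramMatrix (g.inner ((extChartAt (𝓡 n) p).symm y)) (coordBasis hy)
    (g.symm _) (g.pos _)
  simp only [coordBasis_apply] at this
  exact this

theorem chartDensity_pos (g : RMetric n M) (hy : y ∈ (extChartAt (𝓡 n) p).target) :
    0 < chartDensity g p y := Real.sqrt_pos.2 (chartGram_posDef g hy).det_pos

theorem mdifferentiableAt_symm (hy : y ∈ (extChartAt (𝓡 n) p).target) :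
    MDifferentiableAt 𝓘(ℝ, EuclideanSpace ℝ (Fin n)) (𝓡 n) (extChartAt (𝓡 n) p).symm y :=
  (mdifferentiableOn_extChartAt_symm y hy).mdifferentiableAt ((isOpen_target p).mem_nhds hy)

theorem dirDeriv_coordVec {f : M → ℝ} (hy : y ∈ (extChartAt (𝓡 n) p).target)
    (hf : MDifferentiableAt (𝓡 n) 𝓘(ℝ, ℝ) f ((extChartAt (𝓡 n) p).symm y)) (i : Fin n) :
    dirDeriv f ((extChartAt (𝓡 n) p).symm y) (coordVec p y i)
      = fderiv ℝ (f ∘ (extChartAt (𝓡 n) p).symm) y (stdVec i) := by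
  rw [← mfderiv_eq_fderiv, mfderiv_comp y hf (mdifferentiableAt_symm hy)]
  rfl

theorem riemGrad_eq_coord (g : RMetric n M) {f : M → ℝ} (hy : y ∈ (extChartAt (𝓡 n) p).target)
    (hf : MDifferentiableAt (𝓡 n) 𝓘(ℝ, ℝ) f ((extChartAt (𝓡 n) p).symm y)) :
    riemGrad g f ((extChartAt (𝓡 n) p).symm y) = ∑ i, ∑ j, ((chartGram g p y)⁻¹ i j *
      fderiv ℝ (f ∘ (extChartAt (𝓡 n) p).symm) y (stdVec j)) • coordVec p y i := by
  refine riemGrad_eq_of_forall_inner g f _ _ fun v => ?_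
  have := gramInv_representative (g.inner ((extChartAt (𝓡 n) p).symm y)) (coordBasis hy)
    (g.symm _) (g.pos _) (mfderiv (𝓡 n) 𝓘(ℝ, ℝ) f _).toLinearMap v
  simp only [coordBasis_apply] at this
  refine Eq.trans ?_ this
  simp only [← dirDeriv_coordVec hy hf]
  rfl

theorem gradInner_eq_coord (g : RMetric n M) {f h : M → ℝ}
    (hy : y ∈ (extChartAt (𝓡 n) p).target)
    (hf : MDifferentiableAt (𝓡 n) 𝓘(ℝ, ℝ) f ((extChartAt (𝓡 n) p).symm y))
    (hh : MDifferentiableAt (𝓡 n) 𝓘(ℝ, ℝ) h ((extChartAt (𝓡 n) p).symm y)) :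
    gradInner g f h ((extChartAt (𝓡 n) p).symm y) = ∑ i, ∑ j, (chartGram g p y)⁻¹ i j *
      fderiv ℝ (h ∘ (extChartAt (𝓡 n) p).symm) y (stdVec j) *
      fderiv ℝ (f ∘ (extChartAt (𝓡 n) p).symm) y (stdVec i) := by
  rw [gradInner_eq_dirDeriv, riemGrad_eq_coord g hy hh]
  simp only [← dirDeriv_coordVec hy hf]
  simp only [dirDeriv, map_sum, map_smul]
  rfl

theorem chartCoords_coordVec (hy : y ∈ (extChartAt (𝓡 n) p).target) (i : Fin n) :
    chartCoords p ((extChartAt (𝓡 n) p).symm y) (coordVec p y i) = stdVec i := by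
  have := mfderiv_extChartAt_comp_mfderivWithin_extChartAt_symm (I := 𝓡 n) hy
  rw [ModelWithCorners.range_eq_univ, mfderivWithin_univ] at this
  exact DFunLike.congr_fun this (stdVec i)

theorem chartComponent_riemGrad (g : RMetric n M) {f : M → ℝ}
    (hy : y ∈ (extChartAt (𝓡 n) p).target)
    (hf : MDifferentiableAt (𝓡 n) 𝓘(ℝ, ℝ) f ((extChartAt (𝓡 n) p).symm y)) (i : Fin n) :
    chartComponent p (riemGrad g f) i y = ∑ j, (chartGram g p y)⁻¹ i j *
      fderiv ℝ (f ∘ (extChartAt (𝓡 n) p).symm) y (stdVec j) := by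
  have h1 : chartCoords p ((extChartAt (𝓡 n) p).symm y) (riemGrad g f _)
      = ∑ i, ∑ j, ((chartGram g p y)⁻¹ i j *
      fderiv ℝ (f ∘ (extChartAt (𝓡 n) p).symm) y (stdVec j)) • stdVec i := by
    rw [riemGrad_eq_coord g hy hf]
    simp only [← chartCoords_coordVec hy, chartCoords, map_sum, map_smul]
    rfl
  rw [chartComponent, h1]
  simp only [← Finset.sum_smul]
  simp [stdVec, Pi.single_apply]

/-- The coordinate fields are smooth along the inverse chart, being its tangent map applied to
constant fields, and the metric is a smooth section of bilinear forms; evaluating one on the other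
gives a smooth function. -/
theorem contDiffOn_chartGram (g : RMetric n M) (p : M) (i j : Fin n) :
    ContDiffOn ℝ ∞ (fun y => chartGram g p y i j) (extChartAt (𝓡 n) p).target := by
  have hψ : ContMDiffOn 𝓘(ℝ, EuclideanSpace ℝ (Fin n)) (𝓡 n) ∞ (extChartAt (𝓡 n) p).symm
      (extChartAt (𝓡 n) p).target := contMDiffOn_extChartAt_symm p
  have hT : ∀ i : Fin n, ContMDiffOn 𝓘(ℝ, EuclideanSpace ℝ (Fin n)) (𝓡 n).tangent ∞
      (fun y => Bundle.TotalSpace.mk' (EuclideanSpace ℝ (Fin n))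
        (E := fun x : M => TangentSpace (𝓡 n) x) ((extChartAt (𝓡 n) p).symm y) (coordVec p y i))
      (extChartAt (𝓡 n) p).target := by
    intro i
    have h1 : ContMDiff 𝓘(ℝ, EuclideanSpace ℝ (Fin n)) 𝓘(ℝ, EuclideanSpace ℝ (Fin n)).tangent ∞
        (fun y => (⟨y, stdVec i⟩ : TangentBundle 𝓘(ℝ, EuclideanSpace ℝ (Fin n))
          (EuclideanSpace ℝ (Fin n)))) :=
      contMDiff_vectorSpace_iff_contDiff.2 contDiff_const
    have h2 := (hψ.contMDiffOn_tangentMapWithin (m := ∞) le_rfl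
      (isOpen_target p).uniqueMDiffOn).comp h1.contMDiffOn (fun y hy => hy)
    refine h2.congr fun y hy => ?_
    simp only [Function.comp_def, tangentMapWithin, coordVec]
    rw [mfderivWithin_of_isOpen (isOpen_target p) hy]
  have key := ContMDiffOn.clm_bundle_apply₂ (n := ∞)
    (b := (extChartAt (𝓡 n) p).symm) (F₁ := EuclideanSpace ℝ (Fin n))
    (F₂ := EuclideanSpace ℝ (Fin n)) (F₃ := ℝ) (E₁ := fun x : M => TangentSpace (𝓡 n) x)
    (E₂ := fun x : M => TangentSpace (𝓡 n) x) (E₃ := Bundle.Trivial M ℝ)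
    (ψ := fun y => g.inner ((extChartAt (𝓡 n) p).symm y))
    (g.contMDiff.comp_contMDiffOn hψ) (hT i) (hT j)
  rw [← contMDiffOn_iff_contDiffOn]
  intro y hy
  have h3 := key y hy
  rw [Bundle.contMDiffWithinAt_totalSpace] at h3
  exact h3.2

theorem contDiffOn_chartGramInv (g : RMetric n M) (p : M) (i j : Fin n) :
    ContDiffOn ℝ ∞ (fun y => (chartGram g p y)⁻¹ i j) (extChartAt (𝓡 n) p).target :=
  contDiffOn_inv (contDiffOn_chartGram g p) (fun _ hy => (chartGram_posDef g hy).det_pos.ne') i j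

theorem contDiffOn_chartDensity (g : RMetric n M) (p : M) :
    ContDiffOn ℝ ∞ (chartDensity g p) (extChartAt (𝓡 n) p).target :=
  (contDiffOn_det (contDiffOn_chartGram g p)).sqrt
    fun _ hy => (chartGram_posDef g hy).det_pos.ne'

theorem contDiffOn_comp_symm {F : Type*} [NormedAddCommGroup F] [NormedSpace ℝ F] {f : M → F}
    (hf : ContMDiff (𝓡 n) 𝓘(ℝ, F) ∞ f) (p : M) :
    ContDiffOn ℝ ∞ (f ∘ (extChartAt (𝓡 n) p).symm) (extChartAt (𝓡 n) p).target :=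
  contMDiffOn_iff_contDiffOn.1 (hf.comp_contMDiffOn (contMDiffOn_extChartAt_symm p))

theorem contDiffOn_fderiv_apply {F : Type*} [NormedAddCommGroup F] [NormedSpace ℝ F]
    {f : EuclideanSpace ℝ (Fin n) → F} {s : Set (EuclideanSpace ℝ (Fin n))} (hs : IsOpen s)
    (hf : ContDiffOn ℝ ∞ f s) (v : EuclideanSpace ℝ (Fin n)) :
    ContDiffOn ℝ ∞ (fun y => fderiv ℝ f y v) s :=
  (hf.fderiv_of_isOpen hs le_rfl).clm_apply contDiffOn_const

theorem contDiffOn_chartComponent_riemGrad (g : RMetric n M) {f : M → ℝ}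
    (hf : ContMDiff (𝓡 n) 𝓘(ℝ, ℝ) ∞ f) (p : M) (i : Fin n) :
    ContDiffOn ℝ ∞ (chartComponent p (riemGrad g f) i) (extChartAt (𝓡 n) p).target := by
  have : ContDiffOn ℝ ∞ (fun y => ∑ j, (chartGram g p y)⁻¹ i j *
      fderiv ℝ (f ∘ (extChartAt (𝓡 n) p).symm) y (stdVec j)) (extChartAt (𝓡 n) p).target :=
    ContDiffOn.sum fun j _ => (contDiffOn_chartGramInv g p i j).mul
      (contDiffOn_fderiv_apply (isOpen_target p) (contDiffOn_comp_symm hf p) _)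
  exact this.congr fun y hy =>
    chartComponent_riemGrad g hy (hf.mdifferentiable (by simp) _) i

/-- The Laplacian of `f` computed in the chart around `p`, as a function of the coordinates. -/
noncomputable def chartLaplacian (g : RMetric n M) (p : M) (f : M → ℝ)
    (y : EuclideanSpace ℝ (Fin n)) : ℝ :=
  (chartDensity g p y)⁻¹ *
    ∑ i, fderiv ℝ (fun y => chartDensity g p y * chartComponent p (riemGrad g f) i y) y (stdVec i)

theorem contDiffOn_chartLaplacian (g : RMetric n M) {f : M → ℝ}
    (hf : ContMDiff (𝓡 n) 𝓘(ℝ, ℝ) ∞ f) (p : M) :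
    ContDiffOn ℝ ∞ (chartLaplacian g p f) (extChartAt (𝓡 n) p).target :=
  ((contDiffOn_chartDensity g p).inv fun _ hy => (chartDensity_pos g hy).ne').mul
    (ContDiffOn.sum fun i _ => contDiffOn_fderiv_apply (isOpen_target p)
      ((contDiffOn_chartDensity g p).mul (contDiffOn_chartComponent_riemGrad g hf p i)) _)

theorem continuousOn_source_of_target {X : Type*} [TopologicalSpace X] {f : M → X} {p : M}
    (hf : ContinuousOn (f ∘ (extChartAt (𝓡 n) p).symm) (extChartAt (𝓡 n) p).target) :
    ContinuousOn f (extChartAt (𝓡 n) p).source := by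
  refine (hf.comp (continuousOn_extChartAt p) (extChartAt (𝓡 n) p).mapsTo).congr fun x hx => ?_
  simp only [Function.comp_apply, (extChartAt (𝓡 n) p).left_inv hx]

theorem continuous_of_target {X : Type*} [TopologicalSpace X] {f : M → X}
    (hf : ∀ p : M, ContinuousOn (f ∘ (extChartAt (𝓡 n) p).symm) (extChartAt (𝓡 n) p).target) :
    Continuous f :=
  continuous_iff_continuousAt.2 fun p =>
    (continuousOn_source_of_target (hf p)).continuousAt (extChartAt_source_mem_nhds p)

theorem continuous_gradInner (g : RMetric n M) {f h : M → ℝ} (hf : ContMDiff (𝓡 n) 𝓘(ℝ, ℝ) ∞ f)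
    (hh : ContMDiff (𝓡 n) 𝓘(ℝ, ℝ) ∞ h) : Continuous (gradInner g f h) := by
  refine continuous_of_target (n := n) fun p => ?_
  have : ContDiffOn ℝ ∞ (fun y => ∑ i, ∑ j, (chartGram g p y)⁻¹ i j *
      fderiv ℝ (h ∘ (extChartAt (𝓡 n) p).symm) y (stdVec j) *
      fderiv ℝ (f ∘ (extChartAt (𝓡 n) p).symm) y (stdVec i)) (extChartAt (𝓡 n) p).target :=
    ContDiffOn.sum fun i _ => ContDiffOn.sum fun j _ => ((contDiffOn_chartGramInv g p i j).mul
      (contDiffOn_fderiv_apply (isOpen_target p) (contDiffOn_comp_symm hh p) _)).mul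
      (contDiffOn_fderiv_apply (isOpen_target p) (contDiffOn_comp_symm hf p) _)
  exact this.continuousOn.congr fun y hy => gradInner_eq_coord g hy
    (hf.mdifferentiable (by simp) _) (hh.mdifferentiable (by simp) _)

end DriftHeat

/-! ### Change of charts and the Riemannian volume. -/

namespace DriftHeat

variable {n N : ℕ} {M : Type*} [TopologicalSpace M]
  [ChartedSpace (EuclideanSpace ℝ (Fin n)) M] [IsManifold (𝓡 n) ∞ M]
  {p q : M} {y : EuclideanSpace ℝ (Fin n)}

/-- The two sides live in tangent spaces at points that are equal only propositionally; the common
model space of all tangent spaces is what allows the transport. -/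
theorem inner_mfderiv_congr (g : RMetric n M) {f₁ f₂ : EuclideanSpace ℝ (Fin n) → M}
    (h : f₁ =ᶠ[nhds y] f₂) (v w : EuclideanSpace ℝ (Fin n)) :
    g.inner (f₁ y) (mfderiv 𝓘(ℝ, EuclideanSpace ℝ (Fin n)) (𝓡 n) f₁ y v)
        (mfderiv 𝓘(ℝ, EuclideanSpace ℝ (Fin n)) (𝓡 n) f₁ y w)
      = g.inner (f₂ y) (mfderiv 𝓘(ℝ, EuclideanSpace ℝ (Fin n)) (𝓡 n) f₂ y v)
        (mfderiv 𝓘(ℝ, EuclideanSpace ℝ (Fin n)) (𝓡 n) f₂ y w) := by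
  have key : ∀ (x x' : M), x = x' → ∀ v w : EuclideanSpace ℝ (Fin n),
      g.inner x (v : EuclideanSpace ℝ (Fin n)) w = g.inner x' v w := by
    rintro x _ rfl v w; rfl
  have hd := h.mfderiv_eq (I := 𝓘(ℝ, EuclideanSpace ℝ (Fin n))) (I' := 𝓡 n)
  have h1 : ∀ v : EuclideanSpace ℝ (Fin n),
      (mfderiv 𝓘(ℝ, EuclideanSpace ℝ (Fin n)) (𝓡 n) f₁ y v : EuclideanSpace ℝ (Fin n))
      = mfderiv 𝓘(ℝ, EuclideanSpace ℝ (Fin n)) (𝓡 n) f₂ y v := fun v =>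
    DFunLike.congr_fun hd v
  refine (key _ _ h.eq_of_nhds _ _).trans ?_
  exact congrArg₂ (fun a b => g.inner (f₂ y) a b) (h1 v) (h1 w)

/-- The transition map between two charts. -/
noncomputable def transition (p q : M) : EuclideanSpace ℝ (Fin n) → EuclideanSpace ℝ (Fin n) :=
  extChartAt (𝓡 n) q ∘ (extChartAt (𝓡 n) p).symm

theorem differentiableAt_transition (hy : y ∈ (extChartAt (𝓡 n) p).target)
    (hq : (extChartAt (𝓡 n) p).symm y ∈ (extChartAt (𝓡 n) q).source) :
    DifferentiableAt ℝ (transition p q) y := by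
  rw [← mdifferentiableAt_iff_differentiableAt]
  exact (mdifferentiableAt_extChartAt (by simpa using hq)).comp y (mdifferentiableAt_symm hy)

theorem eventuallyEq_symm_comp_transition (hy : y ∈ (extChartAt (𝓡 n) p).target)
    (hq : (extChartAt (𝓡 n) p).symm y ∈ (extChartAt (𝓡 n) q).source) :
    (extChartAt (𝓡 n) p).symm =ᶠ[nhds y] (extChartAt (𝓡 n) q).symm ∘ transition p q := by
  have hc : ContinuousAt (extChartAt (𝓡 n) p).symm y :=
    (continuousOn_extChartAt_symm p).continuousAt ((isOpen_target p).mem_nhds hy)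
  filter_upwards [hc ((isOpen_extChartAt_source q).mem_nhds hq)] with z hz
  exact ((extChartAt (𝓡 n) q).left_inv hz).symm

/-- The chain rule for the inverse chart at `p`, factored through the transition map, expresses the
coordinate fields of one chart in those of the other by the Jacobian matrix. -/
theorem chartGram_transition (g : RMetric n M) (hy : y ∈ (extChartAt (𝓡 n) p).target)
    (hq : (extChartAt (𝓡 n) p).symm y ∈ (extChartAt (𝓡 n) q).source) :
    chartGram g p y = (Matrix.of fun i j => (fderiv ℝ (transition p q) y (stdVec j) i)).transpose
      * chartGram g q (transition p q y)
      * (Matrix.of fun i j => (fderiv ℝ (transition p q) y (stdVec j) i)) := by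
  have hty : transition p q y ∈ (extChartAt (𝓡 n) q).target :=
    (extChartAt (𝓡 n) q).map_source hq
  ext i j
  have h1 := inner_mfderiv_congr g (eventuallyEq_symm_comp_transition hy hq) (stdVec i) (stdVec j)
  have h2 : ∀ v : EuclideanSpace ℝ (Fin n),
      mfderiv 𝓘(ℝ, EuclideanSpace ℝ (Fin n)) (𝓡 n)
        ((extChartAt (𝓡 n) q).symm ∘ transition p q) y v
      = ∑ k, fderiv ℝ (transition p q) y v k • coordVec q (transition p q y) k := by
    intro v
    rw [mfderiv_comp y (mdifferentiableAt_symm hty)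
      (differentiableAt_transition hy hq).mdifferentiableAt, mfderiv_eq_fderiv]
    have h3 : fderiv ℝ (transition p q) y v
        = ∑ k, fderiv ℝ (transition p q) y v k • (stdVec k : EuclideanSpace ℝ (Fin n)) := by
      have := (EuclideanSpace.basisFun (Fin n) ℝ).sum_repr (fderiv ℝ (transition p q) y v)
      simpa [stdVec] using this.symm
    have h4 := congrArg (mfderiv 𝓘(ℝ, EuclideanSpace ℝ (Fin n)) (𝓡 n)
      (extChartAt (𝓡 n) q).symm (transition p q y)) h3
    have h5 : ∀ (L : EuclideanSpace ℝ (Fin n) →L[ℝ]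
        TangentSpace (𝓡 n) ((extChartAt (𝓡 n) q).symm (transition p q y))) (c : Fin n → ℝ),
        L (∑ k, c k • stdVec k) = ∑ k, c k • L (stdVec k) := fun L c => by
      simp only [map_sum, map_smul]
    exact h4.trans (h5 _ _)
  refine h1.trans ?_
  rw [h2, h2]
  refine (bilin_sum_sum (g.inner ((extChartAt (𝓡 n) q).symm (transition p q y))) _ _ _).trans ?_
  simp only [Matrix.mul_apply, Finset.sum_mul, Matrix.transpose_apply, Matrix.of_apply]
  rw [Finset.sum_comm]
  refine Finset.sum_congr rfl fun a _ => Finset.sum_congr rfl fun b _ => ?_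
  simp only [chartGram, Matrix.of_apply]
  ring

theorem chartDensity_transition (g : RMetric n M) (hy : y ∈ (extChartAt (𝓡 n) p).target)
    (hq : (extChartAt (𝓡 n) p).symm y ∈ (extChartAt (𝓡 n) q).source) :
    chartDensity g p y
      = |(fderiv ℝ (transition p q) y).det| * chartDensity g q (transition p q y) := by
  have hJ : (Matrix.of fun i j => (fderiv ℝ (transition p q) y (stdVec j) i)).det
      = (fderiv ℝ (transition p q) y).det := by
    rw [ContinuousLinearMap.det,
      ← LinearMap.det_toMatrix (EuclideanSpace.basisFun (Fin n) ℝ).toBasis]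
    congr 1
  rw [chartDensity, chartDensity, chartGram_transition g hy hq, Matrix.det_mul, Matrix.det_mul,
    Matrix.det_transpose, hJ, ← Real.sqrt_sq_eq_abs, ← Real.sqrt_mul (sq_nonneg _)]
  congr 1
  ring

variable [MeasurableSpace M] [BorelSpace M]

theorem aemeasurable_symm (p : M) : AEMeasurable (extChartAt (𝓡 n) p).symm
    (volume.restrict (extChartAt (𝓡 n) p).target) :=
  (continuousOn_extChartAt_symm p).aemeasurable (isOpen_target p).measurableSet

theorem aemeasurable_chartDensity (g : RMetric n M) (p : M) :
    AEMeasurable (fun y => ENNReal.ofReal (chartDensity g p y))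
      (volume.restrict (extChartAt (𝓡 n) p).target) :=
  ((contDiffOn_chartDensity g p).continuousOn.aemeasurable
    (isOpen_target p).measurableSet).ennreal_ofReal

theorem aemeasurable_symm' (g : RMetric n M) (p : M) : AEMeasurable (extChartAt (𝓡 n) p).symm
    ((volume.restrict (extChartAt (𝓡 n) p).target).withDensity
      fun y => ENNReal.ofReal (chartDensity g p y)) :=
  (aemeasurable_symm p).mono_ac (withDensity_absolutelyContinuous _ _)

theorem measurableSet_target_inter (p : M) {S : Set M} (hS : MeasurableSet S) :
    MeasurableSet ((extChartAt (𝓡 n) p).target ∩ (extChartAt (𝓡 n) p).symm ⁻¹' S) := by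
  have h := (continuousOn_iff_continuous_domRestrict.1
    (continuousOn_extChartAt_symm (I := 𝓡 n) p)).measurable hS
  have h2 := (isOpen_target p).measurableSet.subtype_image h
  convert h2 using 1
  ext y
  simp [and_comm]

theorem chartVolume_apply (g : RMetric n M) (p : M) {S : Set M} (hS : MeasurableSet S) :
    chartVolume g p S = ∫⁻ y in (extChartAt (𝓡 n) p).target ∩ (extChartAt (𝓡 n) p).symm ⁻¹' S,
      ENNReal.ofReal (chartDensity g p y) := by
  have hm := measurableSet_target_inter (n := n) p hS
  have hae : (extChartAt (𝓡 n) p).symm ⁻¹' S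
      =ᵐ[(volume.restrict (extChartAt (𝓡 n) p).target).withDensity
        fun y => ENNReal.ofReal (chartDensity g p y)]
      ((extChartAt (𝓡 n) p).target ∩ (extChartAt (𝓡 n) p).symm ⁻¹' S : Set _) := by
    refine (withDensity_absolutelyContinuous _ _).ae_le ?_
    filter_upwards [ae_restrict_mem (isOpen_target p).measurableSet] with y hy
    exact propext ⟨fun h => ⟨hy, h⟩, fun h => h.2⟩
  rw [chartVolume, Measure.map_apply_of_aemeasurable (aemeasurable_symm' g p) hS,
    measure_congr hae, withDensity_apply _ hm, Measure.restrict_restrict hm,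
    Set.inter_comm _ (extChartAt (𝓡 n) p).target, ← Set.inter_assoc, Set.inter_self]

theorem chartVolume_inter_source (g : RMetric n M) (p : M) {S : Set M} (hS : MeasurableSet S) :
    chartVolume g p (S ∩ (extChartAt (𝓡 n) p).source) = chartVolume g p S := by
  rw [chartVolume_apply g p hS,
    chartVolume_apply g p (hS.inter (isOpen_extChartAt_source p).measurableSet)]
  congr 2
  ext y
  simp only [Set.mem_inter_iff, Set.mem_preimage]
  exact ⟨fun h => ⟨h.1, h.2.1⟩, fun h => ⟨h.1, h.2, (extChartAt (𝓡 n) p).map_target h.1⟩⟩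

/-- Change of variables along the transition map: its Jacobian factor is exactly the ratio of the
two densities. -/
theorem chartVolume_eq_of_subset (g : RMetric n M) (p q : M) {S : Set M} (hS : MeasurableSet S)
    (hp : S ⊆ (extChartAt (𝓡 n) p).source) (hq : S ⊆ (extChartAt (𝓡 n) q).source) :
    chartVolume g p S = chartVolume g q S := by
  rw [chartVolume_apply g p hS, chartVolume_apply g q hS]
  set A := (extChartAt (𝓡 n) p).target ∩ (extChartAt (𝓡 n) p).symm ⁻¹' S with hA
  have himg : (extChartAt (𝓡 n) q).target ∩ (extChartAt (𝓡 n) q).symm ⁻¹' S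
      = transition p q '' A := by
    ext z
    constructor
    · rintro ⟨hz, hzS⟩
      refine ⟨extChartAt (𝓡 n) p ((extChartAt (𝓡 n) q).symm z),
        ⟨(extChartAt (𝓡 n) p).map_source (hp hzS), ?_⟩, ?_⟩
      · simpa only [Set.mem_preimage, (extChartAt (𝓡 n) p).left_inv (hp hzS)] using hzS
      · simp only [transition, Function.comp_apply, (extChartAt (𝓡 n) p).left_inv (hp hzS),
          (extChartAt (𝓡 n) q).right_inv hz]
    · rintro ⟨y, ⟨hy, hyS⟩, rfl⟩
      refine ⟨(extChartAt (𝓡 n) q).map_source (hq hyS), ?_⟩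
      simpa only [Set.mem_preimage, transition, Function.comp_apply,
        (extChartAt (𝓡 n) q).left_inv (hq hyS)] using hyS
  have hinj : Set.InjOn (transition p q) A := by
    rintro y ⟨hy, hyS⟩ z ⟨hz, hzS⟩ h
    exact (extChartAt (𝓡 n) p).symm.injOn hy hz
      ((extChartAt (𝓡 n) q).injOn (hq hyS) (hq hzS) h)
  have hm : MeasurableSet A := measurableSet_target_inter p hS
  rw [himg, lintegral_image_eq_lintegral_abs_det_fderiv_mul volume hm
    (fun y hy => (differentiableAt_transition hy.1 (hq hy.2)).hasFDerivAt.hasFDerivWithinAt) hinj]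
  refine setLIntegral_congr_fun hm fun y hy => ?_
  simp only [chartDensity_transition g hy.1 (hq hy.2), ENNReal.ofReal_mul (abs_nonneg _)]

/-- The added term is infinite on every set that leaves the chart at `q`, so the comparison only has
content inside that chart, where the two chart measures agree. The right side is a measure
independent of `p`, hence it also bounds the supremum over all charts. -/
theorem chartVolume_le (g : RMetric n M) (p q : M) :
    chartVolume g p ≤ chartVolume g q
      + (⊤ : ENNReal) • Measure.count.restrict (extChartAt (𝓡 n) q).sourceᶜ := by
  have hmq := (isOpen_extChartAt_source (I := 𝓡 n) q).measurableSet
  have hmp := (isOpen_extChartAt_source (I := 𝓡 n) p).measurableSet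
  refine Measure.le_iff.2 fun T hT => ?_
  by_cases h : T ⊆ (extChartAt (𝓡 n) q).source
  · refine le_trans ?_ (Measure.le_add_right le_rfl T)
    rw [← chartVolume_inter_source g p hT, chartVolume_eq_of_subset g p q (hT.inter hmp)
      Set.inter_subset_right (Set.inter_subset_left.trans h)]
    exact measure_mono Set.inter_subset_left
  · have hne : (T ∩ (extChartAt (𝓡 n) q).sourceᶜ).Nonempty := by
      obtain ⟨x, hx, hxs⟩ := Set.not_subset.1 h
      exact ⟨x, hx, hxs⟩
    have : Measure.count (T ∩ (extChartAt (𝓡 n) q).sourceᶜ) ≠ 0 :=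
      Measure.count_ne_zero hne
    rw [Measure.add_apply, Measure.smul_apply, Measure.restrict_apply hT, smul_eq_mul,
      ENNReal.top_mul this, add_top]
    exact le_top

/-- The infinite term of `chartVolume_le` vanishes on subsets of the chart, so the supremum of the
chart measures is attained there by the measure of that chart. -/
theorem riemannianVolume_apply_of_subset (g : RMetric n M) (q : M) {S : Set M}
    (hS : MeasurableSet S) (hq : S ⊆ (extChartAt (𝓡 n) q).source) :
    riemannianVolume g S = chartVolume g q S := by
  refine le_antisymm ?_ (le_iSup (chartVolume g) q S)
  refine (iSup_le (fun p => chartVolume_le g p q) : riemannianVolume g ≤ _) S |>.trans ?_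
  rw [Measure.add_apply, Measure.smul_apply, Measure.restrict_apply hS,
    (Set.disjoint_compl_right_iff_subset.2 hq).inter_eq]
  simp

theorem restrict_source_riemannianVolume (g : RMetric n M) (q : M) :
    (riemannianVolume g).restrict (extChartAt (𝓡 n) q).source = chartVolume g q := by
  ext S hS
  rw [Measure.restrict_apply hS, riemannianVolume_apply_of_subset g q
    (hS.inter (isOpen_extChartAt_source q).measurableSet) Set.inter_subset_right,
    chartVolume_inter_source g q hS]

theorem integral_chartVolume (g : RMetric n M) (p : M) {F : M → ℝ}
    (hF : AEStronglyMeasurable F (chartVolume g p)) :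
    ∫ x, F x ∂(chartVolume g p) = ∫ y in (extChartAt (𝓡 n) p).target,
      chartDensity g p y * F ((extChartAt (𝓡 n) p).symm y) := by
  rw [chartVolume, integral_map (aemeasurable_symm' g p) hF,
    integral_withDensity_eq_integral_toReal_smul₀ (aemeasurable_chartDensity g p)
      (Filter.Eventually.of_forall fun _ => ENNReal.ofReal_lt_top)]
  refine setIntegral_congr_fun (isOpen_target p).measurableSet fun y hy => ?_
  simp only [ENNReal.toReal_ofReal (chartDensity_pos g hy).le, smul_eq_mul]

theorem integral_eq_of_support_subset (g : RMetric n M) (p : M) {F : M → ℝ}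
    (hF : AEStronglyMeasurable F (riemannianVolume g))
    (hs : Function.support F ⊆ (extChartAt (𝓡 n) p).source) :
    ∫ x, F x ∂(riemannianVolume g) = ∫ y in (extChartAt (𝓡 n) p).target,
      chartDensity g p y * F ((extChartAt (𝓡 n) p).symm y) := by
  rw [← setIntegral_eq_integral_of_forall_compl_eq_zero (s := (extChartAt (𝓡 n) p).source)
    (fun x hx => Function.notMem_support.1 fun h => hx (hs h)), restrict_source_riemannianVolume,
    integral_chartVolume]
  rw [← restrict_source_riemannianVolume]
  exact hF.restrict

theorem isLocallyFiniteMeasure_riemannianVolume (g : RMetric n M) :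
    IsLocallyFiniteMeasure (riemannianVolume g) := by
  refine ⟨fun x => ?_⟩
  have hxt : extChartAt (𝓡 n) x x ∈ (extChartAt (𝓡 n) x).target := mem_extChartAt_target x
  obtain ⟨r, hr, hball⟩ := Metric.nhds_basis_closedBall.mem_iff.1 ((isOpen_target x).mem_nhds hxt)
  have hV : (extChartAt (𝓡 n) x).source ∩ extChartAt (𝓡 n) x ⁻¹'
      Metric.ball (extChartAt (𝓡 n) x x) r ∈ nhds x :=
    Filter.inter_mem (extChartAt_source_mem_nhds x)
      ((continuousAt_extChartAt x) (Metric.ball_mem_nhds _ hr))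
  have hVo : IsOpen ((extChartAt (𝓡 n) x).source ∩ extChartAt (𝓡 n) x ⁻¹'
      Metric.ball (extChartAt (𝓡 n) x x) r) :=
    (continuousOn_extChartAt x).isOpen_inter_preimage (isOpen_extChartAt_source x) Metric.isOpen_ball
  refine ⟨_, hV, ?_⟩
  rw [riemannianVolume_apply_of_subset g x hVo.measurableSet Set.inter_subset_left,
    chartVolume_apply g x hVo.measurableSet]
  have hi : IntegrableOn (chartDensity g x)
      (Metric.closedBall (extChartAt (𝓡 n) x x) r) :=
    ((contDiffOn_chartDensity g x).continuousOn.mono hball).integrableOn_compact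
      (isCompact_closedBall _ _)
  refine lt_of_le_of_lt (lintegral_mono_set ?_) (hi.lintegral_lt_top)
  rintro y ⟨hy, -, hyb⟩
  rw [Set.mem_preimage, (extChartAt (𝓡 n) x).right_inv hy] at hyb
  exact Metric.ball_subset_closedBall hyb

theorem isOpenPosMeasure_riemannianVolume (g : RMetric n M) :
    (riemannianVolume g).IsOpenPosMeasure := by
  refine ⟨fun U hU ⟨x, hx⟩ h0 => ?_⟩
  have hUo : IsOpen (U ∩ (extChartAt (𝓡 n) x).source) := hU.inter (isOpen_extChartAt_source x)
  have h1 : chartVolume g x (U ∩ (extChartAt (𝓡 n) x).source) = 0 := by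
    rw [← riemannianVolume_apply_of_subset g x hUo.measurableSet Set.inter_subset_right]
    exact measure_mono_null Set.inter_subset_left h0
  rw [chartVolume_inter_source g x hU.measurableSet, chartVolume_apply g x hU.measurableSet] at h1
  have hWo : IsOpen ((extChartAt (𝓡 n) x).target ∩ (extChartAt (𝓡 n) x).symm ⁻¹' U) :=
    (continuousOn_extChartAt_symm x).isOpen_inter_preimage (isOpen_target x) hU
  have hne : ((extChartAt (𝓡 n) x).target ∩ (extChartAt (𝓡 n) x).symm ⁻¹' U).Nonempty :=
    ⟨extChartAt (𝓡 n) x x, mem_extChartAt_target x, by simpa using hx⟩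
  refine (hWo.measure_pos volume hne).ne' ?_
  rw [lintegral_eq_zero_iff' ((aemeasurable_chartDensity g x).mono_set Set.inter_subset_left)] at h1
  have h2 : ∀ᵐ y ∂(volume.restrict
      ((extChartAt (𝓡 n) x).target ∩ (extChartAt (𝓡 n) x).symm ⁻¹' U)), False := by
    filter_upwards [h1, ae_restrict_mem hWo.measurableSet] with y hy hyW
    exact (ENNReal.ofReal_pos.2 (chartDensity_pos g hyW.1)).ne' hy
  simpa using h2

end DriftHeat

/-! ### Green's formula and the chart independence of the Laplacian. -/

namespace DriftHeat

section Euclidean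

variable {n : ℕ} {s K : Set (EuclideanSpace ℝ (Fin n))} {ζ X : EuclideanSpace ℝ (Fin n) → ℝ}

theorem tsupport_indicator_subset (hK : IsCompact K) (hζ : ∀ y ∈ s, y ∉ K → ζ y = 0) :
    tsupport (s.indicator ζ) ⊆ K := by
  refine closure_minimal (fun y hy => ?_) hK.isClosed
  by_contra hyK
  refine hy ?_
  by_cases hys : y ∈ s
  · rw [Set.indicator_of_mem hys, hζ y hys hyK]
  · exact Set.indicator_of_notMem hys _

theorem contDiff_indicator (hs : IsOpen s) (hK : IsCompact K) (hKs : K ⊆ s)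
    (h : ContDiffOn ℝ ∞ ζ s) (hζ : ∀ y ∈ s, y ∉ K → ζ y = 0) :
    ContDiff ℝ ∞ (s.indicator ζ) := by
  rw [← contMDiff_iff_contDiff]
  refine contMDiff_of_tsupport fun y hy => ?_
  have hys : y ∈ s := hKs (tsupport_indicator_subset hK hζ hy)
  rw [contMDiffAt_iff_contDiffAt]
  refine (h.contDiffAt (hs.mem_nhds hys)).congr_of_eventuallyEq ?_
  filter_upwards [hs.mem_nhds hys] with z hz
  exact Set.indicator_of_mem hz _

theorem integrableOn_of_eq_zero_off_compact (hs : IsOpen s) (hK : IsCompact K) (hKs : K ⊆ s)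
    (hX : ContinuousOn X s) (h0 : ∀ y ∈ s, y ∉ K → X y = 0) : IntegrableOn X s := by
  have h1 : IntegrableOn X K := (hX.mono hKs).integrableOn_compact hK
  have h2 : IntegrableOn X (s \ K) := by
    refine (integrableOn_zero (ε' := ℝ)).congr_fun (fun y hy => ?_)
      (hs.measurableSet.diff hK.isClosed.measurableSet)
    exact (h0 y hy.1 hy.2).symm
  have := h1.union h2
  rwa [Set.union_sdiff_cancel hKs] at this

/-- Integration by parts on an open set, when one of the functions has compact support. -/
theorem setIntegral_mul_fderiv_eq_neg (hs : IsOpen s) (hK : IsCompact K) (hKs : K ⊆ s)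
    (hζs : ContDiffOn ℝ ∞ ζ s) (hζ : ∀ y ∈ s, y ∉ K → ζ y = 0) (hX : ContDiffOn ℝ ∞ X s)
    (v : EuclideanSpace ℝ (Fin n)) :
    ∫ y in s, ζ y * fderiv ℝ X y v = -∫ y in s, fderiv ℝ ζ y v * X y := by
  -- Extension by zero is smooth on the whole space, so integration by parts over `ℝⁿ` applies; `X`
  -- has to be differentiable only on the support of `f`.
  set f := s.indicator ζ with hf
  have hfs : ContDiff ℝ ∞ f := contDiff_indicator hs hK hKs hζs hζ
  have htf : tsupport f ⊆ K := tsupport_indicator_subset hK hζ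
  have hfd : ∀ y ∈ s, fderiv ℝ f y = fderiv ℝ ζ y := fun y hy => by
    refine Filter.EventuallyEq.fderiv_eq ?_
    filter_upwards [hs.mem_nhds hy] with z hz
    exact Set.indicator_of_mem hz _
  have hf0 : ∀ y, y ∉ K → f y = 0 := fun y hy => image_eq_zero_of_notMem_tsupport fun h => hy (htf h)
  have hfd0 : ∀ y, y ∉ K → fderiv ℝ f y = 0 := fun y hy => by
    have := (tsupport_fderiv_subset ℝ (f := f)).trans htf
    exact image_eq_zero_of_notMem_tsupport fun h => hy (this h)
  have hfc : ContinuousOn (fun y => fderiv ℝ f y v) s :=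
    ((hfs.continuous_fderiv (by simp)).clm_apply continuous_const).continuousOn
  have hXc : ContinuousOn (fun y => fderiv ℝ X y v) s :=
    (contDiffOn_fderiv_apply hs hX v).continuousOn
  have ext : ∀ {F : EuclideanSpace ℝ (Fin n) → ℝ}, ContinuousOn F s → (∀ y, y ∉ K → F y = 0) →
      Integrable F := fun {F} hF h0 => by
    refine (integrableOn_iff_integrable_of_support_subset (s := s) ?_).1
      (integrableOn_of_eq_zero_off_compact hs hK hKs hF fun y _ hy => h0 y hy)
    exact fun y hy => hKs (by_contra fun h => hy (h0 y h))
  have key := integral_mul_fderiv_eq_neg_fderiv_mul_of_integrable (μ := volume) (f := f) (g := X)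
    (v := v)
    (ext (hfc.mul hX.continuousOn) fun y hy => by simp [hfd0 y hy])
    (ext (hfs.continuous.continuousOn.mul hXc) fun y hy => by simp [hf0 y hy])
    (ext (hfs.continuous.continuousOn.mul hX.continuousOn) fun y hy => by simp [hf0 y hy])
    (fun y _ => hfs.differentiable (by simp) y)
    (fun y hy => (hX.contDiffAt (hs.mem_nhds (hKs (htf hy)))).differentiableAt (by simp))
  have e1 : ∫ y in s, ζ y * fderiv ℝ X y v = ∫ y, f y * fderiv ℝ X y v := by
    rw [← setIntegral_eq_integral_of_forall_compl_eq_zero (s := s) (f := fun y => f y * _)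
      fun y hy => by simp only [hf, Set.indicator_of_notMem hy, zero_mul]]
    exact setIntegral_congr_fun hs.measurableSet fun y hy => by
      simp only [hf, Set.indicator_of_mem hy]
  have e2 : ∫ y in s, fderiv ℝ ζ y v * X y = ∫ y, fderiv ℝ f y v * X y := by
    rw [← setIntegral_eq_integral_of_forall_compl_eq_zero (s := s)
      (f := fun y => fderiv ℝ f y v * _) fun y hy => by simp [hfd0 y fun h => hy (hKs h)]]
    exact setIntegral_congr_fun hs.measurableSet fun y hy => by simp only [hfd y hy]
  rw [e1, e2, key]

end Euclidean

variable {n N : ℕ} {M : Type*} [TopologicalSpace M] [T2Space M]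
  [ChartedSpace (EuclideanSpace ℝ (Fin n)) M] [IsManifold (𝓡 n) ∞ M]
  [MeasurableSpace M] [BorelSpace M] {p q : M}

theorem mdifferentiableAt_of_contMDiff {f : M → ℝ} (hf : ContMDiff (𝓡 n) 𝓘(ℝ, ℝ) ∞ f) (x : M) :
    MDifferentiableAt (𝓡 n) 𝓘(ℝ, ℝ) f x := hf.mdifferentiable (by simp) x

theorem continuousOn_chartLaplacian (g : RMetric n M) {f : M → ℝ}
    (hf : ContMDiff (𝓡 n) 𝓘(ℝ, ℝ) ∞ f) (p : M) :
    ContinuousOn (fun x => chartLaplacian g p f (extChartAt (𝓡 n) p x))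
      (extChartAt (𝓡 n) p).source :=
  (contDiffOn_chartLaplacian g hf p).continuousOn.comp (continuousOn_extChartAt p)
    (extChartAt (𝓡 n) p).mapsTo

theorem continuous_mul_of_tsupport_subset {η F : M → ℝ} {U : Set M} (hU : IsOpen U)
    (hη : Continuous η) (hF : ContinuousOn F U) (hs : tsupport η ⊆ U) :
    Continuous fun x => η x * F x := by
  refine ContinuousOn.continuous_of_tsupport_subset (hη.continuousOn.mul hF) hU ?_
  exact (tsupport_mul_subset_left (f := η) (g := F)).trans hs

/-- The density of the volume cancels the factor `1/√det g` of the divergence, which leaves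
Euclidean integrals of `ζ ∂ᵢ(√det g Xⁱ)`. The right side no longer refers to the chart, and this is
what makes the Laplacian independent of it. -/
theorem integral_mul_chartLaplacian (g : RMetric n M) {f η : M → ℝ}
    (hf : ContMDiff (𝓡 n) 𝓘(ℝ, ℝ) ∞ f) (hη : ContMDiff (𝓡 n) 𝓘(ℝ, ℝ) ∞ η)
    (hc : HasCompactSupport η) (hs : tsupport η ⊆ (extChartAt (𝓡 n) p).source) :
    ∫ x, η x * chartLaplacian g p f (extChartAt (𝓡 n) p x) ∂(riemannianVolume g)
      = -∫ x, gradInner g η f x ∂(riemannianVolume g) := by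
  set T := (extChartAt (𝓡 n) p).target with hT
  set ζ := η ∘ (extChartAt (𝓡 n) p).symm with hζdef
  have hTo : IsOpen T := isOpen_target p
  set K := extChartAt (𝓡 n) p '' tsupport η with hKdef
  have hK : IsCompact K := hc.isCompact.image_of_continuousOn ((continuousOn_extChartAt p).mono hs)
  have hKT : K ⊆ T := by
    rintro _ ⟨x, hx, rfl⟩
    exact (extChartAt (𝓡 n) p).map_source (hs hx)
  have hζ0 : ∀ y ∈ T, y ∉ K → ζ y = 0 := by
    intro y hy hyK
    exact image_eq_zero_of_notMem_tsupport (f := η) fun h => hyK ⟨_, h, (extChartAt (𝓡 n) p).right_inv hy⟩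
  have hζs : ContDiffOn ℝ ∞ ζ T := contDiffOn_comp_symm hη p
  have hX : ∀ i, ContDiffOn ℝ ∞
      (fun y => chartDensity g p y * chartComponent p (riemGrad g f) i y) T := fun i =>
    (contDiffOn_chartDensity g p).mul (contDiffOn_chartComponent_riemGrad g hf p i)
  have hdζ0 : ∀ y ∈ T, y ∉ K → fderiv ℝ ζ y = 0 := by
    intro y hy hyK
    have : ζ =ᶠ[nhds y] fun _ => 0 := by
      filter_upwards [hTo.mem_nhds hy, hK.isClosed.isOpen_compl.mem_nhds hyK] with z hz hzK
      exact hζ0 z hz hzK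
    rw [this.fderiv_eq]; simp
  have h1 := integral_eq_of_support_subset g p
    (F := fun x => η x * chartLaplacian g p f (extChartAt (𝓡 n) p x))
    (continuous_mul_of_tsupport_subset (isOpen_extChartAt_source p) hη.continuous
      (continuousOn_chartLaplacian g hf p) hs).aestronglyMeasurable
    (fun x hx => hs (subset_tsupport _ (left_ne_zero_of_mul hx)))
  have hsg : Function.support (gradInner g η f) ⊆ (extChartAt (𝓡 n) p).source := by
    intro x hx
    by_contra hxs
    refine hx ?_
    have : η =ᶠ[nhds x] fun _ => 0 :=
      notMem_tsupport_iff_eventuallyEq.1 fun h => hxs (hs h)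
    rw [gradInner_eq_dirDeriv, dirDeriv, this.mfderiv_eq, mfderiv_const]
    rfl
  have h2 := integral_eq_of_support_subset g p (continuous_gradInner g hη hf).aestronglyMeasurable hsg
  rw [h1, h2]
  have e1 : ∫ y in T, chartDensity g p y * (η ((extChartAt (𝓡 n) p).symm y) *
        chartLaplacian g p f (extChartAt (𝓡 n) p ((extChartAt (𝓡 n) p).symm y)))
      = ∑ i, ∫ y in T, ζ y * fderiv ℝ
        (fun y => chartDensity g p y * chartComponent p (riemGrad g f) i y) y (stdVec i) := by
    rw [← integral_finsetSum]
    · refine setIntegral_congr_fun hTo.measurableSet fun y hy => ?_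
      have := (chartDensity_pos g hy).ne'
      simp only [(extChartAt (𝓡 n) p).right_inv hy, chartLaplacian, ← Finset.mul_sum]
      field_simp
      exact mul_comm _ _
    · intro i _
      refine integrableOn_of_eq_zero_off_compact hTo hK hKT (hζs.continuousOn.mul
        (contDiffOn_fderiv_apply hTo (hX i) _).continuousOn) fun y hy hyK => ?_
      rw [hζ0 y hy hyK, zero_mul]
  have e2 : ∫ y in T, chartDensity g p y * gradInner g η f ((extChartAt (𝓡 n) p).symm y)
      = ∑ i, ∫ y in T, fderiv ℝ ζ y (stdVec i) *
        (chartDensity g p y * chartComponent p (riemGrad g f) i y) := by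
    rw [← integral_finsetSum]
    · refine setIntegral_congr_fun hTo.measurableSet fun y hy => ?_
      rw [gradInner_eq_coord g hy (mdifferentiableAt_of_contMDiff hη _) (mdifferentiableAt_of_contMDiff hf _), Finset.mul_sum]
      refine Finset.sum_congr rfl fun i _ => ?_
      rw [chartComponent_riemGrad g hy (mdifferentiableAt_of_contMDiff hf _), ← Finset.sum_mul]
      ring
    · intro i _
      refine integrableOn_of_eq_zero_off_compact hTo hK hKT
        ((contDiffOn_fderiv_apply hTo hζs _).continuousOn.mul (hX i).continuousOn)
        fun y hy hyK => ?_
      rw [hdζ0 y hy hyK]; simp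
  rw [e1, e2, ← Finset.sum_neg_distrib]
  exact Finset.sum_congr rfl fun i _ => setIntegral_mul_fderiv_eq_neg hTo hK hKT hζs hζ0 (hX i) _

variable [SecondCountableTopology M]

theorem sigmaCompactSpace_of_chartedSpace (n : ℕ) (M : Type*) [TopologicalSpace M]
    [ChartedSpace (EuclideanSpace ℝ (Fin n)) M] [SecondCountableTopology M] :
    SigmaCompactSpace M := by
  have := Manifold.locallyCompact_of_finiteDimensional (M := M) (𝓡 n)
  infer_instance

/-- The expression of the Laplacian does not depend on the chart. -/
theorem chartLaplacian_eq (g : RMetric n M) {f : M → ℝ} (hf : ContMDiff (𝓡 n) 𝓘(ℝ, ℝ) ∞ f)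
    (p q : M) {x : M} (hp : x ∈ (extChartAt (𝓡 n) p).source)
    (hq : x ∈ (extChartAt (𝓡 n) q).source) :
    chartLaplacian g p f (extChartAt (𝓡 n) p x) = chartLaplacian g q f (extChartAt (𝓡 n) q x) := by
  have := sigmaCompactSpace_of_chartedSpace n M
  have := Manifold.locallyCompact_of_finiteDimensional (M := M) (𝓡 n)
  have := isLocallyFiniteMeasure_riemannianVolume g
  have := isOpenPosMeasure_riemannianVolume g
  set U := (extChartAt (𝓡 n) p).source ∩ (extChartAt (𝓡 n) q).source with hU
  have hUo : IsOpen U := (isOpen_extChartAt_source p).inter (isOpen_extChartAt_source q)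
  have hcp := (continuousOn_chartLaplacian g hf p).mono (Set.inter_subset_left : U ⊆ _)
  have hcq := (continuousOn_chartLaplacian g hf q).mono (Set.inter_subset_right : U ⊆ _)
  -- Both expressions have the same integral against every test function supported in the overlap,
  -- so they agree almost everywhere there; continuity and the full support of the volume upgrade
  -- this to equality at `x`.
  have hae := hUo.ae_eq_zero_of_integral_contMDiff_smul_eq_zero (𝓡 n)
    (μ := riemannianVolume g)
    (f := fun x => chartLaplacian g p f (extChartAt (𝓡 n) p x)
      - chartLaplacian g q f (extChartAt (𝓡 n) q x))
    ((hcp.sub hcq).locallyIntegrableOn hUo.measurableSet) ?_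
  · have h0 : (fun x => chartLaplacian g p f (extChartAt (𝓡 n) p x))
        =ᵐ[(riemannianVolume g).restrict U]
        (fun x => chartLaplacian g q f (extChartAt (𝓡 n) q x)) := by
      rw [Filter.EventuallyEq, ae_restrict_iff' hUo.measurableSet]
      filter_upwards [hae] with x hx hxU
      exact sub_eq_zero.1 (hx hxU)
    exact Measure.eqOn_open_of_ae_eq h0 hUo hcp hcq ⟨hp, hq⟩
  · intro η hη hc hs
    have hip : Integrable (fun x => η x * chartLaplacian g p f (extChartAt (𝓡 n) p x))
        (riemannianVolume g) :=
      (continuous_mul_of_tsupport_subset hUo hη.continuous hcp hs).integrable_of_hasCompactSupport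
        hc.mul_right
    have hiq : Integrable (fun x => η x * chartLaplacian g q f (extChartAt (𝓡 n) q x))
        (riemannianVolume g) :=
      (continuous_mul_of_tsupport_subset hUo hη.continuous hcq hs).integrable_of_hasCompactSupport
        hc.mul_right
    simp only [smul_eq_mul, mul_sub]
    rw [integral_sub hip hiq, integral_mul_chartLaplacian g hf hη hc
      (hs.trans Set.inter_subset_left), integral_mul_chartLaplacian g hf hη hc
      (hs.trans Set.inter_subset_right), sub_self]

theorem laplacian_eq_of_mem_source (g : RMetric n M) {f : M → ℝ}
    (hf : ContMDiff (𝓡 n) 𝓘(ℝ, ℝ) ∞ f) {x : M} (hp : x ∈ (extChartAt (𝓡 n) p).source) :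
    laplacian g f x = chartLaplacian g p f (extChartAt (𝓡 n) p x) :=
  chartLaplacian_eq g hf x p (mem_extChartAt_source x) hp

theorem continuous_laplacian (g : RMetric n M) {f : M → ℝ} (hf : ContMDiff (𝓡 n) 𝓘(ℝ, ℝ) ∞ f) :
    Continuous (laplacian g f) :=
  continuous_iff_continuousAt.2 fun p =>
    ((continuousOn_chartLaplacian g hf p).congr fun _ hx =>
      laplacian_eq_of_mem_source g hf hx).continuousAt (extChartAt_source_mem_nhds p)

theorem gradInner_add_left (g : RMetric n M) {f₁ f₂ h : M → ℝ} {x : M}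
    (h₁ : MDifferentiableAt (𝓡 n) 𝓘(ℝ, ℝ) f₁ x) (h₂ : MDifferentiableAt (𝓡 n) 𝓘(ℝ, ℝ) f₂ x) :
    gradInner g (fun y => f₁ y + f₂ y) h x = gradInner g f₁ h x + gradInner g f₂ h x := by
  simp only [gradInner_eq_dirDeriv]
  have := (h₁.hasMFDerivAt.add h₂.hasMFDerivAt).mfderiv
  exact DFunLike.congr_fun this _

theorem gradInner_sum_left (g : RMetric n M) {ι : Type*} (t : Finset ι) {f : ι → M → ℝ}
    {h : M → ℝ} {x : M} (hf : ∀ i, ContMDiff (𝓡 n) 𝓘(ℝ, ℝ) ∞ (f i)) :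
    gradInner g (fun y => ∑ i ∈ t, f i y) h x = ∑ i ∈ t, gradInner g (f i) h x := by
  classical
  suffices H : ContMDiff (𝓡 n) 𝓘(ℝ, ℝ) ∞ (fun y => ∑ i ∈ t, f i y) ∧
    gradInner g (fun y => ∑ i ∈ t, f i y) h x = ∑ i ∈ t, gradInner g (f i) h x from H.2
  induction t using Finset.induction_on with
  | empty =>
    simp only [Finset.sum_empty]
    refine ⟨contMDiff_const, ?_⟩
    rw [gradInner_eq_dirDeriv, dirDeriv, mfderiv_const]
    rfl
  | insert i t hi ih =>
    simp only [Finset.sum_insert hi]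
    refine ⟨(hf i).add ih.1, ?_⟩
    rw [gradInner_add_left g (mdifferentiableAt_of_contMDiff (hf i) x)
      (mdifferentiableAt_of_contMDiff ih.1 x), ih.2]

theorem hasCompactSupport_gradInner (g : RMetric n M) {f η : M → ℝ} (hc : HasCompactSupport η) :
    HasCompactSupport (gradInner g η f) := by
  refine hc.mono' fun x hx => ?_
  by_contra hxs
  refine hx ?_
  have : η =ᶠ[nhds x] fun _ => 0 := notMem_tsupport_iff_eventuallyEq.1 hxs
  rw [gradInner_eq_dirDeriv, dirDeriv, this.mfderiv_eq, mfderiv_const]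
  rfl

/-- Green's formula. -/
theorem integral_mul_laplacian (g : RMetric n M) {f η : M → ℝ}
    (hf : ContMDiff (𝓡 n) 𝓘(ℝ, ℝ) ∞ f) (hη : ContMDiff (𝓡 n) 𝓘(ℝ, ℝ) ∞ η)
    (hc : HasCompactSupport η) :
    ∫ x, η x * laplacian g f x ∂(riemannianVolume g)
      = -∫ x, gradInner g η f x ∂(riemannianVolume g) := by
  have := sigmaCompactSpace_of_chartedSpace n M
  have := isLocallyFiniteMeasure_riemannianVolume g
  -- Cutting `η` with a partition of unity reduces to test functions supported in one chart;
  -- compactness of the support of `η` leaves finitely many pieces.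
  obtain ⟨ρ, hρ⟩ := SmoothPartitionOfUnity.exists_isSubordinate_chartAt_source (𝓡 n) M
  have hfin := ρ.locallyFinite.finite_nonempty_inter_compact hc.isCompact
  set t := hfin.toFinset with ht
  have hρη : ∀ i, ContMDiff (𝓡 n) 𝓘(ℝ, ℝ) ∞ fun x => ρ i x * η x := fun i => (ρ i).contMDiff.mul hη
  have hρc : ∀ i, HasCompactSupport fun x => ρ i x * η x := fun i => hc.mul_left
  have hsum : η = fun x => ∑ i ∈ t, ρ i x * η x := by
    funext x
    rw [← Finset.sum_mul]
    by_cases hx : η x = 0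
    · simp [hx]
    · have : ∑ i ∈ t, ρ i x = 1 := by
        rw [← ρ.sum_eq_one (Set.mem_univ x), finsum_eq_sum_of_support_subset]
        intro i hi
        simp only [ht, Set.Finite.coe_toFinset]
        exact ⟨x, hi, subset_tsupport _ hx⟩
      rw [this, one_mul]
  have hpiece : ∀ i, ∫ x, ρ i x * η x * laplacian g f x ∂(riemannianVolume g)
      = -∫ x, gradInner g (fun x => ρ i x * η x) f x ∂(riemannianVolume g) := by
    intro i
    have hs : tsupport (fun x => ρ i x * η x) ⊆ (extChartAt (𝓡 n) i).source := by
      rw [extChartAt_source]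
      exact (tsupport_mul_subset_left (f := ρ i) (g := η)).trans (hρ i)
    rw [← integral_mul_chartLaplacian g hf (hρη i) (hρc i) hs]
    refine integral_congr_ae (Filter.Eventually.of_forall fun x => ?_)
    by_cases hx : x ∈ (extChartAt (𝓡 n) i).source
    · simp only [laplacian_eq_of_mem_source g hf hx]
    · have : ρ i x * η x = 0 := image_eq_zero_of_notMem_tsupport
        (f := fun x => ρ i x * η x) fun h => hx (hs h)
      simp only [this, zero_mul]
  have hL : ∀ x, η x * laplacian g f x = ∑ i ∈ t, ρ i x * η x * laplacian g f x := fun x => by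
    rw [← Finset.sum_mul, ← congrFun hsum x]
  have hR : ∀ x, gradInner g η f x = ∑ i ∈ t, gradInner g (fun x => ρ i x * η x) f x := fun x => by
    rw [← gradInner_sum_left g t hρη, ← hsum]
  simp only [hL, hR]
  rw [integral_finsetSum _ fun i _ => ?_, integral_finsetSum _ fun i _ => ?_,
    ← Finset.sum_neg_distrib]
  · exact Finset.sum_congr rfl fun i _ => hpiece i
  · exact (continuous_gradInner g (hρη i) hf).integrable_of_hasCompactSupport
      (hasCompactSupport_gradInner g (hρc i))
  · exact ((hρη i).continuous.mul (continuous_laplacian g hf)).integrable_of_hasCompactSupport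
      (hρc i).mul_right

end DriftHeat

/-! ### Cauchy-Schwarz, the weighted measure and integration by parts in the Sobolev space. -/

namespace DriftHeat

section CauchySchwarz

/-- The discriminant criterion. Together with its converse below it turns a pointwise Cauchy-Schwarz
inequality into nonnegativity of a quadratic form, a condition that survives sums and integrals. -/
theorem sq_le_mul_of_quadratic_nonneg {A b C : ℝ}
    (key : ∀ s t : ℝ, 0 ≤ s ^ 2 * A + 2 * s * t * b + t ^ 2 * C) : b ^ 2 ≤ A * C := by
  have hA : 0 ≤ A := by simpa using key 1 0
  rcases hA.eq_or_lt with h0 | h0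
  · have hb : b = 0 := by
      by_contra hb
      have h1 := key (-(C + 1) / b) 1
      rw [← h0] at h1
      have h2 : 2 * (-(C + 1) / b) * 1 * b = -2 * (C + 1) := by field_simp
      have hC : 0 ≤ C := by simpa using key 0 1
      linarith
    rw [hb, ← h0]; simp
  · have h1 := key (-b) A
    nlinarith

theorem quadratic_nonneg_of_sq_le_mul {A b C : ℝ} (hA : 0 ≤ A) (hC : 0 ≤ C) (h : b ^ 2 ≤ A * C)
    (s t : ℝ) : 0 ≤ s ^ 2 * A + 2 * s * t * b + t ^ 2 * C := by
  have h1 : |b| ≤ √A * √C := by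
    rw [← Real.sqrt_mul hA]
    exact Real.abs_le_sqrt h
  have h2 : -(|s| * |t| * (√A * √C)) ≤ s * t * b := by
    have h3 : |s * t * b| ≤ |s| * |t| * (√A * √C) := by
      rw [abs_mul, abs_mul]; gcongr
    exact (abs_le.1 h3).1
  have h4 : 0 ≤ (|s| * √A - |t| * √C) ^ 2 := sq_nonneg _
  have h5 : (|s| * √A - |t| * √C) ^ 2
      = s ^ 2 * A + t ^ 2 * C - 2 * (|s| * |t| * (√A * √C)) := by
    have := Real.sq_sqrt hA
    have := Real.sq_sqrt hC
    rw [sub_sq, mul_pow, mul_pow, sq_abs, sq_abs, Real.sq_sqrt hA, Real.sq_sqrt hC]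
    ring
  linarith

variable {α : Type*} [MeasurableSpace α] {μ : Measure α} {A B c : α → ℝ}

/-- The hypothesis implies `|c| ≤ A + B`. -/
theorem integrable_of_sq_le_mul (hc : AEStronglyMeasurable c μ) (hA : Integrable A μ)
    (hB : Integrable B μ) (hA0 : ∀ x, 0 ≤ A x) (hB0 : ∀ x, 0 ≤ B x)
    (h : ∀ x, c x ^ 2 ≤ A x * B x) : Integrable c μ := by
  refine (hA.add hB).mono' hc (Filter.Eventually.of_forall fun x => ?_)
  rw [Real.norm_eq_abs]
  refine abs_le_of_sq_le_sq ?_ (add_nonneg (hA0 x) (hB0 x))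
  have := h x
  have := mul_nonneg (hA0 x) (hB0 x)
  simp only [Pi.add_apply]
  nlinarith [sq_nonneg (A x), sq_nonneg (B x)]

theorem integral_sq_le_mul (hc : Integrable c μ) (hA : Integrable A μ)
    (hB : Integrable B μ) (hA0 : ∀ x, 0 ≤ A x) (hB0 : ∀ x, 0 ≤ B x)
    (h : ∀ x, c x ^ 2 ≤ A x * B x) : (∫ x, c x ∂μ) ^ 2 ≤ (∫ x, A x ∂μ) * ∫ x, B x ∂μ := by
  refine sq_le_mul_of_quadratic_nonneg fun s t => ?_
  have h1 : 0 ≤ ∫ x, s ^ 2 * A x + 2 * s * t * c x + t ^ 2 * B x ∂μ :=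
    integral_nonneg fun x => quadratic_nonneg_of_sq_le_mul (hA0 x) (hB0 x) (h x) s t
  have i1 : Integrable (fun x => s ^ 2 * A x + 2 * s * t * c x) μ :=
    (hA.const_mul _).add (hc.const_mul _)
  rwa [integral_add i1 (hB.const_mul _), integral_add (hA.const_mul _) (hc.const_mul _), integral_const_mul, integral_const_mul,
    integral_const_mul] at h1

end CauchySchwarz

variable {n N : ℕ} {M : Type*} [TopologicalSpace M]
  [ChartedSpace (EuclideanSpace ℝ (Fin n)) M] [IsManifold (𝓡 n) ∞ M]

/-- Smooth maps into `ℝᴺ`. -/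
abbrev SmoothMap (n : ℕ) {N : ℕ} {M : Type*} [TopologicalSpace M]
    [ChartedSpace (EuclideanSpace ℝ (Fin n)) M] (u : M → EuclideanSpace ℝ (Fin N)) : Prop :=
  ContMDiff (𝓡 n) 𝓘(ℝ, EuclideanSpace ℝ (Fin N)) ∞ u

theorem SmoothMap.component {u : M → EuclideanSpace ℝ (Fin N)} (hu : SmoothMap n u) (k : Fin N) :
    ContMDiff (𝓡 n) 𝓘(ℝ, ℝ) ∞ fun x => u x k :=
  (EuclideanSpace.proj (𝕜 := ℝ) k).contMDiff.comp hu

/-- `⟨∇u, ∇v⟩ = ∑ₖ ⟨∇uᵏ, ∇vᵏ⟩`. -/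
noncomputable def gradDot (g : RMetric n M) (u v : M → EuclideanSpace ℝ (Fin N)) (x : M) : ℝ :=
  ∑ k, gradInner g (fun y => u y k) (fun y => v y k) x

theorem gradNormSq_eq_gradDot (g : RMetric n M) (u : M → EuclideanSpace ℝ (Fin N)) (x : M) :
    gradNormSq g u x = gradDot g u u x := rfl

theorem gradDot_sub_left (g : RMetric n M) {u v w : M → EuclideanSpace ℝ (Fin N)}
    (hu : SmoothMap n u) (hv : SmoothMap n v) (x : M) :
    gradDot g (fun y => u y - v y) w x = gradDot g u w x - gradDot g v w x := by
  rw [gradDot, gradDot, gradDot, ← Finset.sum_sub_distrib]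
  refine Finset.sum_congr rfl fun k _ => ?_
  exact gradInner_sub_left ((hu.component k).mdifferentiable (by simp) x)
    ((hv.component k).mdifferentiable (by simp) x)

theorem gradDot_comm (g : RMetric n M) (u v : M → EuclideanSpace ℝ (Fin N)) (x : M) :
    gradDot g u v x = gradDot g v u x :=
  Finset.sum_congr rfl fun _ _ => gradInner_comm g _ _ x

theorem gradDot_sub_right (g : RMetric n M) {u v w : M → EuclideanSpace ℝ (Fin N)}
    (hu : SmoothMap n u) (hv : SmoothMap n v) (x : M) :
    gradDot g w (fun y => u y - v y) x = gradDot g w u x - gradDot g w v x := by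
  rw [gradDot_comm, gradDot_sub_left g hu hv, gradDot_comm g u, gradDot_comm g v]

theorem gradDot_sq_le (g : RMetric n M) (u v : M → EuclideanSpace ℝ (Fin N)) (x : M) :
    gradDot g u v x ^ 2 ≤ gradNormSq g u x * gradNormSq g v x := by
  refine sq_le_mul_of_quadratic_nonneg fun s t => ?_
  have : s ^ 2 * gradNormSq g u x + 2 * s * t * gradDot g u v x + t ^ 2 * gradNormSq g v x
      = ∑ k, (s ^ 2 * gradInner g (fun y => u y k) (fun y => u y k) x
        + 2 * s * t * gradInner g (fun y => u y k) (fun y => v y k) x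
        + t ^ 2 * gradInner g (fun y => v y k) (fun y => v y k) x) := by
    simp only [gradNormSq, gradDot, Finset.sum_add_distrib, Finset.mul_sum]
  rw [this]
  exact Finset.sum_nonneg fun k _ => quadratic_nonneg_of_sq_le_mul (gradInner_self_nonneg g _ x)
    (gradInner_self_nonneg g _ x) (gradInner_sq_le g _ _ x) s t

theorem continuous_gradDot (g : RMetric n M) {u v : M → EuclideanSpace ℝ (Fin N)}
    (hu : SmoothMap n u) (hv : SmoothMap n v) : Continuous (gradDot g u v) :=
  continuous_finsetSum _ fun k _ => continuous_gradInner g (hu.component k) (hv.component k)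

theorem gradInner_exp_neg (g : RMetric n M) {φ h : M → ℝ} (hφ : ContMDiff (𝓡 n) 𝓘(ℝ, ℝ) ∞ φ)
    (x : M) : gradInner g (fun y => Real.exp (-φ y)) h x
      = -Real.exp (-φ x) * gradInner g φ h x := by
  simp only [gradInner_eq_dirDeriv]
  have hd : HasDerivAt (fun s : ℝ => Real.exp (-s)) (-Real.exp (-φ x)) (φ x) := by
    simpa using (hasDerivAt_neg (φ x)).exp
  have h2 := (hd.differentiableAt.hasFDerivAt.hasMFDerivAt.comp x
    (hφ.mdifferentiable (by simp) x).hasMFDerivAt).mfderiv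
  have h3 : ∀ c : ℝ, fderiv ℝ (fun s : ℝ => Real.exp (-s)) (φ x) c = -Real.exp (-φ x) * c :=
    fun c => by rw [fderiv_eq_smul_deriv, hd.deriv, smul_eq_mul, mul_comm]
  exact (DFunLike.congr_fun h2 (riemGrad g h x)).trans (h3 _)

theorem contMDiff_exp_neg {φ : M → ℝ} (hφ : ContMDiff (𝓡 n) 𝓘(ℝ, ℝ) ∞ φ) :
    ContMDiff (𝓡 n) 𝓘(ℝ, ℝ) ∞ fun y => Real.exp (-φ y) :=
  (Real.contDiff_exp.comp contDiff_neg).contMDiff.comp hφ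

variable [MeasurableSpace M]

/-- The weighted measure `e^{-φ} dvol`. -/
noncomputable def weightedVolume (g : RMetric n M) (φ : M → ℝ) : Measure M :=
  (riemannianVolume g).withDensity fun x => ENNReal.ofReal (Real.exp (-φ x))

variable [BorelSpace M] {g : RMetric n M} {φ : M → ℝ}

theorem measurable_weight (hφ : Continuous φ) :
    Measurable fun x => ENNReal.ofReal (Real.exp (-φ x)) :=
  (Real.continuous_exp.comp hφ.neg).measurable.ennreal_ofReal

theorem integral_weightedVolume (hφ : Continuous φ) (F : M → ℝ) :
    ∫ x, F x ∂(weightedVolume g φ) = ∫ x, F x * Real.exp (-φ x) ∂(riemannianVolume g) := by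
  rw [weightedVolume, integral_withDensity_eq_integral_toReal_smul (measurable_weight hφ)
    (Filter.Eventually.of_forall fun _ => ENNReal.ofReal_lt_top)]
  refine integral_congr_ae (Filter.Eventually.of_forall fun x => ?_)
  simp only [ENNReal.toReal_ofReal (Real.exp_pos _).le, smul_eq_mul, mul_comm]

theorem lintegral_weightedVolume (hφ : Continuous φ) {F : M → ℝ} (hF : Continuous F) :
    ∫⁻ x, ENNReal.ofReal (F x) ∂(weightedVolume g φ)
      = ∫⁻ x, ENNReal.ofReal (F x * Real.exp (-φ x)) ∂(riemannianVolume g) := by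
  rw [weightedVolume, lintegral_withDensity_eq_lintegral_mul _ (measurable_weight hφ)
    hF.measurable.ennreal_ofReal]
  refine lintegral_congr fun x => ?_
  rw [Pi.mul_apply, mul_comm, ← ENNReal.ofReal_mul' (Real.exp_pos _).le]

theorem isLocallyFiniteMeasure_weightedVolume (hφ : Continuous φ) :
    IsLocallyFiniteMeasure (weightedVolume g φ) := by
  have := isLocallyFiniteMeasure_riemannianVolume g
  exact IsLocallyFiniteMeasure.withDensity_ofReal hφ.neg.rexp

theorem isOpenPosMeasure_weightedVolume (hφ : Continuous φ) :
    (weightedVolume g φ).IsOpenPosMeasure := by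
  have := isOpenPosMeasure_riemannianVolume g
  refine Measure.AbsolutelyContinuous.isOpenPosMeasure (μ := riemannianVolume g) ?_
  refine withDensity_absolutelyContinuous' (measurable_weight hφ).aemeasurable ?_
  exact Filter.Eventually.of_forall fun x => (ENNReal.ofReal_pos.2 (Real.exp_pos _)).ne'

theorem sobolevSq_eq (hφ : Continuous φ) {f : M → EuclideanSpace ℝ (Fin N)} (hf : SmoothMap n f) :
    sobolevSq g φ f
      = ∫⁻ x, ENNReal.ofReal (‖f x‖ ^ 2 + gradNormSq g f x) ∂(weightedVolume g φ) :=
  (lintegral_weightedVolume hφ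
    ((hf.continuous.norm.pow 2).add (continuous_gradDot g hf hf))).symm

section L2

variable {f : M → EuclideanSpace ℝ (Fin N)}

theorem integrable_sobolev (hφ : Continuous φ) (hf : SmoothMap n f) (h : sobolevSq g φ f < ⊤) :
    Integrable (fun x => ‖f x‖ ^ 2 + gradNormSq g f x) (weightedVolume g φ) := by
  rw [sobolevSq_eq hφ hf] at h
  refine ⟨((hf.continuous.norm.pow 2).add (continuous_gradDot g hf hf)).aestronglyMeasurable, ?_⟩
  rwa [hasFiniteIntegral_iff_ofReal (Filter.Eventually.of_forall fun x =>
    add_nonneg (sq_nonneg _) (gradNormSq_nonneg g f x))]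

theorem integrable_normSq (hφ : Continuous φ) (hf : SmoothMap n f) (h : sobolevSq g φ f < ⊤) :
    Integrable (fun x => ‖f x‖ ^ 2) (weightedVolume g φ) := by
  refine (integrable_sobolev hφ hf h).mono' (hf.continuous.norm.pow 2).aestronglyMeasurable
    (Filter.Eventually.of_forall fun x => ?_)
  rw [Real.norm_of_nonneg (sq_nonneg _)]
  linarith [gradNormSq_nonneg g f x]

theorem integrable_gradNormSq (hφ : Continuous φ) (hf : SmoothMap n f) (h : sobolevSq g φ f < ⊤) :
    Integrable (gradNormSq g f) (weightedVolume g φ) := by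
  refine (integrable_sobolev hφ hf h).mono' (continuous_gradDot g hf hf).aestronglyMeasurable
    (Filter.Eventually.of_forall fun x => ?_)
  rw [Real.norm_of_nonneg (gradNormSq_nonneg g f x)]
  linarith [sq_nonneg ‖f x‖]

theorem integral_add_eq_sobolevSq_toReal (hφ : Continuous φ) (hf : SmoothMap n f) :
    ∫ x, (‖f x‖ ^ 2 + gradNormSq g f x) ∂(weightedVolume g φ) = (sobolevSq g φ f).toReal := by
  rw [sobolevSq_eq hφ hf, integral_eq_lintegral_of_nonneg_ae (Filter.Eventually.of_forall fun x =>
    add_nonneg (sq_nonneg _) (gradNormSq_nonneg g f x))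
    ((hf.continuous.norm.pow 2).add (continuous_gradDot g hf hf)).aestronglyMeasurable]

end L2

theorem hasCompactSupport_gradDot (g : RMetric n M) {h v : M → EuclideanSpace ℝ (Fin N)}
    (hc : HasCompactSupport h) : HasCompactSupport (gradDot g h v) := by
  refine hc.mono' fun x hx => ?_
  by_contra hxs
  refine hx (Finset.sum_eq_zero fun k _ => ?_)
  have : (fun y => h y k) =ᶠ[nhds x] fun _ => 0 := by
    filter_upwards [notMem_tsupport_iff_eventuallyEq.1 hxs] with y hy
    simp [hy]
  rw [gradInner_eq_dirDeriv, dirDeriv, this.mfderiv_eq, mfderiv_const]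
  rfl

theorem sobolevSq_lt_top_of_hasCompactSupport (hφ : Continuous φ)
    {h : M → EuclideanSpace ℝ (Fin N)} (hh : SmoothMap n h) (hc : HasCompactSupport h) :
    sobolevSq g φ h < ⊤ := by
  have := isLocallyFiniteMeasure_weightedVolume (g := g) hφ
  rw [sobolevSq_eq hφ hh]
  refine Integrable.lintegral_lt_top ?_
  refine Integrable.add ?_ ?_
  · have hc2 : HasCompactSupport fun x => ‖h x‖ ^ 2 :=
      hc.comp_left (g := fun v : EuclideanSpace ℝ (Fin N) => ‖v‖ ^ 2) (by simp)
    have hc1 : Continuous fun x => ‖h x‖ ^ 2 := hh.continuous.norm.pow 2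
    exact hc1.integrable_of_hasCompactSupport hc2
  · exact (continuous_gradDot g hh hh).integrable_of_hasCompactSupport
      (hasCompactSupport_gradDot g hc)

theorem sobolevSq_add_le (hφ : Continuous φ) {u v : M → EuclideanSpace ℝ (Fin N)}
    (hu : SmoothMap n u) (hv : SmoothMap n v) :
    sobolevSq g φ u ≤ 2 * sobolevSq g φ (fun x => u x - v x) + 2 * sobolevSq g φ v := by
  have hd : SmoothMap n fun x => u x - v x := hu.sub hv
  have hm : Measurable fun x => 2 * ENNReal.ofReal
      (‖u x - v x‖ ^ 2 + gradNormSq g (fun x => u x - v x) x) :=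
    ((hd.continuous.norm.pow 2).add
      (continuous_gradDot g hd hd)).measurable.ennreal_ofReal.const_mul _
  rw [sobolevSq_eq hφ hu, sobolevSq_eq hφ hv, sobolevSq_eq hφ hd,
    ← lintegral_const_mul' _ _ (by simp), ← lintegral_const_mul' _ _ (by simp),
    ← lintegral_add_left hm]
  refine lintegral_mono fun x => ?_
  have h0 : ∀ w : M → EuclideanSpace ℝ (Fin N), 0 ≤ ‖w x‖ ^ 2 + gradNormSq g w x :=
    fun w => add_nonneg (sq_nonneg _) (gradNormSq_nonneg g w x)
  have two : ∀ r : ℝ, 2 * ENNReal.ofReal r = ENNReal.ofReal (2 * r) := fun r => by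
    rw [ENNReal.ofReal_mul (by norm_num), ENNReal.ofReal_ofNat]
  rw [two, two, ← ENNReal.ofReal_add
    (mul_nonneg (by norm_num) (h0 fun x => u x - v x)) (mul_nonneg (by norm_num) (h0 v))]
  refine ENNReal.ofReal_le_ofReal ?_
  have h1 : ‖u x‖ ^ 2 ≤ 2 * ‖u x - v x‖ ^ 2 + 2 * ‖v x‖ ^ 2 := by
    have := norm_add_le (u x - v x) (v x)
    rw [sub_add_cancel] at this
    nlinarith [sq_nonneg (‖u x - v x‖ - ‖v x‖), norm_nonneg (u x)]
  have h2 : gradNormSq g u x ≤ 2 * gradNormSq g (fun x => u x - v x) x + 2 * gradNormSq g v x := by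
    have e : gradNormSq g (fun x => u x - v x) x
        = gradNormSq g u x - 2 * gradDot g u v x + gradNormSq g v x := by
      rw [gradNormSq_eq_gradDot, gradDot_sub_left g hu hv, gradDot_sub_right g hu hv,
        gradDot_sub_right g hu hv, gradDot_comm g v u]
      simp only [gradNormSq_eq_gradDot]; ring
    -- The coefficients `1` and `-2` express `|∇(u - 2v)|² ≥ 0`, which is the difference of the two
    -- sides of `h2`.
    have := quadratic_nonneg_of_sq_le_mul (gradNormSq_nonneg g u x) (gradNormSq_nonneg g v x)
      (gradDot_sq_le g u v x) 1 (-2)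
    rw [e]
    linarith
  linarith

/-- One approximant at distance `1` suffices, since compactly supported smooth functions have finite
norm. -/
theorem MemSobolev.sobolevSq_lt_top (hφ : Continuous φ) {u : M → EuclideanSpace ℝ (Fin N)}
    (hu : SmoothMap n u) (h : MemSobolev g φ u) : sobolevSq g φ u < ⊤ := by
  obtain ⟨v, hv, hc, hlt⟩ := h 1 one_pos
  refine (sobolevSq_add_le hφ hu hv).trans_lt ?_
  have := sobolevSq_lt_top_of_hasCompactSupport (g := g) hφ hv hc
  exact ENNReal.add_lt_top.2 ⟨ENNReal.mul_lt_top (by simp) (hlt.trans (by simp)),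
    ENNReal.mul_lt_top (by simp) this⟩

variable [T2Space M] [SecondCountableTopology M]

theorem continuous_driftLaplacian (hφ : ContMDiff (𝓡 n) 𝓘(ℝ, ℝ) ∞ φ)
    {v : M → EuclideanSpace ℝ (Fin N)} (hv : SmoothMap n v) :
    Continuous (driftLaplacian g φ v) := by
  refine (PiLp.continuous_toLp 2 _).comp (continuous_pi fun k => ?_)
  exact (continuous_laplacian g (hv.component k)).sub (continuous_gradInner g (hv.component k) hφ)

/-- Green's formula with the test function `η e^{-φ}`: the derivative of the weight produces exactly
the drift term. -/
theorem integral_mul_driftLaplacian (hφ : ContMDiff (𝓡 n) 𝓘(ℝ, ℝ) ∞ φ) {f η : M → ℝ}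
    (hf : ContMDiff (𝓡 n) 𝓘(ℝ, ℝ) ∞ f) (hη : ContMDiff (𝓡 n) 𝓘(ℝ, ℝ) ∞ η)
    (hc : HasCompactSupport η) :
    ∫ x, η x * (laplacian g f x - gradInner g f φ x) ∂(weightedVolume g φ)
      = -∫ x, gradInner g η f x ∂(weightedVolume g φ) := by
  have := isLocallyFiniteMeasure_riemannianVolume g
  have hE := contMDiff_exp_neg hφ
  have hηE : ContMDiff (𝓡 n) 𝓘(ℝ, ℝ) ∞ fun x => η x * Real.exp (-φ x) := hη.mul hE
  have hcE : HasCompactSupport fun x => η x * Real.exp (-φ x) := hc.mul_right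
  have key := integral_mul_laplacian g hf hηE hcE
  have e : ∀ x, gradInner g (fun y => η y * Real.exp (-φ y)) f x
      = gradInner g η f x * Real.exp (-φ x) - η x * gradInner g f φ x * Real.exp (-φ x) := by
    intro x
    rw [gradInner_mul_left (mdifferentiableAt_of_contMDiff hη x)
      (mdifferentiableAt_of_contMDiff hE x), gradInner_exp_neg g hφ, gradInner_comm g φ f]
    ring
  have i1 : Integrable (fun x => gradInner g η f x * Real.exp (-φ x)) (riemannianVolume g) :=
    ((continuous_gradInner g hη hf).mul hE.continuous).integrable_of_hasCompactSupport
      (hasCompactSupport_gradInner g hc).mul_right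
  have i2 : Integrable (fun x => η x * gradInner g f φ x * Real.exp (-φ x))
      (riemannianVolume g) :=
    ((hη.continuous.mul (continuous_gradInner g hf hφ)).mul
      hE.continuous).integrable_of_hasCompactSupport (hc.mul_right).mul_right
  have i3 : Integrable (fun x => η x * Real.exp (-φ x) * laplacian g f x) (riemannianVolume g) :=
    (hηE.continuous.mul (continuous_laplacian g hf)).integrable_of_hasCompactSupport hcE.mul_right
  simp only [e] at key
  rw [integral_sub i1 i2] at key
  rw [integral_weightedVolume hφ.continuous, integral_weightedVolume hφ.continuous]
  have e2 : ∀ x, η x * (laplacian g f x - gradInner g f φ x) * Real.exp (-φ x)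
      = η x * Real.exp (-φ x) * laplacian g f x - η x * gradInner g f φ x * Real.exp (-φ x) :=
    fun x => by ring
  simp only [e2]
  rw [integral_sub i3 i2]
  linarith

theorem inner_eq_sum (v w : EuclideanSpace ℝ (Fin N)) : inner ℝ v w = ∑ k, v k * w k := by
  simp [PiLp.inner_apply, mul_comm]

theorem integral_inner_driftLaplacian_of_hasCompactSupport (hφ : ContMDiff (𝓡 n) 𝓘(ℝ, ℝ) ∞ φ)
    {h v : M → EuclideanSpace ℝ (Fin N)} (hh : SmoothMap n h) (hc : HasCompactSupport h)
    (hv : SmoothMap n v) :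
    ∫ x, inner ℝ (h x) (driftLaplacian g φ v x) ∂(weightedVolume g φ)
      = -∫ x, gradDot g h v x ∂(weightedVolume g φ) := by
  have := isLocallyFiniteMeasure_weightedVolume (g := g) hφ.continuous
  have hck : ∀ k, HasCompactSupport fun x => h x k := fun k =>
    hc.comp_left (g := fun v : EuclideanSpace ℝ (Fin N) => v k) rfl
  simp only [inner_eq_sum, gradDot]
  rw [integral_finsetSum _ fun k _ => ?_, integral_finsetSum _ fun k _ => ?_,
    ← Finset.sum_neg_distrib]
  · exact Finset.sum_congr rfl fun k _ =>
      integral_mul_driftLaplacian hφ (hv.component k) (hh.component k) (hck k)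
  · exact (continuous_gradInner g (hh.component k) (hv.component k)).integrable_of_hasCompactSupport
      (hasCompactSupport_gradInner g (hck k))
  · refine ((hh.component k).continuous.mul ?_).integrable_of_hasCompactSupport (hck k).mul_right
    exact (continuous_laplacian g (hv.component k)).sub
      (continuous_gradInner g (hv.component k) hφ)

theorem inner_sq_le (v w : EuclideanSpace ℝ (Fin N)) : inner ℝ v w ^ 2 ≤ ‖v‖ ^ 2 * ‖w‖ ^ 2 := by
  rw [← mul_pow, ← sq_abs]
  exact pow_le_pow_left₀ (abs_nonneg _) (abs_real_inner_le_norm v w) 2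

/-- Integration by parts against functions of the weighted Sobolev space. -/
theorem integral_inner_driftLaplacian (hφ : ContMDiff (𝓡 n) 𝓘(ℝ, ℝ) ∞ φ)
    {w v : M → EuclideanSpace ℝ (Fin N)} (hw : SmoothMap n w) (hwS : MemSobolev g φ w)
    (hv : SmoothMap n v) (hvS : sobolevSq g φ v < ⊤)
    (hL : Integrable (fun x => ‖driftLaplacian g φ v x‖ ^ 2) (weightedVolume g φ)) :
    ∫ x, inner ℝ (w x) (driftLaplacian g φ v x) ∂(weightedVolume g φ)
      = -∫ x, gradDot g w v x ∂(weightedVolume g φ) := by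
  set μ := weightedVolume g φ with hμ
  have hG := integrable_gradNormSq hφ.continuous hv hvS
  have hiL : ∀ {f : M → EuclideanSpace ℝ (Fin N)}, SmoothMap n f → sobolevSq g φ f < ⊤ →
      Integrable (fun x => inner ℝ (f x) (driftLaplacian g φ v x)) μ := fun {f} hf h =>
    integrable_of_sq_le_mul (hf.continuous.inner
      (continuous_driftLaplacian hφ hv)).aestronglyMeasurable
      (integrable_normSq hφ.continuous hf h) hL (fun _ => sq_nonneg _) (fun _ => sq_nonneg _)
      fun x => inner_sq_le _ _
  have hiG : ∀ {f : M → EuclideanSpace ℝ (Fin N)}, SmoothMap n f → sobolevSq g φ f < ⊤ →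
      Integrable (gradDot g f v) μ := fun {f} hf h =>
    integrable_of_sq_le_mul (continuous_gradDot g hf hv).aestronglyMeasurable
      (integrable_gradNormSq hφ.continuous hf h) hG (gradNormSq_nonneg g f) (gradNormSq_nonneg g v)
      fun x => gradDot_sq_le g f v x
  set A := ∫ x, ‖driftLaplacian g φ v x‖ ^ 2 ∂μ
  set B := ∫ x, gradNormSq g v x ∂μ
  -- `Z` is the defect of the formula. It is linear in `w` and zero for compactly supported
  -- functions, so `w` may be replaced by `w - h`, after which Cauchy-Schwarz makes it arbitrarily
  -- small.
  set Z := ∫ x, inner ℝ (w x) (driftLaplacian g φ v x) ∂μ + ∫ x, gradDot g w v x ∂μ with hZ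
  have hA : 0 ≤ A := integral_nonneg fun _ => sq_nonneg _
  have hB : 0 ≤ B := integral_nonneg fun x => gradNormSq_nonneg g v x
  have hwt := hwS.sobolevSq_lt_top hφ.continuous hw
  have bound : ∀ ε : ℝ, 0 < ε → Z ^ 2 ≤ ε * (2 * A + 2 * B) := by
    intro ε hε
    obtain ⟨h, hh, hc, hlt⟩ := hwS (ENNReal.ofReal ε) (ENNReal.ofReal_pos.2 hε)
    have hh' : SmoothMap n h := hh
    have hd : SmoothMap n fun x => w x - h x := hw.sub hh
    have hdt : sobolevSq g φ (fun x => w x - h x) < ⊤ := hlt.trans ENNReal.ofReal_lt_top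
    have hht := sobolevSq_lt_top_of_hasCompactSupport (g := g) hφ.continuous hh' hc
    have hcomp := integral_inner_driftLaplacian_of_hasCompactSupport (g := g) hφ hh' hc hv
    have hZ' : Z = ∫ x, inner ℝ (w x - h x) (driftLaplacian g φ v x) ∂μ
        + ∫ x, gradDot g (fun y => w y - h y) v x ∂μ := by
      simp only [inner_sub_left, gradDot_sub_left g hw hh']
      rw [integral_sub (hiL hw hwt) (hiL hh' hht), integral_sub (hiG hw hwt) (hiG hh' hht), hcomp,
        hZ]
      ring
    have c1 := integral_sq_le_mul (hiL hd hdt) (integrable_normSq hφ.continuous hd hdt) hL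
      (fun _ => sq_nonneg _) (fun _ => sq_nonneg _) fun x => inner_sq_le _ _
    have c2 := integral_sq_le_mul (hiG hd hdt) (integrable_gradNormSq hφ.continuous hd hdt) hG
      (gradNormSq_nonneg g _) (gradNormSq_nonneg g v) fun x => gradDot_sq_le g _ v x
    have hsum := integral_add_eq_sobolevSq_toReal (g := g) hφ.continuous hd
    rw [integral_add (integrable_normSq hφ.continuous hd hdt)
      (integrable_gradNormSq hφ.continuous hd hdt)] at hsum
    have hle : (sobolevSq g φ fun x => w x - h x).toReal ≤ ε :=
      ENNReal.toReal_le_of_le_ofReal hε.le hlt.le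
    have n1 : 0 ≤ ∫ x, ‖w x - h x‖ ^ 2 ∂μ := integral_nonneg fun _ => sq_nonneg _
    have n2 : 0 ≤ ∫ x, gradNormSq g (fun y => w y - h y) x ∂μ :=
      integral_nonneg fun x => gradNormSq_nonneg g _ x
    have d1 := c1.trans (mul_le_mul_of_nonneg_right (show _ ≤ ε by linarith) hA)
    have d2 := c2.trans (mul_le_mul_of_nonneg_right (show _ ≤ ε by linarith) hB)
    rw [hZ']
    nlinarith [sq_nonneg (∫ x, inner ℝ (w x - h x) (driftLaplacian g φ v x) ∂μ
      - ∫ x, gradDot g (fun y => w y - h y) v x ∂μ)]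
  have hZ0 : Z = 0 := by
    by_contra hne
    have hpos : 0 < Z ^ 2 := by positivity
    -- This choice of `ε` makes the right side of `bound` at most `Z²/2`.
    have := bound (Z ^ 2 / (2 * (2 * A + 2 * B + 1))) (by positivity)
    rw [div_mul_eq_mul_div, le_div_iff₀ (by positivity)] at this
    nlinarith
  linarith

end DriftHeat

/-! ### Time derivatives on `M × [a, b]`, end points included. -/

namespace DriftHeat

section TimeSpace

variable {E F : Type*} [NormedAddCommGroup E] [NormedSpace ℝ E] [NormedAddCommGroup F]
  [NormedSpace ℝ F] {T : Set E} {a b : ℝ} {H : E × ℝ → F} {y : E} {t : ℝ}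

theorem uniqueDiffOn_prod_Icc (hT : IsOpen T) (hab : a < b) :
    UniqueDiffOn ℝ (T ×ˢ Set.Icc a b) := hT.uniqueDiffOn.prod (uniqueDiffOn_Icc hab)

theorem prod_Icc_subset_closure_interior (hT : IsOpen T) (hab : a < b) :
    T ×ˢ Set.Icc a b ⊆ closure (interior (T ×ˢ Set.Icc a b)) := by
  rw [interior_prod_eq, closure_prod_eq, interior_Icc, closure_Ioo hab.ne, hT.interior_eq]
  exact Set.prod_mono subset_closure subset_rfl

theorem hasDerivWithinAt_time (hH : DifferentiableOn ℝ H (T ×ˢ Set.Icc a b)) (hy : y ∈ T)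
    (ht : t ∈ Set.Icc a b) :
    HasDerivWithinAt (fun s => H (y, s))
      (fderivWithin ℝ H (T ×ˢ Set.Icc a b) (y, t) (0, 1)) (Set.Icc a b) t := by
  have h1 : HasDerivWithinAt (fun s : ℝ => (y, s)) ((0 : E), (1 : ℝ)) (Set.Icc a b) t :=
    (hasDerivWithinAt_const t _ y).prodMk (hasDerivWithinAt_id t _)
  exact (hH (y, t) ⟨hy, ht⟩).hasFDerivWithinAt.comp_hasDerivWithinAt t h1 fun s hs => ⟨hy, hs⟩

theorem fderiv_space (hT : IsOpen T) (hH : DifferentiableOn ℝ H (T ×ˢ Set.Icc a b)) (hy : y ∈ T)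
    (ht : t ∈ Set.Icc a b) (v : E) :
    fderiv ℝ (fun z => H (z, t)) y v = fderivWithin ℝ H (T ×ˢ Set.Icc a b) (y, t) (v, 0) := by
  have h1 : HasFDerivWithinAt (fun z : E => (z, t)) (ContinuousLinearMap.inl ℝ E ℝ) T y :=
    (hasFDerivAt_prodMk_left y t).hasFDerivWithinAt
  have hm : Set.MapsTo (fun z : E => (z, t)) T (T ×ˢ Set.Icc a b) := fun s hs => ⟨hs, ht⟩
  have h2 := (hH (y, t) ⟨hy, ht⟩).hasFDerivWithinAt.comp y h1 hm
  have h3 := (h2.hasFDerivAt (hT.mem_nhds hy)).fderiv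
  exact DFunLike.congr_fun h3 v

/-- Time and space derivatives commute, up to the end points of the time interval. -/
theorem hasDerivWithinAt_fderiv_space (hT : IsOpen T) (hab : a < b)
    (hH : ContDiffOn ℝ ∞ H (T ×ˢ Set.Icc a b)) (hy : y ∈ T) (ht : t ∈ Set.Icc a b) (v : E) :
    HasDerivWithinAt (fun s => fderiv ℝ (fun z => H (z, s)) y v)
      (fderiv ℝ (fun z => fderivWithin ℝ H (T ×ˢ Set.Icc a b) (z, t) (0, 1)) y v)
      (Set.Icc a b) t := by
  set S := T ×ˢ Set.Icc a b with hS
  have hSu : UniqueDiffOn ℝ S := uniqueDiffOn_prod_Icc hT hab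
  have hd : DifferentiableOn ℝ H S := hH.differentiableOn (by simp)
  have hD : ContDiffOn ℝ ∞ (fderivWithin ℝ H S) S := hH.fderivWithin hSu le_rfl
  have hDd : DifferentiableOn ℝ (fderivWithin ℝ H S) S := hD.differentiableOn (by simp)
  have happ : ∀ w z, z ∈ S → HasFDerivWithinAt (fun z => fderivWithin ℝ H S z w)
      ((ContinuousLinearMap.apply ℝ F w).comp (fderivWithin ℝ (fderivWithin ℝ H S) S z)) S z :=
    fun w z hz => (ContinuousLinearMap.apply ℝ F w).hasFDerivAt.comp_hasFDerivWithinAt z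
      (hDd z hz).hasFDerivWithinAt
  have happd : ∀ w, DifferentiableOn ℝ (fun z => fderivWithin ℝ H S z w) S := fun w z hz =>
    (happ w z hz).differentiableWithinAt
  have hz : ((y, t) : E × ℝ) ∈ S := ⟨hy, ht⟩
  -- Symmetry of the second derivative holds at the end points too, because `T × [a, b]` lies in the
  -- closure of its interior.
  have hsymm : IsSymmSndFDerivWithinAt ℝ H S (y, t) :=
    (hH (y, t) hz).isSymmSndFDerivWithinAt (by simpa using ENat.LEInfty.out) hSu
      (prod_Icc_subset_closure_interior hT hab hz) hz
  rw [fderiv_space hT (happd (0, 1)) hy ht, (happ _ _ hz).fderivWithin (hSu _ hz)]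
  have h1 := hasDerivWithinAt_time (happd (v, 0)) hy ht
  rw [← hS, (happ _ _ hz).fderivWithin (hSu _ hz)] at h1
  simp only [ContinuousLinearMap.comp_apply, ContinuousLinearMap.apply_apply] at h1 ⊢
  rw [hsymm.eq] at h1
  exact h1.congr (fun s hs => fderiv_space hT hd hy hs v) (fderiv_space hT hd hy ht v)

end TimeSpace

variable {n N : ℕ} {M : Type*} [TopologicalSpace M]
  [ChartedSpace (EuclideanSpace ℝ (Fin n)) M] [IsManifold (𝓡 n) ∞ M]

section Smooth

variable {F : Type*} [NormedAddCommGroup F] [NormedSpace ℝ F] {a b : ℝ} {f : M → ℝ → F}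

/-- Functions that are smooth on `M × [a, b]`. -/
abbrev SmoothOnTime (n : ℕ) {M F : Type*} [TopologicalSpace M]
    [ChartedSpace (EuclideanSpace ℝ (Fin n)) M] [NormedAddCommGroup F] [NormedSpace ℝ F]
    (a b : ℝ) (f : M → ℝ → F) : Prop :=
  ContMDiffOn ((𝓡 n).prod 𝓘(ℝ, ℝ)) 𝓘(ℝ, F) ∞ (fun p : M × ℝ => f p.1 p.2)
    (Set.univ ×ˢ Set.Icc a b)

theorem SmoothOnTime.slice (hf : SmoothOnTime n a b f) {t : ℝ} (ht : t ∈ Set.Icc a b) :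
    ContMDiff (𝓡 n) 𝓘(ℝ, F) ∞ fun x => f x t := by
  rw [← contMDiffOn_univ]
  exact hf.comp (contMDiff_id.prodMk contMDiff_const).contMDiffOn fun x _ => ⟨Set.mem_univ _, ht⟩

theorem SmoothOnTime.contDiffOn_time (hf : SmoothOnTime n a b f) (x : M) :
    ContDiffOn ℝ ∞ (f x) (Set.Icc a b) := by
  rw [← contMDiffOn_iff_contDiffOn]
  exact hf.comp (contMDiff_const.prodMk contMDiff_id).contMDiffOn fun t ht => ⟨Set.mem_univ _, ht⟩

theorem SmoothOnTime.hasDerivWithinAt (hf : SmoothOnTime n a b f) (x : M) {t : ℝ}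
    (ht : t ∈ Set.Icc a b) :
    HasDerivWithinAt (f x) (derivWithin (f x) (Set.Icc a b) t) (Set.Icc a b) t :=
  ((hf.contDiffOn_time x).differentiableOn (by simp) t ht).hasDerivWithinAt

/-- A function on `M × ℝ` in the chart around `p`. -/
noncomputable def chartExpr (p : M) (f : M → ℝ → F) (z : EuclideanSpace ℝ (Fin n) × ℝ) : F :=
  f ((extChartAt (𝓡 n) p).symm z.1) z.2

theorem SmoothOnTime.contDiffOn_chartExpr (hf : SmoothOnTime n a b f) (p : M) :
    ContDiffOn ℝ ∞ (chartExpr p f) ((extChartAt (𝓡 n) p).target ×ˢ Set.Icc a b) := by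
  rw [← contMDiffOn_iff_contDiffOn]
  have h1 : ContMDiffOn 𝓘(ℝ, EuclideanSpace ℝ (Fin n) × ℝ) (𝓡 n) ∞
      (fun z : EuclideanSpace ℝ (Fin n) × ℝ => (extChartAt (𝓡 n) p).symm z.1)
      ((extChartAt (𝓡 n) p).target ×ˢ Set.Icc a b) :=
    (contMDiffOn_extChartAt_symm p).comp contDiff_fst.contMDiff.contMDiffOn fun z hz => hz.1
  exact hf.comp (h1.prodMk contDiff_snd.contMDiff.contMDiffOn) fun z hz => ⟨Set.mem_univ _, hz.2⟩

theorem SmoothOnTime.derivWithin_eq (hab : a < b) (hf : SmoothOnTime n a b f) {p : M}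
    {y : EuclideanSpace ℝ (Fin n)} (hy : y ∈ (extChartAt (𝓡 n) p).target) {t : ℝ}
    (ht : t ∈ Set.Icc a b) :
    derivWithin (f ((extChartAt (𝓡 n) p).symm y)) (Set.Icc a b) t
      = fderivWithin ℝ (chartExpr p f) ((extChartAt (𝓡 n) p).target ×ˢ Set.Icc a b) (y, t)
        (0, 1) :=
  (hasDerivWithinAt_time ((hf.contDiffOn_chartExpr p).differentiableOn (by simp)) hy
    ht).derivWithin (uniqueDiffOn_Icc hab t ht)

theorem contMDiffOn_of_chartExpr {h : M → ℝ → F}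
    (hh : ∀ p, ContDiffOn ℝ ∞ (chartExpr p h) ((extChartAt (𝓡 n) p).target ×ˢ Set.Icc a b)) :
    SmoothOnTime n a b h := by
  rintro ⟨p, t⟩ ⟨-, ht⟩
  have h1 : ContMDiffOn ((𝓡 n).prod 𝓘(ℝ, ℝ)) 𝓘(ℝ, EuclideanSpace ℝ (Fin n) × ℝ) ∞
      (fun z : M × ℝ => (extChartAt (𝓡 n) p z.1, z.2))
      ((extChartAt (𝓡 n) p).source ×ˢ Set.Icc a b) := by
    have h2 : ContMDiffOn ((𝓡 n).prod 𝓘(ℝ, ℝ)) 𝓘(ℝ, EuclideanSpace ℝ (Fin n)) ∞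
        (fun z : M × ℝ => extChartAt (𝓡 n) p z.1)
        ((extChartAt (𝓡 n) p).source ×ˢ Set.Icc a b) :=
      (contMDiffOn_extChartAt (x := p)).comp contMDiff_fst.contMDiffOn
        fun z hz => by simpa using hz.1
    exact h2.prodMk_space contMDiff_snd.contMDiffOn
  have h3 : ContMDiffOn ((𝓡 n).prod 𝓘(ℝ, ℝ)) 𝓘(ℝ, F) ∞ (fun z : M × ℝ => h z.1 z.2)
      ((extChartAt (𝓡 n) p).source ×ˢ Set.Icc a b) := by
    refine ((hh p).contMDiffOn.comp h1
      fun z hz => ⟨(extChartAt (𝓡 n) p).map_source hz.1, hz.2⟩).congr fun z hz => ?_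
    simp only [Function.comp_apply, chartExpr, (extChartAt (𝓡 n) p).left_inv hz.1]
  refine (h3 (p, t) ⟨mem_extChartAt_source p, ht⟩).mono_of_mem_nhdsWithin ?_
  refine mem_nhdsWithin.2 ⟨(extChartAt (𝓡 n) p).source ×ˢ Set.univ,
    (isOpen_extChartAt_source p).prod isOpen_univ, ⟨mem_extChartAt_source p, trivial⟩, ?_⟩
  exact fun z hz => ⟨hz.1.1, hz.2.2⟩

theorem smoothOnTime_derivWithin (hab : a < b) (hf : SmoothOnTime n a b f) :
    SmoothOnTime n a b fun x t => derivWithin (f x) (Set.Icc a b) t := by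
  refine contMDiffOn_of_chartExpr fun p => ?_
  refine ContDiffOn.congr (f := fun z => fderivWithin ℝ (chartExpr p f)
    ((extChartAt (𝓡 n) p).target ×ˢ Set.Icc a b) z (0, 1)) ?_
    fun z hz => hf.derivWithin_eq hab hz.1 hz.2
  exact ((hf.contDiffOn_chartExpr p).fderivWithin
    (uniqueDiffOn_prod_Icc (isOpen_target p) hab) le_rfl).clm_apply contDiffOn_const

end Smooth

section Gradient

variable {a b : ℝ} {f h : M → ℝ → ℝ}

theorem SmoothOnTime.hasDerivWithinAt_coord (hab : a < b) (hf : SmoothOnTime n a b f) {p : M}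
    {y : EuclideanSpace ℝ (Fin n)} (hy : y ∈ (extChartAt (𝓡 n) p).target) {t : ℝ}
    (ht : t ∈ Set.Icc a b) (v : EuclideanSpace ℝ (Fin n)) :
    HasDerivWithinAt (fun s => fderiv ℝ ((fun x => f x s) ∘ (extChartAt (𝓡 n) p).symm) y v)
      (fderiv ℝ ((fun x => derivWithin (f x) (Set.Icc a b) t) ∘ (extChartAt (𝓡 n) p).symm) y v)
      (Set.Icc a b) t := by
  have h1 := hasDerivWithinAt_fderiv_space (isOpen_target p) hab (hf.contDiffOn_chartExpr p) hy ht v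
  have h2 : (fun z => fderivWithin ℝ (chartExpr p f)
        ((extChartAt (𝓡 n) p).target ×ˢ Set.Icc a b) (z, t) (0, 1))
      =ᶠ[nhds y] (fun x => derivWithin (f x) (Set.Icc a b) t) ∘ (extChartAt (𝓡 n) p).symm := by
    filter_upwards [(isOpen_target p).mem_nhds hy] with z hz
    exact (hf.derivWithin_eq hab hz ht).symm
  rw [h2.fderiv_eq] at h1
  exact h1

theorem SmoothOnTime.continuousOn_coord (hab : a < b) (hf : SmoothOnTime n a b f) (p : M)
    (v : EuclideanSpace ℝ (Fin n)) :
    ContinuousOn (fun z : EuclideanSpace ℝ (Fin n) × ℝ =>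
        fderiv ℝ ((fun x => f x z.2) ∘ (extChartAt (𝓡 n) p).symm) z.1 v)
      ((extChartAt (𝓡 n) p).target ×ˢ Set.Icc a b) := by
  have hc := hf.contDiffOn_chartExpr p
  refine ContinuousOn.congr (f := fun z => fderivWithin ℝ (chartExpr p f)
    ((extChartAt (𝓡 n) p).target ×ˢ Set.Icc a b) z (v, 0)) ?_ fun z hz =>
    fderiv_space (isOpen_target p) (hc.differentiableOn (by simp)) hz.1 hz.2 v
  exact ((hc.fderivWithin (m := ∞) (uniqueDiffOn_prod_Icc (isOpen_target p) hab) le_rfl).clm_apply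
    contDiffOn_const).continuousOn

/-- In a fixed chart the inverse metric does not depend on time, so this is the product rule
together with the exchange of time and space derivatives. -/
theorem hasDerivWithinAt_gradInner (g : RMetric n M) (hab : a < b) (hf : SmoothOnTime n a b f)
    (hh : SmoothOnTime n a b h) (x : M) {t : ℝ} (ht : t ∈ Set.Icc a b) :
    HasDerivWithinAt (fun s => gradInner g (fun y => f y s) (fun y => h y s) x)
      (gradInner g (fun y => derivWithin (f y) (Set.Icc a b) t) (fun y => h y t) x
        + gradInner g (fun y => f y t) (fun y => derivWithin (h y) (Set.Icc a b) t) x)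
      (Set.Icc a b) t := by
  obtain ⟨p, y, hy, rfl⟩ : ∃ p : M, ∃ y ∈ (extChartAt (𝓡 n) p).target,
      (extChartAt (𝓡 n) p).symm y = x := ⟨x, _, mem_extChartAt_target x, extChartAt_to_inv x⟩
  have hf' := smoothOnTime_derivWithin hab hf
  have hh' := smoothOnTime_derivWithin hab hh
  have md : ∀ {k : M → ℝ → ℝ}, SmoothOnTime n a b k → ∀ {s}, s ∈ Set.Icc a b → ∀ z,
      MDifferentiableAt (𝓡 n) 𝓘(ℝ, ℝ) (fun x => k x s) z :=
    fun hk _ hs z => (hk.slice hs).mdifferentiable (by simp) z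
  have h1 : HasDerivWithinAt (fun s => ∑ i, ∑ j, (chartGram g p y)⁻¹ i j *
      fderiv ℝ ((fun x => h x s) ∘ (extChartAt (𝓡 n) p).symm) y (stdVec j) *
      fderiv ℝ ((fun x => f x s) ∘ (extChartAt (𝓡 n) p).symm) y (stdVec i)) _ (Set.Icc a b) t :=
    HasDerivWithinAt.fun_sum fun i _ => HasDerivWithinAt.fun_sum fun j _ =>
      ((hh.hasDerivWithinAt_coord hab hy ht (stdVec j)).const_mul _).mul
        (hf.hasDerivWithinAt_coord hab hy ht (stdVec i))
  refine (h1.congr_deriv ?_).congr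
    (fun s hs => gradInner_eq_coord g hy (md hf hs _) (md hh hs _))
    (gradInner_eq_coord g hy (md hf ht _) (md hh ht _))
  rw [gradInner_eq_coord g hy (md hf' ht _) (md hh ht _),
    gradInner_eq_coord g hy (md hf ht _) (md hh' ht _), add_comm]
  simp only [← Finset.sum_add_distrib]

theorem continuousOn_gradInner_time (g : RMetric n M) (hab : a < b) (hf : SmoothOnTime n a b f)
    (hh : SmoothOnTime n a b h) :
    ContinuousOn (fun z : M × ℝ => gradInner g (fun y => f y z.2) (fun y => h y z.2) z.1)
      (Set.univ ×ˢ Set.Icc a b) := by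
  rintro ⟨p, t⟩ ⟨-, ht⟩
  set T := (extChartAt (𝓡 n) p).target
  have h1 : ContinuousOn (fun z : EuclideanSpace ℝ (Fin n) × ℝ =>
      ∑ i, ∑ j, (chartGram g p z.1)⁻¹ i j *
      fderiv ℝ ((fun x => h x z.2) ∘ (extChartAt (𝓡 n) p).symm) z.1 (stdVec j) *
      fderiv ℝ ((fun x => f x z.2) ∘ (extChartAt (𝓡 n) p).symm) z.1 (stdVec i))
      (T ×ˢ Set.Icc a b) := by
    refine continuousOn_finsetSum _ fun i _ => continuousOn_finsetSum _ fun j _ => ?_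
    exact (((contDiffOn_chartGramInv g p i j).continuousOn.comp continuousOn_fst
      fun z hz => hz.1).mul (hh.continuousOn_coord hab p _)).mul (hf.continuousOn_coord hab p _)
  have h2 : ContinuousOn (fun z : M × ℝ => (extChartAt (𝓡 n) p z.1, z.2))
      ((extChartAt (𝓡 n) p).source ×ˢ Set.Icc a b) :=
    ((continuousOn_extChartAt p).comp continuousOn_fst fun z hz => hz.1).prodMk continuousOn_snd
  have h3 : ContinuousOn (fun z : M × ℝ => gradInner g (fun y => f y z.2) (fun y => h y z.2) z.1)
      ((extChartAt (𝓡 n) p).source ×ˢ Set.Icc a b) := by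
    refine (h1.comp h2 fun z hz => ⟨(extChartAt (𝓡 n) p).map_source hz.1, hz.2⟩).congr
      fun z hz => ?_
    have h4 := gradInner_eq_coord g (f := fun y => f y z.2) (h := fun y => h y z.2)
      ((extChartAt (𝓡 n) p).map_source hz.1)
      ((hf.slice hz.2).mdifferentiable (by simp) _) ((hh.slice hz.2).mdifferentiable (by simp) _)
    rw [(extChartAt (𝓡 n) p).left_inv hz.1] at h4
    exact h4
  refine (h3 (p, t) ⟨mem_extChartAt_source p, ht⟩).mono_of_mem_nhdsWithin ?_
  refine mem_nhdsWithin.2 ⟨(extChartAt (𝓡 n) p).source ×ˢ Set.univ,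
    (isOpen_extChartAt_source p).prod isOpen_univ, ⟨mem_extChartAt_source p, trivial⟩, ?_⟩
  exact fun z hz => ⟨hz.1.1, hz.2.2⟩

end Gradient

section Vector

variable {a b : ℝ} {u v : M → ℝ → EuclideanSpace ℝ (Fin N)}

theorem SmoothOnTime.component (hu : SmoothOnTime n a b u) (k : Fin N) :
    SmoothOnTime n a b fun x t => u x t k :=
  (EuclideanSpace.proj (𝕜 := ℝ) k).contMDiff.comp_contMDiffOn hu

theorem smoothOnTime_timeDeriv (hab : a < b) (hu : SmoothOnTime n a b u) :
    SmoothOnTime n a b fun x t => timeDeriv a b u t x := smoothOnTime_derivWithin hab hu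

theorem timeDeriv_component (hab : a < b) (hu : SmoothOnTime n a b u) (x : M) {t : ℝ}
    (ht : t ∈ Set.Icc a b) (k : Fin N) :
    timeDeriv a b u t x k = derivWithin (fun s => u x s k) (Set.Icc a b) t :=
  (((EuclideanSpace.proj (𝕜 := ℝ) k).hasFDerivAt.comp_hasDerivWithinAt t
    (hu.hasDerivWithinAt x ht)).derivWithin (uniqueDiffOn_Icc hab t ht)).symm

theorem hasDerivWithinAt_normSq (hu : SmoothOnTime n a b u) (x : M) {t : ℝ}
    (ht : t ∈ Set.Icc a b) :
    HasDerivWithinAt (fun s => ‖u x s‖ ^ 2) (2 * inner ℝ (u x t) (timeDeriv a b u t x))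
      (Set.Icc a b) t := (hu.hasDerivWithinAt x ht).norm_sq

theorem hasDerivWithinAt_gradNormSq (g : RMetric n M) (hab : a < b) (hu : SmoothOnTime n a b u)
    (x : M) {t : ℝ} (ht : t ∈ Set.Icc a b) :
    HasDerivWithinAt (fun s => gradNormSq g (fun y => u y s) x)
      (2 * gradDot g (fun y => u y t) (timeDeriv a b u t) x) (Set.Icc a b) t := by
  have h1 : HasDerivWithinAt (fun s => ∑ k, gradInner g (fun y => u y s k) (fun y => u y s k) x)
      (∑ k, (gradInner g (fun y => derivWithin (fun s => u y s k) (Set.Icc a b) t)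
          (fun y => u y t k) x
        + gradInner g (fun y => u y t k)
          (fun y => derivWithin (fun s => u y s k) (Set.Icc a b) t) x)) (Set.Icc a b) t :=
    HasDerivWithinAt.fun_sum fun k _ =>
      hasDerivWithinAt_gradInner g hab (hu.component k) (hu.component k) x ht
  refine h1.congr_deriv ?_
  rw [gradDot, Finset.mul_sum]
  refine Finset.sum_congr rfl fun k _ => ?_
  have h2 : (fun y => timeDeriv a b u t y k)
      = fun y => derivWithin (fun s => u y s k) (Set.Icc a b) t :=
    funext fun y => timeDeriv_component hab hu y ht k
  rw [h2, gradInner_comm g (fun y => derivWithin _ _ _), two_mul]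

theorem continuousOn_gradDot_time (g : RMetric n M) (hab : a < b) (hu : SmoothOnTime n a b u)
    (hv : SmoothOnTime n a b v) :
    ContinuousOn (fun z : M × ℝ => gradDot g (fun y => u y z.2) (fun y => v y z.2) z.1)
      (Set.univ ×ˢ Set.Icc a b) := by
  have h1 : ∀ k : Fin N, ContinuousOn (fun z : M × ℝ =>
      gradInner g (fun y => u y z.2 k) (fun y => v y z.2 k) z.1) (Set.univ ×ˢ Set.Icc a b) :=
    fun k => continuousOn_gradInner_time (f := fun y s => u y s k) (h := fun y s => v y s k)
      g hab (hu.component k) (hv.component k)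
  exact continuousOn_finsetSum _ fun k _ => h1 k

end Vector

end DriftHeat

/-! ### The one-variable argument for `I`, `D` and `U`. -/

namespace DriftHeat

section AbsolutelyContinuous

variable {a b : ℝ}

/-- A `C¹` function is Lipschitz on a compact interval. Needed for the integrating factor and for
`1/I`. -/
theorem absolutelyContinuousOnInterval_comp {f φ : ℝ → ℝ} {l r : ℝ}
    (hf : AbsolutelyContinuousOnInterval f a b) (hφ : ContDiffOn ℝ 1 φ (Set.Icc l r))
    (hm : ∀ t ∈ Set.uIcc a b, f t ∈ Set.Icc l r) :
    AbsolutelyContinuousOnInterval (fun t => φ (f t)) a b := by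
  obtain ⟨K, hK⟩ := hφ.exists_lipschitzOnWith (by decide) (convex_Icc _ _) isCompact_Icc
  rw [absolutelyContinuousOnInterval_iff] at hf ⊢
  intro ε hε
  -- Dividing by `K + 1` rather than `K` covers the case `K = 0` and gives strict inequality.
  obtain ⟨δ, hδ, h⟩ := hf (ε / (K + 1)) (by positivity)
  refine ⟨δ, hδ, fun E hE hlt => ?_⟩
  have h1 := h E hE hlt
  calc ∑ i ∈ Finset.range E.1, dist (φ (f (E.2 i).1)) (φ (f (E.2 i).2))
      ≤ ∑ i ∈ Finset.range E.1, K * dist (f (E.2 i).1) (f (E.2 i).2) :=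
        Finset.sum_le_sum fun i hi =>
          hK.dist_le_mul _ (hm _ (hE.1 i hi).1) _ (hm _ (hE.1 i hi).2)
    _ = K * ∑ i ∈ Finset.range E.1, dist (f (E.2 i).1) (f (E.2 i).2) := by rw [Finset.mul_sum]
    _ ≤ K * (ε / (K + 1)) := by gcongr
    _ < (K + 1) * (ε / (K + 1)) := by gcongr; linarith
    _ = ε := by field

/-- The fundamental theorem of calculus for absolutely continuous functions. An almost everywhere
version is required because `C²`, `I'` and `D'` are only integrable in time. -/
theorem le_of_ae_deriv_nonneg {f : ℝ → ℝ} (hab : a ≤ b)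
    (hf : AbsolutelyContinuousOnInterval f a b)
    (h : ∀ᵐ t, t ∈ Set.Icc a b → ∃ f', HasDerivAt f f' t ∧ 0 ≤ f') : f a ≤ f b := by
  have h1 : 0 ≤ ∫ t in a..b, deriv f t := by
    refine intervalIntegral.integral_nonneg_of_ae_restrict hab ?_
    rw [Filter.EventuallyLE, ae_restrict_iff' measurableSet_Icc]
    filter_upwards [h] with t ht htI
    obtain ⟨f', hf', h0⟩ := ht htI
    simpa [hf'.deriv] using h0
  rw [hf.integral_deriv_eq_sub] at h1
  linarith

theorem absolutelyContinuousOnInterval_primitive {f F : ℝ → ℝ}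
    (hf : IntervalIntegrable f volume a b) (hF : ∀ t, F t = F a + ∫ s in a..t, f s) :
    AbsolutelyContinuousOnInterval F a b := by
  have h1 : AbsolutelyContinuousOnInterval (fun _ : ℝ => F a) a b :=
    (contDiffOn_const (𝕜 := ℝ)).absolutelyContinuousOnInterval
  have := h1.add (hf.absolutelyContinuousOnInterval_intervalIntegral Set.left_mem_uIcc)
  rwa [show ((fun _ : ℝ => F a) + fun x => ∫ v in a..x, f v) = F from
    funext fun t => (hF t).symm] at this

theorem ae_hasDerivAt_primitive {f F : ℝ → ℝ} (hab : a ≤ b)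
    (hf : IntervalIntegrable f volume a b) (hF : ∀ t, F t = F a + ∫ s in a..t, f s) :
    ∀ᵐ t, t ∈ Set.Icc a b → HasDerivAt F (f t) t := by
  filter_upwards [hf.ae_hasDerivAt_integral] with t ht htI
  rw [Set.uIcc_of_le hab] at ht
  rw [show F = fun t => F a + ∫ s in a..t, f s from funext hF]
  exact (ht htI a (Set.left_mem_Icc.2 hab)).const_add _

end AbsolutelyContinuous

section Frequency

variable {a b T K : ℝ} {I D i d C : ℝ → ℝ}

theorem intervalIntegrable_sq_of_bounded (hab : a ≤ b)
    (hC : AEMeasurable C (volume.restrict (Set.Icc a b)))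
    (hC0 : ∀ t ∈ Set.Icc a b, 0 ≤ C t) (hCK : ∀ t ∈ Set.Icc a b, C t ≤ K) :
    IntervalIntegrable (fun t => C t ^ 2) volume a b := by
  rw [intervalIntegrable_iff_integrableOn_Icc_of_le hab]
  refine Integrable.mono' (g := fun _ => K ^ 2) (integrable_const _)
    (hC.pow_const 2).aestronglyMeasurable ?_
  filter_upwards [ae_restrict_mem measurableSet_Icc] with t ht
  rw [Real.norm_of_nonneg (sq_nonneg _)]
  exact pow_le_pow_left₀ (hC0 t ht) (hCK t ht) 2

/-- Where `I > 0`, `hfreq` says `U' ≥ C² (U - 1)`, so `(U - 1) exp(-∫C²)` is nondecreasing. -/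
theorem frequency_lower_bound (hab : a ≤ b) (hi : IntervalIntegrable i volume a b)
    (hd : IntervalIntegrable d volume a b) (hI : ∀ t, I t = I a + ∫ s in a..t, i s)
    (hD : ∀ t, D t = D a + ∫ s in a..t, d s)
    (hC : IntervalIntegrable (fun t => C t ^ 2) volume a b)
    (hpos : ∀ t ∈ Set.Icc a b, 0 < I t)
    (hfreq : ∀ t ∈ Set.Icc a b, -(C t ^ 2 * (I t * (I t - D t))) ≤ d t * I t - D t * i t) :
    D a / I a - 1 ≤ (D b / I b - 1) * Real.exp (-∫ s in a..b, C s ^ 2) := by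
  have acI := absolutelyContinuousOnInterval_primitive hi hI
  have acD := absolutelyContinuousOnInterval_primitive hd hD
  set c : ℝ → ℝ := fun t => ∫ s in a..t, C s ^ 2 with hc
  have hcp : ∀ t, c t = c a + ∫ s in a..t, C s ^ 2 := fun t => by simp [hc]
  have acc := absolutelyContinuousOnInterval_primitive hC hcp
  have acE : AbsolutelyContinuousOnInterval (fun t => Real.exp (-c t)) a b := by
    obtain ⟨R, hR⟩ := acc.exists_bound
    refine absolutelyContinuousOnInterval_comp (φ := fun x => Real.exp (-x)) (l := -R) (r := R) acc
      (Real.contDiff_exp.comp contDiff_neg).contDiffOn fun t ht => ?_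
    exact abs_le.1 (hR t ht)
  have acV : AbsolutelyContinuousOnInterval (fun t => (I t)⁻¹) a b := by
    obtain ⟨R, hR⟩ := acI.exists_bound
    -- The positive minimum of `I` keeps its values in an interval on which inversion is `C¹`.
    obtain ⟨t₀, ht₀, hmin⟩ := isCompact_Icc.exists_isMinOn (Set.nonempty_Icc.2 hab)
      (Set.uIcc_of_le hab ▸ acI.continuousOn)
    refine absolutelyContinuousOnInterval_comp (φ := fun x => x⁻¹) (l := I t₀) (r := R) acI
      (contDiffOn_id.inv fun x hx => ((hpos t₀ ht₀).trans_le hx.1).ne') fun t ht => ?_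
    refine ⟨?_, (abs_le.1 (hR t ht)).2⟩
    rw [Set.uIcc_of_le hab] at ht
    exact hmin ht
  have acX : AbsolutelyContinuousOnInterval
      (fun t => (D t * (I t)⁻¹ - 1) * Real.exp (-c t)) a b := by
    have h1 : AbsolutelyContinuousOnInterval (fun _ : ℝ => (1 : ℝ)) a b :=
      (contDiffOn_const (𝕜 := ℝ)).absolutelyContinuousOnInterval
    exact ((acD.mul acV).sub h1).mul acE
  have key := le_of_ae_deriv_nonneg hab acX ?_
  · simpa [hc, div_eq_mul_inv] using key
  · filter_upwards [ae_hasDerivAt_primitive hab hi hI, ae_hasDerivAt_primitive hab hd hD,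
      ae_hasDerivAt_primitive hab hC hcp] with t h1 h2 h3 ht
    have hp := hpos t ht
    refine ⟨_, (((h2 ht).mul ((h1 ht).inv hp.ne')).sub_const 1).mul (h3 ht).neg.exp, ?_⟩
    -- The derivative is a positive factor times the difference of the two sides of `hfreq`.
    have e : (d t * (I t)⁻¹ + D t * (-i t / I t ^ 2)) * Real.exp (-c t)
        + (D t * (I t)⁻¹ - 1) * (Real.exp (-c t) * -C t ^ 2)
        = Real.exp (-c t) / I t ^ 2 *
          (d t * I t - D t * i t + C t ^ 2 * (I t * (I t - D t))) := by
      field_simp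
      ring
    have h4 : 0 ≤ Real.exp (-c t) / I t ^ 2 *
          (d t * I t - D t * i t + C t ^ 2 * (I t * (I t - D t))) :=
      mul_nonneg (by positivity) (by linarith [hfreq t ht])
    rw [← e] at h4
    simpa using h4

/-- The frequency bound makes `D ≥ m I` for a constant `m`; `hgrow` then becomes the linear
inequality `Λ I ≤ I'`, and `I exp(-Λ(t - a))` is nondecreasing. A bound `L` on the integral of `C²`,
in place of the integral itself, lets the same constant serve every subinterval. -/
theorem energy_lower_bound_of_pos (hab : a ≤ b) (hi : IntervalIntegrable i volume a b)
    (hd : IntervalIntegrable d volume a b) (hI : ∀ t, I t = I a + ∫ s in a..t, i s)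
    (hD : ∀ t, D t = D a + ∫ s in a..t, d s)
    (hC : IntervalIntegrable (fun t => C t ^ 2) volume a b)
    (hC0 : ∀ t ∈ Set.Icc a b, 0 ≤ C t) (hCK : ∀ t ∈ Set.Icc a b, C t ≤ K)
    (hpos : ∀ t ∈ Set.Icc a b, 0 < I t) (hneg : ∀ t ∈ Set.Icc a b, D t ≤ 0)
    (hfreq : ∀ t ∈ Set.Icc a b, -(C t ^ 2 * (I t * (I t - D t))) ≤ d t * I t - D t * i t)
    (hgrow : ∀ t ∈ Set.Icc a b, (2 + C t) * D t - 3 * C t * I t ≤ i t)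
    {L : ℝ} (hL : ∫ s in a..b, C s ^ 2 ≤ L) :
    I a * Real.exp (((2 + K) * (Real.exp L * (D a / I a - 1) + 1) - 3 * K) * (b - a)) ≤ I b := by
  set Λ := (2 + K) * (Real.exp L * (D a / I a - 1) + 1) - 3 * K with hΛ
  have haI := Set.left_mem_Icc.2 hab
  have hUa : D a / I a - 1 ≤ 0 := by
    have := div_nonpos_of_nonpos_of_nonneg (hneg a haI) (hpos a haI).le
    linarith
  have hm : ∀ t ∈ Set.Icc a b, (Real.exp L * (D a / I a - 1) + 1) * I t ≤ D t := by
    intro t ht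
    have hsub : Set.Icc a t ⊆ Set.Icc a b := Set.Icc_subset_Icc_right ht.2
    have husub : Set.uIcc a t ⊆ Set.uIcc a b := by
      rwa [Set.uIcc_of_le ht.1, Set.uIcc_of_le hab]
    have h1 := frequency_lower_bound ht.1 (hi.mono_set husub) (hd.mono_set husub) hI hD
      (hC.mono_set husub) (fun s hs => hpos s (hsub hs)) fun s hs => hfreq s (hsub hs)
    have hct : ∫ s in a..t, C s ^ 2 ≤ L := by
      refine le_trans ?_ hL
      exact intervalIntegral.integral_mono_interval le_rfl ht.1 ht.2
        (Filter.Eventually.of_forall fun _ => sq_nonneg _) hC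
    have h2 : Real.exp L * (D a / I a - 1) ≤ D t / I t - 1 := by
      calc Real.exp L * (D a / I a - 1)
          ≤ Real.exp (∫ s in a..t, C s ^ 2) * (D a / I a - 1) :=
            mul_le_mul_of_nonpos_right (Real.exp_le_exp.2 hct) hUa
        _ ≤ Real.exp (∫ s in a..t, C s ^ 2) *
            ((D t / I t - 1) * Real.exp (-∫ s in a..t, C s ^ 2)) := by gcongr
        _ = D t / I t - 1 := by
            rw [mul_comm, mul_assoc, ← Real.exp_add]; simp
    rw [← le_div_iff₀ (hpos t ht)]
    linarith
  -- `U(a) - 1 ≤ -1` and `exp L ≥ 1`. This sign is what allows `2 + C` to be replaced by the larger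
  -- `2 + K` in front of `m I`.
  have hbr : Real.exp L * (D a / I a - 1) + 1 ≤ 0 := by
    have hL0 : 0 ≤ L :=
      (intervalIntegral.integral_nonneg hab fun _ _ => sq_nonneg _).trans hL
    have h1 := Real.one_le_exp hL0
    have h2 := div_nonpos_of_nonpos_of_nonneg (hneg a haI) (hpos a haI).le
    nlinarith
  have hΛi : ∀ t ∈ Set.Icc a b, Λ * I t ≤ i t := by
    intro t ht
    refine le_trans ?_ (hgrow t ht)
    have h1 := hm t ht
    have h2 := hC0 t ht
    have h3 := hCK t ht
    have h4 := (hpos t ht).le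
    set m := Real.exp L * (D a / I a - 1) + 1
    have h5 : (2 + C t) * (m * I t) ≤ (2 + C t) * D t := by gcongr
    have h6 : (2 + K) * (m * I t) ≤ (2 + C t) * (m * I t) :=
      mul_le_mul_of_nonpos_right (by linarith) (mul_nonpos_of_nonpos_of_nonneg hbr h4)
    have h7 : C t * I t ≤ K * I t := by gcongr
    rw [hΛ]
    linarith
  have acI := absolutelyContinuousOnInterval_primitive hi hI
  have acE : AbsolutelyContinuousOnInterval (fun t => Real.exp (-(Λ * (t - a)))) a b := by
    refine ContDiffOn.absolutelyContinuousOnInterval (ContDiff.contDiffOn ?_)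
    exact Real.contDiff_exp.comp (contDiff_const.mul (contDiff_id.sub contDiff_const)).neg
  have key := le_of_ae_deriv_nonneg hab (acI.mul acE) ?_
  · simp only [Pi.mul_apply, sub_self, mul_zero, neg_zero, Real.exp_zero, mul_one] at key
    calc I a * Real.exp (Λ * (b - a))
        ≤ I b * Real.exp (-(Λ * (b - a))) * Real.exp (Λ * (b - a)) := by gcongr
      _ = I b := by rw [mul_assoc, ← Real.exp_add]; simp
  · filter_upwards [ae_hasDerivAt_primitive hab hi hI] with t h1 ht
    have h2 : HasDerivAt (fun t => -(Λ * (t - a))) (-Λ) t := by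
      have h0 := (((hasDerivAt_id t).sub_const a).const_mul Λ).fun_neg
      rw [mul_one] at h0
      exact h0
    refine ⟨_, (h1 ht).mul h2.exp, ?_⟩
    have h3 := hΛi t ht
    have h4 := Real.exp_pos (-(Λ * (t - a)))
    nlinarith [mul_nonneg h4.le (sub_nonneg.2 h3)]

/-- Positivity of `I` is automatic once `I(a) > 0`: at a first zero `T` the bound holds at all
earlier times, and by continuity it gives `I(T) > 0`. If `I(a) = 0` there is nothing to prove. -/
theorem energy_lower_bound (hab : a ≤ b) (hi : IntervalIntegrable i volume a b)
    (hd : IntervalIntegrable d volume a b) (hI : ∀ t, I t = I a + ∫ s in a..t, i s)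
    (hD : ∀ t, D t = D a + ∫ s in a..t, d s)
    (hC : IntervalIntegrable (fun t => C t ^ 2) volume a b)
    (hC0 : ∀ t ∈ Set.Icc a b, 0 ≤ C t) (hCK : ∀ t ∈ Set.Icc a b, C t ≤ K)
    (hnn : ∀ t ∈ Set.Icc a b, 0 ≤ I t) (hneg : ∀ t ∈ Set.Icc a b, D t ≤ 0)
    (hfreq : ∀ t ∈ Set.Icc a b, -(C t ^ 2 * (I t * (I t - D t))) ≤ d t * I t - D t * i t)
    (hgrow : ∀ t ∈ Set.Icc a b, (2 + C t) * D t - 3 * C t * I t ≤ i t)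
    {L : ℝ} (hL : ∫ s in a..b, C s ^ 2 ≤ L) :
    I a * Real.exp (((2 + K) * (Real.exp L * (D a / I a - 1) + 1) - 3 * K) * (b - a)) ≤ I b := by
  set Λ := (2 + K) * (Real.exp L * (D a / I a - 1) + 1) - 3 * K with hΛ
  have haI := Set.left_mem_Icc.2 hab
  rcases (hnn a haI).eq_or_lt with h0 | h0
  · rw [← h0, zero_mul]
    exact hnn b (Set.right_mem_Icc.2 hab)
  have sub : ∀ T ∈ Set.Icc a b, (∀ t ∈ Set.Icc a T, 0 < I t) →
      I a * Real.exp (Λ * (T - a)) ≤ I T := by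
    intro T hT hp
    have hsub : Set.Icc a T ⊆ Set.Icc a b := Set.Icc_subset_Icc_right hT.2
    have husub : Set.uIcc a T ⊆ Set.uIcc a b := by
      rwa [Set.uIcc_of_le hT.1, Set.uIcc_of_le hab]
    refine energy_lower_bound_of_pos hT.1 (hi.mono_set husub) (hd.mono_set husub) hI hD
      (hC.mono_set husub) (fun t ht => hC0 t (hsub ht)) (fun t ht => hCK t (hsub ht)) hp
      (fun t ht => hneg t (hsub ht)) (fun t ht => hfreq t (hsub ht))
      (fun t ht => hgrow t (hsub ht)) ?_
    refine le_trans ?_ hL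
    exact intervalIntegral.integral_mono_interval le_rfl hT.1 hT.2
        (Filter.Eventually.of_forall fun _ => sq_nonneg _) hC
  have hcont : ContinuousOn I (Set.Icc a b) :=
    Set.uIcc_of_le hab ▸ (absolutelyContinuousOnInterval_primitive hi hI).continuousOn
  refine sub b (Set.right_mem_Icc.2 hab) ?_
  by_contra hne
  push Not at hne
  obtain ⟨t₁, ht₁, hle⟩ := hne
  set Z := Set.Icc a b ∩ I ⁻¹' Set.Iic 0 with hZ
  have hZc : IsCompact Z :=
    isCompact_Icc.of_isClosed_subset (hcont.preimage_isClosed_of_isClosed isClosed_Icc isClosed_Iic)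
      Set.inter_subset_left
  obtain ⟨T, ⟨hT, hTle⟩, hmin⟩ := hZc.exists_isLeast ⟨t₁, ht₁, hle⟩
  have hpT : ∀ t ∈ Set.Ico a T, 0 < I t := by
    intro t ht
    by_contra hle
    exact absurd (hmin ⟨⟨ht.1, ht.2.le.trans hT.2⟩, not_lt.1 hle⟩) (not_le.2 ht.2)
  have haT : a < T := lt_of_le_of_ne hT.1 fun h => by
    rw [← h] at hTle
    exact absurd h0 (not_lt.2 hTle)
  have hlow : ∀ t ∈ Set.Ico a T, I a * Real.exp (Λ * (t - a)) ≤ I t := fun t ht =>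
    sub t ⟨ht.1, ht.2.le.trans hT.2⟩ fun s hs => hpT s ⟨hs.1, hs.2.trans_lt ht.2⟩
  have hlim := ContinuousWithinAt.closure_le (s := Set.Ico a T) (x := T)
    (f := fun t => I a * Real.exp (Λ * (t - a))) (g := I)
    (by rw [closure_Ico haT.ne]; exact Set.right_mem_Icc.2 haT.le)
    (by fun_prop)
    ((hcont T hT).mono fun s hs => ⟨hs.1, hs.2.le.trans hT.2⟩) hlow
  have : 0 < I a * Real.exp (Λ * (T - a)) := by positivity
  exact absurd (this.trans_le hlim) (not_lt.2 hTle)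

end Frequency

end DriftHeat

/-! ### Differentiation under the integral sign. -/

namespace DriftHeat

section Fubini

variable {X : Type*} [TopologicalSpace X] [SecondCountableTopology X] [MeasurableSpace X]
  [BorelSpace X] {μ : Measure X} [SFinite μ] {a b : ℝ} {q q' B : X → ℝ → ℝ}

theorem aestronglyMeasurable_of_continuousOn_time {f : X × ℝ → ℝ}
    (hf : ContinuousOn f (Set.univ ×ˢ Set.Icc a b)) :
    AEStronglyMeasurable f (μ.prod (volume.restrict (Set.Icc a b))) := by
  have h1 : μ.prod (volume.restrict (Set.Icc a b))
      = (μ.prod volume).restrict (Set.univ ×ˢ Set.Icc a b) := by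
    rw [← Measure.prod_restrict, Measure.restrict_univ]
  rw [h1]
  exact hf.aestronglyMeasurable (MeasurableSet.univ.prod measurableSet_Icc)

theorem integrable_prod_of_lintegral (hB : ContinuousOn (fun z : X × ℝ => B z.1 z.2)
      (Set.univ ×ˢ Set.Icc a b)) (hB0 : ∀ x t, 0 ≤ B x t)
    (hfin : ∫⁻ t in Set.Icc a b, ∫⁻ x, ENNReal.ofReal (B x t) ∂μ < ⊤) :
    Integrable (fun z : X × ℝ => B z.1 z.2) (μ.prod (volume.restrict (Set.Icc a b))) := by
  have hm := aestronglyMeasurable_of_continuousOn_time (μ := μ) hB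
  refine ⟨hm, ?_⟩
  have h0 : 0 ≤ᵐ[μ.prod (volume.restrict (Set.Icc a b))] fun z : X × ℝ => B z.1 z.2 :=
    Filter.Eventually.of_forall fun z => hB0 z.1 z.2
  rw [hasFiniteIntegral_iff_ofReal h0,
    lintegral_prod_symm _ hm.aemeasurable.ennreal_ofReal]
  exact hfin

/-- A differential inequality `q' ≤ q + B` bounds `q` by its initial value and the integral
of `B`. -/
theorem le_exp_mul_of_deriv_le {q q' B : ℝ → ℝ} {t : ℝ} (ht : t ∈ Set.Icc a b)
    (hq : ∀ s ∈ Set.Icc a b, HasDerivWithinAt q (q' s) (Set.Icc a b) s)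
    (hq' : ContinuousOn q' (Set.Icc a b)) (hB : ContinuousOn B (Set.Icc a b))
    (hB0 : ∀ s, 0 ≤ B s) (hq0 : 0 ≤ q a) (hle : ∀ s ∈ Set.Icc a b, q' s ≤ q s + B s) :
    q t ≤ Real.exp (b - a) * (q a + ∫ s in Set.Icc a b, B s) := by
  have hsub : Set.Icc a t ⊆ Set.Icc a b := Set.Icc_subset_Icc_right ht.2
  have hqc : ContinuousOn q (Set.Icc a b) := fun s hs => (hq s hs).continuousWithinAt
  have hec : Continuous fun s => Real.exp (-(s - a)) := by fun_prop
  have hint : IntervalIntegrable (fun s => q' s * Real.exp (-(s - a))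
      + q s * (Real.exp (-(s - a)) * -1)) volume a t := by
    refine ContinuousOn.intervalIntegrable ?_
    rw [Set.uIcc_of_le ht.1]
    exact ((hq'.mono hsub).mul hec.continuousOn).add
      ((hqc.mono hsub).mul (hec.mul continuous_const).continuousOn)
  have hBi : IntervalIntegrable B volume a t := by
    refine ContinuousOn.intervalIntegrable ?_
    rw [Set.uIcc_of_le ht.1]
    exact hB.mono hsub
  -- The integrating factor `exp(-(s - a))` cancels the term `q`; it is at most `1` on the interval,
  -- so it can be dropped in front of `B`.
  have h1 := intervalIntegral.integral_eq_sub_of_hasDerivAt_of_le ht.1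
    (f := fun s => q s * Real.exp (-(s - a)))
    (f' := fun s => q' s * Real.exp (-(s - a)) + q s * (Real.exp (-(s - a)) * -1))
    ((hqc.mono hsub).mul hec.continuousOn) (fun s hs => ?_) hint
  · have h2 : ∫ s in a..t, (q' s * Real.exp (-(s - a)) + q s * (Real.exp (-(s - a)) * -1))
        ≤ ∫ s in a..t, B s := by
      refine intervalIntegral.integral_mono_on ht.1 hint hBi fun s hs => ?_
      have e1 : Real.exp (-(s - a)) ≤ 1 := Real.exp_le_one_iff.2 (by linarith [hs.1])
      have e2 := Real.exp_pos (-(s - a))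
      have := hle s (hsub hs)
      nlinarith [hB0 s]
    have h3 : ∫ s in a..t, B s ≤ ∫ s in Set.Icc a b, B s := by
      rw [intervalIntegral.integral_of_le ht.1]
      refine setIntegral_mono_set (hB.integrableOn_compact isCompact_Icc)
        (Filter.Eventually.of_forall fun s => hB0 s) (Filter.Eventually.of_forall fun s hs => ?_)
      exact ⟨hs.1.le, hs.2.trans ht.2⟩
    rw [h1] at h2
    simp only [sub_self, neg_zero, Real.exp_zero, mul_one] at h2
    have h4 : q t * Real.exp (-(t - a)) ≤ q a + ∫ s in Set.Icc a b, B s := by linarith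
    have h5 : 0 ≤ ∫ s in Set.Icc a b, B s := integral_nonneg fun s => hB0 s
    calc q t = Real.exp (t - a) * (q t * Real.exp (-(t - a))) := by
          rw [mul_comm, mul_assoc, ← Real.exp_add]; simp
      _ ≤ Real.exp (t - a) * (q a + ∫ s in Set.Icc a b, B s) := by gcongr
      _ ≤ Real.exp (b - a) * (q a + ∫ s in Set.Icc a b, B s) := by
          gcongr
          exact ht.2
  · have hs' : s ∈ Set.Icc a b := ⟨hs.1.le, hs.2.le.trans ht.2⟩
    have hd : HasDerivAt q (q' s) s :=
      (hq s hs').hasDerivAt (Icc_mem_nhds hs.1 (hs.2.trans_le ht.2))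
    have he : HasDerivAt (fun s => -(s - a)) (-1) s := ((hasDerivAt_id s).sub_const a).neg
    exact hd.mul he.exp

/-- Differentiation in time under the integral sign, in integrated form. -/
theorem integral_eq_add_integral_deriv (hab : a ≤ b)
    (hq : ∀ x, ∀ t ∈ Set.Icc a b, HasDerivWithinAt (q x) (q' x t) (Set.Icc a b) t)
    (hqc : ContinuousOn (fun z : X × ℝ => q z.1 z.2) (Set.univ ×ˢ Set.Icc a b))
    (hq'c : ContinuousOn (fun z : X × ℝ => q' z.1 z.2) (Set.univ ×ˢ Set.Icc a b))
    (hBc : ContinuousOn (fun z : X × ℝ => B z.1 z.2) (Set.univ ×ˢ Set.Icc a b))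
    (hq0 : ∀ x t, 0 ≤ q x t) (hB0 : ∀ x t, 0 ≤ B x t)
    (hle : ∀ x, ∀ t ∈ Set.Icc a b, |q' x t| ≤ q x t + B x t)
    (hqi : ∀ t ∈ Set.Icc a b, Integrable (fun x => q x t) μ)
    (hfin : ∫⁻ t in Set.Icc a b, ∫⁻ x, ENNReal.ofReal (B x t) ∂μ < ⊤) :
    IntervalIntegrable (fun t => ∫ x, q' x t ∂μ) volume a b ∧
      ∀ t ∈ Set.Icc a b, ∫ x, q x t ∂μ = ∫ x, q x a ∂μ + ∫ s in a..t, ∫ x, q' x s ∂μ := by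
  set ν := volume.restrict (Set.Icc a b) with hν
  have slice : ∀ {f : X → ℝ → ℝ}, ContinuousOn (fun z : X × ℝ => f z.1 z.2)
      (Set.univ ×ˢ Set.Icc a b) → ∀ x, ContinuousOn (f x) (Set.Icc a b) := fun {f} hf x =>
    hf.comp (f := fun t => (x, t)) (by fun_prop) fun t ht => ⟨Set.mem_univ _, ht⟩
  have hBi : Integrable (fun z : X × ℝ => B z.1 z.2) (μ.prod ν) :=
    integrable_prod_of_lintegral hBc hB0 hfin
  have hβ : Integrable (fun x => ∫ s, B x s ∂ν) μ := hBi.integral_prod_left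
  have haI := Set.left_mem_Icc.2 hab
  -- Integrability of the slices gives no control uniform in `t`. The pointwise Gronwall estimate
  -- supplies a majorant that depends on `x` alone and is integrable.
  have hqi' : Integrable (fun z : X × ℝ => q z.1 z.2) (μ.prod ν) := by
    have hdom : Integrable (fun z : X × ℝ =>
        (Real.exp (b - a) * (q z.1 a + ∫ s, B z.1 s ∂ν)) * 1) (μ.prod ν) :=
      Integrable.mul_prod (f := fun x => Real.exp (b - a) * (q x a + ∫ s, B x s ∂ν))
        (g := fun _ : ℝ => (1 : ℝ)) (((hqi a haI).add hβ).const_mul _) (integrable_const _)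
    refine hdom.mono' (aestronglyMeasurable_of_continuousOn_time hqc) ?_
    have hmem : ∀ᵐ z : X × ℝ ∂(μ.prod ν), z.2 ∈ Set.Icc a b :=
      Measure.quasiMeasurePreserving_snd.ae (ae_restrict_mem measurableSet_Icc)
    filter_upwards [hmem] with z hz
    rw [Real.norm_of_nonneg (hq0 _ _), mul_one]
    exact le_exp_mul_of_deriv_le hz (hq z.1) (slice hq'c z.1) (slice hBc z.1) (hB0 z.1)
      (hq0 _ _) fun s hs => (le_abs_self _).trans (hle z.1 s hs)
  have hq'i : Integrable (fun z : X × ℝ => q' z.1 z.2) (μ.prod ν) := by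
    refine (hqi'.add hBi).mono' (aestronglyMeasurable_of_continuousOn_time hq'c) ?_
    have hmem : ∀ᵐ z : X × ℝ ∂(μ.prod ν), z.2 ∈ Set.Icc a b :=
      Measure.quasiMeasurePreserving_snd.ae (ae_restrict_mem measurableSet_Icc)
    filter_upwards [hmem] with z hz
    exact hle z.1 z.2 hz
  refine ⟨?_, fun t ht => ?_⟩
  · rw [intervalIntegrable_iff_integrableOn_Icc_of_le hab]
    exact hq'i.integral_prod_right
  · have hsub : Set.Ioc a t ⊆ Set.Icc a b := fun s hs => ⟨hs.1.le, hs.2.trans ht.2⟩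
    have hft : ∀ x, q x t - q x a = ∫ s in Set.Ioc a t, q' x s := by
      intro x
      rw [← intervalIntegral.integral_of_le ht.1]
      refine (intervalIntegral.integral_eq_sub_of_hasDerivAt_of_le ht.1 ?_ (fun s hs => ?_) ?_).symm
      · exact (slice hqc x).mono (Set.Icc_subset_Icc_right ht.2)
      · exact (hq x s ⟨hs.1.le, hs.2.le.trans ht.2⟩).hasDerivAt
          (Icc_mem_nhds hs.1 (hs.2.trans_le ht.2))
      · refine ContinuousOn.intervalIntegrable ?_
        rw [Set.uIcc_of_le ht.1]
        exact (slice hq'c x).mono (Set.Icc_subset_Icc_right ht.2)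
    have hres : Integrable (Function.uncurry q') (μ.prod (volume.restrict (Set.Ioc a t))) := by
      refine hq'i.mono_measure ?_
      exact Measure.prod_mono le_rfl (Measure.restrict_mono hsub le_rfl)
    have hswap := integral_integral_swap hres
    simp only [← hft] at hswap
    rw [integral_sub (hqi t ht) (hqi a haI)] at hswap
    rw [intervalIntegral.integral_of_le ht.1]
    linarith

end Fubini

end DriftHeat

/-! ### The integral inequalities at a fixed time. -/

namespace DriftHeat

variable {n N : ℕ} {M : Type*} [TopologicalSpace M]
  [ChartedSpace (EuclideanSpace ℝ (Fin n)) M] [IsManifold (𝓡 n) ∞ M]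

section Slice

variable [T2Space M] [SecondCountableTopology M] [MeasurableSpace M] [BorelSpace M]
  {g : RMetric n M} {φ : M → ℝ} {u v : M → EuclideanSpace ℝ (Fin N)} {c : ℝ}

theorem normSq_le_of_norm_le {f : EuclideanSpace ℝ (Fin N)} {x : M}
    (h : ‖f‖ ≤ c * (‖u x‖ + √(gradNormSq g u x))) :
    ‖f‖ ^ 2 ≤ 2 * c ^ 2 * (‖u x‖ ^ 2 + gradNormSq g u x) := by
  have h1 := Real.sq_sqrt (gradNormSq_nonneg g u x)
  have h2 := pow_le_pow_left₀ (norm_nonneg _) h 2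
  have h3 : (‖u x‖ + √(gradNormSq g u x)) ^ 2 ≤ 2 * (‖u x‖ ^ 2 + gradNormSq g u x) := by
    nlinarith [sq_nonneg (‖u x‖ - √(gradNormSq g u x))]
  rw [mul_pow] at h2
  nlinarith [mul_le_mul_of_nonneg_left h3 (sq_nonneg c)]

/-- The data of a solution of the differential inequality at a fixed time: `u` is the solution and
`v` its time derivative. -/
structure DriftInequality (g : RMetric n M) (φ : M → ℝ) (u v : M → EuclideanSpace ℝ (Fin N))
    (c : ℝ) : Prop where
  smooth_weight : ContMDiff (𝓡 n) 𝓘(ℝ, ℝ) ∞ φ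
  smooth : SmoothMap n u
  smooth_deriv : SmoothMap n v
  mem : MemSobolev g φ u
  mem_deriv : MemSobolev g φ v
  nonneg : 0 ≤ c
  le : ∀ x, ‖v x - driftLaplacian g φ u x‖ ≤ c * (‖u x‖ + √(gradNormSq g u x))

namespace DriftInequality

theorem integrable_normSq (h : DriftInequality g φ u v c) :
    Integrable (fun x => ‖u x‖ ^ 2) (weightedVolume g φ) :=
  DriftHeat.integrable_normSq h.smooth_weight.continuous h.smooth
    (h.mem.sobolevSq_lt_top h.smooth_weight.continuous h.smooth)

theorem integrable_gradNormSq (h : DriftInequality g φ u v c) :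
    Integrable (gradNormSq g u) (weightedVolume g φ) :=
  DriftHeat.integrable_gradNormSq h.smooth_weight.continuous h.smooth
    (h.mem.sobolevSq_lt_top h.smooth_weight.continuous h.smooth)

theorem integrable_normSq_deriv (h : DriftInequality g φ u v c) :
    Integrable (fun x => ‖v x‖ ^ 2) (weightedVolume g φ) :=
  DriftHeat.integrable_normSq h.smooth_weight.continuous h.smooth_deriv
    (h.mem_deriv.sobolevSq_lt_top h.smooth_weight.continuous h.smooth_deriv)

theorem continuous_driftLaplacian (h : DriftInequality g φ u v c) :
    Continuous (driftLaplacian g φ u) :=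
  DriftHeat.continuous_driftLaplacian h.smooth_weight h.smooth

/-- The drift Laplacian is `v` minus the error term, and the pointwise inequality bounds the error
by `u` and `∇u`, all square integrable. This is the integrability that integration by parts
requires. -/
theorem integrable_normSq_driftLaplacian (h : DriftInequality g φ u v c) :
    Integrable (fun x => ‖driftLaplacian g φ u x‖ ^ 2) (weightedVolume g φ) := by
  refine Integrable.mono' ((h.integrable_normSq_deriv.const_mul 2).add
    ((h.integrable_normSq.add h.integrable_gradNormSq).const_mul (4 * c ^ 2)))
    (h.continuous_driftLaplacian.norm.pow 2).aestronglyMeasurable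
    (Filter.Eventually.of_forall fun x => ?_)
  rw [Real.norm_of_nonneg (sq_nonneg _)]
  have h1 := normSq_le_of_norm_le (h.le x)
  have h2 : ‖driftLaplacian g φ u x‖ ≤ ‖v x‖ + ‖v x - driftLaplacian g φ u x‖ := by
    have := norm_sub_le (v x) (v x - driftLaplacian g φ u x)
    rwa [sub_sub_cancel] at this
  have h3 := pow_le_pow_left₀ (norm_nonneg _) h2 2
  simp only [Pi.add_apply]
  nlinarith [sq_nonneg (‖v x‖ - ‖v x - driftLaplacian g φ u x‖)]

theorem integrable_inner_of_normSq {w z : M → EuclideanSpace ℝ (Fin N)}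
    (hw : Continuous w) (hz : Continuous z)
    (hwi : Integrable (fun x => ‖w x‖ ^ 2) (weightedVolume g φ))
    (hzi : Integrable (fun x => ‖z x‖ ^ 2) (weightedVolume g φ)) :
    Integrable (fun x => (inner ℝ (w x) (z x) : ℝ)) (weightedVolume g φ) :=
  integrable_of_sq_le_mul (hw.inner hz).aestronglyMeasurable hwi hzi (fun _ => sq_nonneg _)
    (fun _ => sq_nonneg _) fun _ => inner_sq_le _ _

theorem integral_inner_self (h : DriftInequality g φ u v c) :
    ∫ x, inner ℝ (u x) (driftLaplacian g φ u x) ∂(weightedVolume g φ)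
      = -∫ x, gradNormSq g u x ∂(weightedVolume g φ) :=
  integral_inner_driftLaplacian h.smooth_weight h.smooth h.mem h.smooth
    (h.mem.sobolevSq_lt_top h.smooth_weight.continuous h.smooth)
    h.integrable_normSq_driftLaplacian

/-- Here the time derivative serves as the Sobolev test function; the formula rewrites `D'` as
`2∫⟨u_t, Lu⟩`. -/
theorem integral_inner_deriv (h : DriftInequality g φ u v c) :
    ∫ x, inner ℝ (v x) (driftLaplacian g φ u x) ∂(weightedVolume g φ)
      = -∫ x, gradDot g u v x ∂(weightedVolume g φ) := by
  simp only [gradDot_comm g u v]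
  exact integral_inner_driftLaplacian h.smooth_weight h.smooth_deriv h.mem_deriv h.smooth
    (h.mem.sobolevSq_lt_top h.smooth_weight.continuous h.smooth)
    h.integrable_normSq_driftLaplacian

/-- The lower bound for the derivative of the energy. -/
theorem growth (h : DriftInequality g φ u v c) :
    (2 + c) * (-∫ x, gradNormSq g u x ∂(weightedVolume g φ))
        - 3 * c * ∫ x, ‖u x‖ ^ 2 ∂(weightedVolume g φ)
      ≤ ∫ x, 2 * inner ℝ (u x) (v x) ∂(weightedVolume g φ) := by
  have hI := h.integrable_normSq
  have hG := h.integrable_gradNormSq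
  have hL := integrable_inner_of_normSq h.smooth.continuous h.continuous_driftLaplacian hI
    h.integrable_normSq_driftLaplacian
  have hV := integrable_inner_of_normSq h.smooth.continuous h.smooth_deriv.continuous hI
    h.integrable_normSq_deriv
  have key : ∫ x, (2 * inner ℝ (u x) (driftLaplacian g φ u x)
        - (3 * c * ‖u x‖ ^ 2 + c * gradNormSq g u x)) ∂(weightedVolume g φ)
      ≤ ∫ x, 2 * inner ℝ (u x) (v x) ∂(weightedVolume g φ) := by
    refine integral_mono ((hL.const_mul 2).sub ((hI.const_mul _).add (hG.const_mul _)))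
      (hV.const_mul 2) fun x => ?_
    have h1 := abs_real_inner_le_norm (u x) (v x - driftLaplacian g φ u x)
    have h2 := mul_le_mul_of_nonneg_left (h.le x) (norm_nonneg (u x))
    have h3 := Real.sq_sqrt (gradNormSq_nonneg g u x)
    -- `2|u||∇u| ≤ |u|² + |∇u|²` splits the mixed term of `2c|u|(|u| + |∇u|)`; hence the
    -- coefficients `3c` and `c`.
    have h4 := mul_nonneg h.nonneg (sq_nonneg (‖u x‖ - √(gradNormSq g u x)))
    have h5 := (abs_le.1 (h1.trans h2)).1
    rw [inner_sub_right] at h5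
    have h6 : c * √(gradNormSq g u x) ^ 2 = c * gradNormSq g u x := by rw [h3]
    dsimp only
    linarith
  rw [integral_sub (hL.const_mul 2) ((hI.const_mul _).fun_add (hG.const_mul _)),
    integral_add (hI.const_mul _) (hG.const_mul _)] at key
  simp only [integral_const_mul] at key ⊢
  rw [h.integral_inner_self] at key
  linarith

/-- The lower bound for the derivative of the frequency. -/
theorem frequency (h : DriftInequality g φ u v c) :
    -(c ^ 2 * ((∫ x, ‖u x‖ ^ 2 ∂(weightedVolume g φ))
        * ((∫ x, ‖u x‖ ^ 2 ∂(weightedVolume g φ))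
          - -∫ x, gradNormSq g u x ∂(weightedVolume g φ))))
      ≤ (-∫ x, 2 * gradDot g u v x ∂(weightedVolume g φ))
          * (∫ x, ‖u x‖ ^ 2 ∂(weightedVolume g φ))
        - (-∫ x, gradNormSq g u x ∂(weightedVolume g φ))
          * ∫ x, 2 * inner ℝ (u x) (v x) ∂(weightedVolume g φ) := by
  have hI := h.integrable_normSq
  have hG := h.integrable_gradNormSq
  have hp := h.integrable_normSq_deriv
  have hr := h.integrable_normSq_driftLaplacian
  have hy := integrable_inner_of_normSq h.smooth.continuous h.continuous_driftLaplacian hI hr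
  have hx := integrable_inner_of_normSq h.smooth.continuous h.smooth_deriv.continuous hI hp
  have hz := integrable_inner_of_normSq h.smooth_deriv.continuous h.continuous_driftLaplacian hp hr
  -- Cauchy-Schwarz for `u` and `v + Lu`, the nonnegative part of the polarized expression.
  have cs : (∫ x, (inner ℝ (u x) (v x) + inner ℝ (u x) (driftLaplacian g φ u x))
          ∂(weightedVolume g φ)) ^ 2
      ≤ (∫ x, ‖u x‖ ^ 2 ∂(weightedVolume g φ))
        * ∫ x, (‖v x‖ ^ 2 + 2 * inner ℝ (v x) (driftLaplacian g φ u x)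
            + ‖driftLaplacian g φ u x‖ ^ 2) ∂(weightedVolume g φ) := by
    have e : ∀ x, ‖v x‖ ^ 2 + 2 * inner ℝ (v x) (driftLaplacian g φ u x)
        + ‖driftLaplacian g φ u x‖ ^ 2 = ‖v x + driftLaplacian g φ u x‖ ^ 2 := fun x =>
      (norm_add_sq_real _ _).symm
    refine integral_sq_le_mul (hx.add hy) hI ((hp.add (hz.const_mul 2)).add hr)
      (fun _ => sq_nonneg _) (fun x => (e x).symm ▸ sq_nonneg _) fun x => ?_
    rw [e, ← inner_add_right]
    exact inner_sq_le _ _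
  -- The part with `v - Lu`, controlled by the differential inequality. Its factor `2` meets the `½`
  -- of the polarization, leaving exactly `c²`.
  have hf : ∫ x, (‖v x‖ ^ 2 - 2 * inner ℝ (v x) (driftLaplacian g φ u x)
        + ‖driftLaplacian g φ u x‖ ^ 2) ∂(weightedVolume g φ)
      ≤ ∫ x, 2 * c ^ 2 * (‖u x‖ ^ 2 + gradNormSq g u x) ∂(weightedVolume g φ) := by
    refine integral_mono ((hp.sub (hz.const_mul 2)).add hr) ((hI.add hG).const_mul _) fun x => ?_
    dsimp only
    rw [← norm_sub_sq_real]
    exact normSq_le_of_norm_le (h.le x)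
  rw [integral_add hx hy, integral_add (hp.fun_add (hz.const_mul 2)) hr,
    integral_add hp (hz.const_mul 2)] at cs
  have hpz : Integrable (fun x => ‖v x‖ ^ 2 - 2 * inner ℝ (v x) (driftLaplacian g φ u x))
      (weightedVolume g φ) := hp.sub (hz.const_mul 2)
  rw [integral_add hpz hr, integral_sub hp (hz.const_mul 2)] at hf
  simp only [integral_const_mul] at cs hf ⊢
  rw [integral_add hI hG] at hf
  have h1 := h.integral_inner_self
  have h2 := h.integral_inner_deriv
  rw [h1, h2] at cs
  rw [h2] at hf
  have h0 : 0 ≤ ∫ x, ‖u x‖ ^ 2 ∂(weightedVolume g φ) := integral_nonneg fun _ => sq_nonneg _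
  have h3 := mul_le_mul_of_nonneg_left hf h0
  -- The square is `(∫⟨u, v - Lu⟩)²`, the term of the polarization that is dropped.
  nlinarith [sq_nonneg ((∫ x, inner ℝ (u x) (v x) ∂(weightedVolume g φ))
    + ∫ x, gradNormSq g u x ∂(weightedVolume g φ))]

end DriftInequality

end Slice

end DriftHeat

/-! ### Evolution of the energies. -/

namespace DriftHeat

section Evolution

variable {n N : ℕ} {M : Type*} [TopologicalSpace M]
  [ChartedSpace (EuclideanSpace ℝ (Fin n)) M] [IsManifold (𝓡 n) ∞ M]
  [T2Space M] [SecondCountableTopology M] [MeasurableSpace M] [BorelSpace M]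
  {g : RMetric n M} {φ : M → ℝ} {a b : ℝ} {u : M → ℝ → EuclideanSpace ℝ (Fin N)} {C : ℝ → ℝ}

theorem energyI_eq (hφ : Continuous φ) (f : M → EuclideanSpace ℝ (Fin N)) :
    energyI g φ f = ∫ x, ‖f x‖ ^ 2 ∂(weightedVolume g φ) :=
  (integral_weightedVolume hφ _).symm

theorem energyD_eq (hφ : Continuous φ) (f : M → EuclideanSpace ℝ (Fin N)) :
    energyD g φ f = -∫ x, gradNormSq g f x ∂(weightedVolume g φ) :=
  congrArg Neg.neg (integral_weightedVolume hφ _).symm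

theorem energyI_nonneg (hφ : Continuous φ) (f : M → EuclideanSpace ℝ (Fin N)) :
    0 ≤ energyI g φ f := by
  rw [energyI_eq hφ]
  exact integral_nonneg fun _ => sq_nonneg _

theorem energyD_nonpos (hφ : Continuous φ) (f : M → EuclideanSpace ℝ (Fin N)) :
    energyD g φ f ≤ 0 := by
  rw [energyD_eq hφ]
  exact neg_nonpos.2 (integral_nonneg fun x => gradNormSq_nonneg g f x)

/-- The domination `|2⟨u, u_t⟩| ≤ |u|² + |u_t|²` has the form needed for differentiation under the
integral, with `|u_t|²` integrable over space and time. -/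
theorem energyI_deriv (hφ : Continuous φ) (hab : a < b) (hu : SmoothOnTime n a b u)
    (hW : ∀ t ∈ Set.Icc a b, MemSobolev g φ (fun x => u x t))
    (hWt_int : ∫⁻ t in Set.Icc a b, sobolevSq g φ (timeDeriv a b u t) < ⊤) :
    IntervalIntegrable
        (fun t => ∫ x, 2 * inner ℝ (u x t) (timeDeriv a b u t x) ∂(weightedVolume g φ))
        volume a b ∧
      ∀ t ∈ Set.Icc a b, energyI g φ (fun x => u x t) = energyI g φ (fun x => u x a)
        + ∫ s in a..t, ∫ x, 2 * inner ℝ (u x s) (timeDeriv a b u s x) ∂(weightedVolume g φ) := by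
  have := isLocallyFiniteMeasure_weightedVolume (g := g) hφ
  have hut := smoothOnTime_timeDeriv hab hu
  simp only [energyI_eq hφ]
  refine integral_eq_add_integral_deriv (B := fun x t => ‖timeDeriv a b u t x‖ ^ 2) hab.le
    (fun x t ht => hasDerivWithinAt_normSq hu x ht) (hu.continuousOn.norm.pow 2)
    (continuousOn_const.mul (hu.continuousOn.inner hut.continuousOn))
    (hut.continuousOn.norm.pow 2) (fun _ _ => sq_nonneg _) (fun _ _ => sq_nonneg _)
    (fun x t _ => ?_) (fun t ht => ?_) ?_
  · rw [abs_mul, abs_two]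
    have := abs_real_inner_le_norm (u x t) (timeDeriv a b u t x)
    nlinarith [sq_nonneg (‖u x t‖ - ‖timeDeriv a b u t x‖)]
  · exact integrable_normSq hφ (hu.slice ht) ((hW t ht).sobolevSq_lt_top hφ (hu.slice ht))
  · refine lt_of_le_of_lt (setLIntegral_mono' measurableSet_Icc fun t ht => ?_) hWt_int
    rw [sobolevSq_eq hφ (hut.slice ht)]
    exact lintegral_mono fun x => ENNReal.ofReal_le_ofReal
      (le_add_of_nonneg_right (gradNormSq_nonneg g _ x))

/-- Same scheme with `|∇u_t|²` as the integrable term, so the gradient part of the time-integrated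
Sobolev norm is used here. -/
theorem energyD_deriv (hφ : Continuous φ) (hab : a < b) (hu : SmoothOnTime n a b u)
    (hW : ∀ t ∈ Set.Icc a b, MemSobolev g φ (fun x => u x t))
    (hWt_int : ∫⁻ t in Set.Icc a b, sobolevSq g φ (timeDeriv a b u t) < ⊤) :
    IntervalIntegrable (fun t => -∫ x, 2 * gradDot g (fun y => u y t) (timeDeriv a b u t) x
        ∂(weightedVolume g φ)) volume a b ∧
      ∀ t ∈ Set.Icc a b, energyD g φ (fun x => u x t) = energyD g φ (fun x => u x a)
        + ∫ s in a..t, -∫ x, 2 * gradDot g (fun y => u y s) (timeDeriv a b u s) x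
          ∂(weightedVolume g φ) := by
  have := isLocallyFiniteMeasure_weightedVolume (g := g) hφ
  have hut := smoothOnTime_timeDeriv hab hu
  simp only [energyD_eq hφ]
  have key := integral_eq_add_integral_deriv (μ := weightedVolume g φ)
    (q := fun x t => gradNormSq g (fun y => u y t) x)
    (q' := fun x t => 2 * gradDot g (fun y => u y t) (timeDeriv a b u t) x)
    (B := fun x t => gradNormSq g (timeDeriv a b u t) x) hab.le
    (fun x t ht => hasDerivWithinAt_gradNormSq g hab hu x ht)
    (continuousOn_gradDot_time g hab hu hu)
    ((continuousOn_gradDot_time g hab hu hut).const_mul 2 :)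
    (continuousOn_gradDot_time g hab hut hut) (fun x _ => gradNormSq_nonneg g _ x)
    (fun x _ => gradNormSq_nonneg g _ x)
    (fun x t _ => ?_) (fun t ht => ?_) ?_
  · refine ⟨key.1.neg, fun t ht => ?_⟩
    rw [key.2 t ht, intervalIntegral.integral_neg]
    ring
  · have h1 := gradDot_sq_le g (fun y => u y t) (timeDeriv a b u t) x
    have h2 := gradNormSq_nonneg g (fun y => u y t) x
    have h3 := gradNormSq_nonneg g (timeDeriv a b u t) x
    refine abs_le_of_sq_le_sq ?_ (add_nonneg h2 h3)
    nlinarith [sq_nonneg (gradNormSq g (fun y => u y t) x - gradNormSq g (timeDeriv a b u t) x)]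
  · exact integrable_gradNormSq hφ (hu.slice ht) ((hW t ht).sobolevSq_lt_top hφ (hu.slice ht))
  · refine lt_of_le_of_lt (setLIntegral_mono' measurableSet_Icc fun t ht => ?_) hWt_int
    rw [sobolevSq_eq hφ (hut.slice ht)]
    exact lintegral_mono fun x => ENNReal.ofReal_le_ofReal
      (le_add_of_nonneg_left (sq_nonneg _))

/-- The energy at the final time is bounded below in terms of the energy and of the frequency at
any earlier time. -/
theorem energyI_lower_bound (hφ : ContMDiff (𝓡 n) 𝓘(ℝ, ℝ) ∞ φ) (hab : a < b)
    (hu : SmoothOnTime n a b u)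
    (hW : ∀ t ∈ Set.Icc a b, MemSobolev g φ (fun x => u x t))
    (hWt : ∀ t ∈ Set.Icc a b, MemSobolev g φ (timeDeriv a b u t))
    (hWt_int : ∫⁻ t in Set.Icc a b, sobolevSq g φ (timeDeriv a b u t) < ⊤)
    (hC0 : ∀ t ∈ Set.Icc a b, 0 ≤ C t)
    (hC : AEMeasurable C (volume.restrict (Set.Icc a b)))
    (hCb : BddAbove (C '' Set.Icc a b))
    (heq : ∀ t ∈ Set.Icc a b, ∀ x : M,
      ‖timeDeriv a b u t x - driftLaplacian g φ (fun y => u y t) x‖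
        ≤ C t * (‖u x t‖ + Real.sqrt (gradNormSq g (fun y => u y t) x)))
    {r : ℝ} (hr : r ∈ Set.Icc a b) :
    energyI g φ (fun x => u x r) * Real.exp (((2 + sSup (C '' Set.Icc a b)) *
        (Real.exp (∫ s in a..b, C s ^ 2) * (frequencyU g φ (fun x => u x r) - 1) + 1)
          - 3 * sSup (C '' Set.Icc a b)) * (b - r))
      ≤ energyI g φ (fun x => u x b) := by
  have hφc := hφ.continuous
  have hCK : ∀ t ∈ Set.Icc a b, C t ≤ sSup (C '' Set.Icc a b) := fun t ht =>
    le_csSup hCb (Set.mem_image_of_mem C ht)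
  have hC2 := intervalIntegrable_sq_of_bounded hab.le hC hC0 hCK
  obtain ⟨hi, hI⟩ := energyI_deriv hφc hab hu hW hWt_int
  obtain ⟨hd, hD⟩ := energyD_deriv hφc hab hu hW hWt_int
  set i : ℝ → ℝ := fun t => ∫ x, 2 * inner ℝ (u x t) (timeDeriv a b u t x) ∂(weightedVolume g φ)
    with hi_def
  set d : ℝ → ℝ := fun t => -∫ x, 2 * gradDot g (fun y => u y t) (timeDeriv a b u t) x
    ∂(weightedVolume g φ) with hd_def
  have hsub : Set.Icc r b ⊆ Set.Icc a b := Set.Icc_subset_Icc_left hr.1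
  have base : ∀ {F f : ℝ → ℝ}, IntervalIntegrable f volume a b →
      (∀ t ∈ Set.Icc a b, F t = F a + ∫ s in a..t, f s) →
      ∀ t ∈ Set.Icc r b, F r + ∫ s in r..t, f s = F t := fun {F f} hf hF t ht => by
    have h1 : ∀ s ∈ Set.Icc a b, IntervalIntegrable f volume a s := fun s hs =>
      hf.mono_set (Set.uIcc_subset_uIcc_left (Set.uIcc_of_le hab.le ▸ hs))
    rw [hF t (hsub ht), hF r hr, add_assoc, intervalIntegral.integral_add_adjacent_intervals
      (h1 r hr) ((h1 r hr).symm.trans (h1 t (hsub ht)))]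
  have mono : ∀ {f : ℝ → ℝ}, IntervalIntegrable f volume a b → IntervalIntegrable f volume r b :=
    fun {f} hf => hf.mono_set (Set.uIcc_subset_uIcc_right (Set.uIcc_of_le hab.le ▸ hr))
  have hI' : ∀ t ∈ Set.Icc r b, energyI g φ (fun x => u x r) + ∫ s in r..t, i s
      = energyI g φ (fun x => u x t) := base (F := fun t => energyI g φ fun x => u x t) hi hI
  have hD' : ∀ t ∈ Set.Icc r b, energyD g φ (fun x => u x r) + ∫ s in r..t, d s
      = energyD g φ (fun x => u x t) := base (F := fun t => energyD g φ fun x => u x t) hd hD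
  have data : ∀ t ∈ Set.Icc a b,
      DriftInequality g φ (fun x => u x t) (timeDeriv a b u t) (C t) := fun t ht =>
    ⟨hφ, hu.slice ht, (smoothOnTime_timeDeriv hab hu).slice ht, hW t ht, hWt t ht, hC0 t ht,
      heq t ht⟩
  have hrr : r ∈ Set.Icc r b := Set.left_mem_Icc.2 hr.2
  -- The one-variable lemma wants primitives on all of `ℝ`, whereas the energies are controlled only
  -- on `[a, b]`. They are replaced by primitives that agree with them on `[r, b]`.
  have key := energy_lower_bound
    (I := fun t => energyI g φ (fun x => u x r) + ∫ s in r..t, i s)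
    (D := fun t => energyD g φ (fun x => u x r) + ∫ s in r..t, d s)
    hr.2 (mono hi) (mono hd) (fun t => by simp) (fun t => by simp) (mono hC2)
    (fun t ht => hC0 t (hsub ht)) (fun t ht => hCK t (hsub ht))
    (fun t ht => (hI' t ht).symm ▸ energyI_nonneg hφc _)
    (fun t ht => (hD' t ht).symm ▸ energyD_nonpos hφc _) (fun t ht => ?_) (fun t ht => ?_)
    (L := ∫ s in a..b, C s ^ 2) ?_
  · simpa only [frequencyU, hI' r hrr, hD' r hrr, hI' b (Set.right_mem_Icc.2 hr.2)] using key
  · simp only [hI' t ht, hD' t ht]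
    simp only [energyI_eq hφc, energyD_eq hφc]
    exact (data t (hsub ht)).frequency
  · simp only [hI' t ht, hD' t ht]
    simp only [energyI_eq hφc, energyD_eq hφc]
    exact (data t (hsub ht)).growth
  · exact intervalIntegral.integral_mono_interval hr.1 hr.2 le_rfl
      (Filter.Eventually.of_forall fun s => sq_nonneg _) hC2

/-- Vanishing almost everywhere becomes vanishing everywhere, since `f` is continuous and the
weighted measure charges every nonempty open set. Membership in the Sobolev space rules out that the
integral is zero merely by divergence. -/
theorem eq_zero_of_energyI_eq_zero (hφ : Continuous φ) {f : M → EuclideanSpace ℝ (Fin N)}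
    (hf : SmoothMap n f) (h : MemSobolev g φ f) (h0 : energyI g φ f = 0) (x : M) : f x = 0 := by
  have := isOpenPosMeasure_weightedVolume (g := g) hφ
  rw [energyI_eq hφ, integral_eq_zero_iff_of_nonneg (fun _ => sq_nonneg _)
    (integrable_normSq hφ hf (h.sobolevSq_lt_top hφ hf))] at h0
  have h1 := Continuous.ae_eq_iff_eq _ (hf.continuous.norm.pow 2) continuous_zero |>.1 h0
  simpa using congrFun h1 x

end Evolution

end DriftHeat

/-! ### The theorem. -/

open DriftHeat in
theorem corollary3p2 {n N : ℕ} {M : Type*} [TopologicalSpace M] [T2Space M]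
    [SecondCountableTopology M] [ChartedSpace (EuclideanSpace ℝ (Fin n)) M]
    [IsManifold (𝓡 n) ∞ M] [MeasurableSpace M] [BorelSpace M]
    (g : RMetric n M) (φ : M → ℝ) (hφ : ContMDiff (𝓡 n) 𝓘(ℝ, ℝ) ∞ φ)
    (a b : ℝ) (hab : a < b)
    (u : M → ℝ → EuclideanSpace ℝ (Fin N))
    (hu : ContMDiffOn ((𝓡 n).prod 𝓘(ℝ, ℝ)) 𝓘(ℝ, EuclideanSpace ℝ (Fin N)) ∞
      (fun p : M × ℝ => u p.1 p.2) (Set.univ ×ˢ Set.Icc a b))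
    (hW : ∀ t ∈ Set.Icc a b, MemSobolev g φ (fun x => u x t))
    (hWt : ∀ t ∈ Set.Icc a b, MemSobolev g φ (timeDeriv a b u t))
    (hWt_int : ∫⁻ t in Set.Icc a b, sobolevSq g φ (timeDeriv a b u t) < ⊤)
    (C : ℝ → ℝ) (hC0 : ∀ t ∈ Set.Icc a b, 0 ≤ C t)
    (hC : AEMeasurable C (volume.restrict (Set.Icc a b)))
    (hCb : BddAbove (C '' Set.Icc a b))
    (heq : ∀ t ∈ Set.Icc a b, ∀ x : M,
      ‖timeDeriv a b u t x - driftLaplacian g φ (fun y => u y t) x‖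
        ≤ C t * (‖u x t‖ + Real.sqrt (gradNormSq g (fun y => u y t) x))) :
    energyI g φ (fun x => u x a) *
        Real.exp ((b - a) * (2 + sSup (C '' Set.Icc a b)) *
          (Real.exp (∫ s in a..b, C s ^ 2) * (frequencyU g φ (fun x => u x a) - 1) + 1
            - 3 / 2 * sSup (C '' Set.Icc a b)))
      ≤ energyI g φ (fun x => u x b) ∧
    ((∀ x : M, u x b = 0) → ∀ t ∈ Set.Icc a b, ∀ x : M, u x t = 0) := by
  have hφc := hφ.continuous
  have haI := Set.left_mem_Icc.2 hab.le
  have hbI := Set.right_mem_Icc.2 hab.le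
  have bound := fun {r : ℝ} (hr : r ∈ Set.Icc a b) =>
    energyI_lower_bound hφ hab hu hW hWt hWt_int hC0 hC hCb heq hr
  refine ⟨(mul_le_mul_of_nonneg_left (Real.exp_le_exp.2 ?_)
    (energyI_nonneg hφc _)).trans (bound haI), fun h0 t ht x => ?_⟩
  -- The exponent obtained from `energyI_lower_bound` exceeds the stated one by `(3/2) K² (b - a)`,
  -- because `(2 + K)(3/2)K = 3K + (3/2)K²`.
  · have hK : 0 ≤ sSup (C '' Set.Icc a b) :=
      (hC0 a haI).trans (le_csSup hCb (Set.mem_image_of_mem C haI))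
    nlinarith [mul_nonneg (sub_nonneg.2 hab.le) (sq_nonneg (sSup (C '' Set.Icc a b)))]
  -- The bound started at time `t` gives `I(t)` times a positive number at most `I(b) = 0`.
  · refine eq_zero_of_energyI_eq_zero hφc (SmoothOnTime.slice hu ht) (hW t ht) ?_ x
    have h1 : energyI g φ (fun x => u x b) = 0 := by simp [energyI, h0]
    have h2 := bound ht
    rw [h1] at h2
    exact le_antisymm (nonpos_of_mul_nonpos_left h2 (Real.exp_pos _)) (energyI_nonneg hφc _)
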